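/- **Setting.** Consider the two-sorted language of bounded arithmetic with a number sort and a string sort (strings are finite sets of numbers) and the symbols $0, s, +, \cdot, |X|, \le, X(i)$ (also written $i\in X$). $\Sigma^B_0$ formulas have no string quantifiers and only bounded number quantifiers. $V^0$ consists of the axioms $BASIC_2$ of Cook and Nguyen together with $\Sigma^B_0$-comprehension ($\exists Y\,(|Y|\le a\wedge\forall z<a\,(Y(z)\leftrightarrow\varphi(z)))$ for $\varphi\in\Sigma^B_0$ with parameters), and $VP=V^0+MCV$, where, with $E(y,x)$ standing for $E(\langle y,x\rangle)$ and $\langle x,y\rangle=(x+y)(x+y+1)+2y$, $$MCV\equiv\forall a\,\forall C,E\,\exists Y\Big(\neg Y(0)\wedge Y(1)\wedge\forall x<a\,\big(x\ge 2\to(Y(x)\leftrightarrow[(C(x)\wedge\forall y<x\,(E(y,x)\to Y(y)))\vee(\neg C(x)\wedge\exists y<x\,(E(y,x)\wedge Y(y)))])\big)\Big).$$ Let $(M_0,M)\models VP$ and $n\in M_0$. Let $\mathbb C$ be the set of Boolean circuits with inputs $p_0,\dots,p_{n-1}$ (and unbounded fan-in) that are coded by strings in $M$. Let $\le$ be one of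 the following two orders on $\mathbb C$: * $C\le_A C'$ iff in $(M_0,M)$ every assignment $A$ of truth values to $p_0,\dots,p_{n-1}$ satisfies $eval(C,A)\le eval(C',A)$; * $C\le_{EF}C'$ iff some element of $M$ is an Extended Frege proof of $C\to C'$. Let $\mathbb B$ be $\mathbb C$ modulo the equivalence $C\le C'\wedge C'\le C$. An ideal $I\subseteq\mathbb B$ is a set with $0\in I$, $1\notin I$ that is closed under $\vee$ and downward closed; a filter $F\subseteq\mathbb B$ is a set with $1\in F$, $0\notin F$ that is closed under $\wedge$ and upward closed. $X:a\to\mathbb B$ means that $a\in M_0$ and $X\in M$ codes a sequence $X(0),\dots,X(a-1)$ of circuits in $\mathbb C$. An ideal $I$ is $M_0$-complete if, for all $a\in M_0$ and $X:a\to\mathbb B$ such that $X(i)\in I$ for all $i<a$, the (class of the) circuit $\bigvee_{i<a}X(i)$ is in $I$. A set $D\subseteq\mathbb B$ is definable if it is the set of classes of the $C\in\mathbb C$ satisfying a formula in $(M_0,M)$ with parameters, and it is dense over $I$ if for every $X\in\mathbb B\setminus I$ there is $X'\in D\setminus I$ with $X'\le X$. A filter $G\subseteq\mathbb B$ is $\mathcal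 M$-generic over $I$ if $(D\setminus I)\cap G\ne\emptyset$ for every definable $D$ that is dense over $I$. For $X:a\to\mathbb B$ put $i_G(X)=\{y<a: X(y)\in G\}$, and let $M[G]$ be the set of all $i_G(X)$, where $a\in M_0$ and $X:a\to\mathbb B$. The pair $(M_0,M[G])$ is a two-sorted structure: its numbers are those of $M_0$ with the same operations and order, $\in$ is membership, and $|T|$ is the least strict upper bound of $T$ in $M_0$. **Theorem.** For either choice of $\le$, every $M_0$-complete ideal $I\subseteq\mathbb B$ and every $G\subseteq\mathbb B$ that is $\mathcal M$-generic over $I$, $$(M_0,M[G])\models VP.$$ -/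

import Mathlib

/-! Two-sorted bounded arithmetic, circuits coded in a two-sorted structure, the Boolean algebras of
circuits, and the generic extension. -/

universe u v

namespace TwoSorted

/-! ### Structures and formulas of the two-sorted language -/

/-- Structures for the two-sorted language `0, s, +, ·, |X|, ≤, ∈`: `N` is the number sort and `S` is
the string sort. Equality of either sort is interpreted as true equality. -/
structure Model (N : Type u) (S : Type v) where
  zero : N
  succ : N → N
  add : N → N → N
  mul : N → N → N
  le : N → N → Prop
  len : S → N
  mem : N → S → Prop

/-- Number terms. Variables of either sort are named by natural numbers. -/
inductive NumTerm : Type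
  | var (x : ℕ)
  | zero
  | succ (t : NumTerm)
  | add (t t' : NumTerm)
  | mul (t t' : NumTerm)
  | len (X : ℕ)

/-- Formulas. The bounding term of a bounded quantifier lies outside the scope of the quantifier. -/
inductive Fml : Type
  | eq (t t' : NumTerm)
  | le (t t' : NumTerm)
  | mem (t : NumTerm) (X : ℕ)
  | strEq (X Y : ℕ)
  | neg (φ : Fml)
  | and (φ ψ : Fml)
  | or (φ ψ : Fml)
  | ballNum (x : ℕ) (t : NumTerm) (φ : Fml)
  | bexNum (x : ℕ) (t : NumTerm) (φ : Fml)
  | allNum (x : ℕ) (φ : Fml)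
  | exNum (x : ℕ) (φ : Fml)
  | allStr (X : ℕ) (φ : Fml)
  | exStr (X : ℕ) (φ : Fml)

/-- `Σ₀ᴮ` formulas: no string quantifiers, and only bounded number quantifiers. -/
def Fml.IsSigmaZeroB : Fml → Prop
  | .eq _ _ => True
  | .le _ _ => True
  | .mem _ _ => True
  | .strEq _ _ => True
  | .neg φ => φ.IsSigmaZeroB
  | .and φ ψ => φ.IsSigmaZeroB ∧ ψ.IsSigmaZeroB
  | .or φ ψ => φ.IsSigmaZeroB ∧ ψ.IsSigmaZeroB
  | .ballNum _ _ φ => φ.IsSigmaZeroB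
  | .bexNum _ _ φ => φ.IsSigmaZeroB
  | .allNum _ _ => False
  | .exNum _ _ => False
  | .allStr _ _ => False
  | .exStr _ _ => False

namespace Model

variable {N : Type u} {S : Type v}

/-- `x < y` abbreviates `x ≤ y ∧ x ≠ y`. -/
def lt (M : Model N S) (x y : N) : Prop := M.le x y ∧ x ≠ y

/-- The value of a term. -/
def termVal (M : Model N S) (ν : ℕ → N) (σ : ℕ → S) : NumTerm → N
  | .var x => ν x
  | .zero => M.zero
  | .succ t => M.succ (M.termVal ν σ t)
  | .add t t' => M.add (M.termVal ν σ t) (M.termVal ν σ t')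
  | .mul t t' => M.mul (M.termVal ν σ t) (M.termVal ν σ t')
  | .len X => M.len (σ X)

/-- Tarski satisfaction. -/
def Realize (M : Model N S) : Fml → (ℕ → N) → (ℕ → S) → Prop
  | .eq t t', ν, σ => M.termVal ν σ t = M.termVal ν σ t'
  | .le t t', ν, σ => M.le (M.termVal ν σ t) (M.termVal ν σ t')
  | .mem t X, ν, σ => M.mem (M.termVal ν σ t) (σ X)
  | .strEq X Y, _, σ => σ X = σ Y
  | .neg φ, ν, σ => ¬ M.Realize φ ν σ
  | .and φ ψ, ν, σ => M.Realize φ ν σ ∧ M.Realize ψ ν σ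
  | .or φ ψ, ν, σ => M.Realize φ ν σ ∨ M.Realize ψ ν σ
  | .ballNum x t φ, ν, σ =>
      ∀ m, M.lt m (M.termVal ν σ t) → M.Realize φ (Function.update ν x m) σ
  | .bexNum x t φ, ν, σ =>
      ∃ m, M.lt m (M.termVal ν σ t) ∧ M.Realize φ (Function.update ν x m) σ
  | .allNum x φ, ν, σ => ∀ m, M.Realize φ (Function.update ν x m) σ
  | .exNum x φ, ν, σ => ∃ m, M.Realize φ (Function.update ν x m) σ
  | .allStr X φ, ν, σ => ∀ Z, M.Realize φ ν (Function.update σ X Z)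
  | .exStr X φ, ν, σ => ∃ Z, M.Realize φ ν (Function.update σ X Z)

/-! ### The theories `V⁰` and `VP` -/

/-- The axioms `BASIC₂` of Cook and Nguyen. -/
structure Basic (M : Model N S) : Prop where
  b1 : ∀ x, M.succ x ≠ M.zero
  b2 : ∀ x y, M.succ x = M.succ y → x = y
  b3 : ∀ x, M.add x M.zero = x
  b4 : ∀ x y, M.add x (M.succ y) = M.succ (M.add x y)
  b5 : ∀ x, M.mul x M.zero = M.zero
  b6 : ∀ x y, M.mul x (M.succ y) = M.add (M.mul x y) x
  b7 : ∀ x y, M.le x y → M.le y x → x = y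
  b8 : ∀ x y, M.le x (M.add x y)
  b9 : ∀ x, M.le M.zero x
  b10 : ∀ x y, M.le x y ∨ M.le y x
  b11 : ∀ x y, M.le x y ↔ M.lt x (M.succ y)
  b12 : ∀ x, x ≠ M.zero → ∃ y, M.le y x ∧ M.succ y = x
  l1 : ∀ X y, M.mem y X → M.lt y (M.len X)
  l2 : ∀ X y, M.succ y = M.len X → M.mem y X
  se : ∀ X Y, M.len X = M.len Y → (∀ i, M.lt i (M.len X) → (M.mem i X ↔ M.mem i Y)) → X = Y

/-- `Σ₀ᴮ-COMP`: for every `Σ₀ᴮ` formula `φ(z)`, with parameters of both sorts, and every `a` there is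
`Y` with `|Y| ≤ a` and `∀ z < a (Y(z) ↔ φ(z))`. -/
def Comp (M : Model N S) : Prop :=
  ∀ φ : Fml, φ.IsSigmaZeroB → ∀ (ν : ℕ → N) (σ : ℕ → S) (z : ℕ) (a : N),
    ∃ Y, M.le (M.len Y) a ∧
      ∀ m, M.lt m a → (M.mem m Y ↔ M.Realize φ (Function.update ν z m) σ)

/-- `V⁰` is `BASIC₂` together with `Σ₀ᴮ-COMP`. -/
def VZero (M : Model N S) : Prop := M.Basic ∧ M.Comp

/-- The number `1`. -/
def one (M : Model N S) : N := M.succ M.zero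

/-- The number `2`. -/
def two (M : Model N S) : N := M.succ M.one

/-- The number `3`. -/
def three (M : Model N S) : N := M.succ M.two

/-- The pairing term `⟨x, y⟩ = (x + y)(x + y + 1) + 2y`. -/
def pair (M : Model N S) (x y : N) : N :=
  M.add (M.mul (M.add x y) (M.succ (M.add x y))) (M.mul M.two y)

/-- The formula `δ_MCV(a, C, E, Y)`; here `E(y, x)` stands for `⟨y, x⟩ ∈ E`. -/
def DeltaMCV (M : Model N S) (a : N) (C E Y : S) : Prop :=
  ¬ M.mem M.zero Y ∧ M.mem M.one Y ∧
    ∀ x, M.lt x a → M.le M.two x →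
      (M.mem x Y ↔
        ((M.mem x C ∧ ∀ y, M.lt y x → M.mem (M.pair y x) E → M.mem y Y) ∨
          (¬ M.mem x C ∧ ∃ y, M.lt y x ∧ M.mem (M.pair y x) E ∧ M.mem y Y)))

/-- The monotone circuit value axiom. -/
def MCV (M : Model N S) : Prop := ∀ (a : N) (C E : S), ∃ Y, M.DeltaMCV a C E Y

/-- `M ⊨ VP`, where `VP = V⁰ + MCV`. -/
def VP (M : Model N S) : Prop := M.VZero ∧ M.MCV

/-! ### Boolean circuits coded by strings

A set `T` of numbers is read as the code of a Boolean circuit with inputs `p_0, …, p_{n-1}`. Its gates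
are numbers. A gate `x < n` is the input `p_x`. A gate `x ≥ n` is a conjunction or a disjunction,
possibly negated, of the gates `y < x` that have an edge to `x`. So the constants are gates without
incoming edges, and negation is a negated gate with one incoming edge. -/

/-- The set of positions of the bits of a string that are `1`. -/
def bits (M : Model N S) (Z : S) : Set N := {j | M.mem j Z}

/-- The `i`-th row of `X`, that is, the `i`-th term of the sequence of strings coded by `X`. -/
def row (M : Model N S) (X : S) (i : N) : Set N := {j | M.mem (M.pair i j) X}

/-- The gate `x` is a (possibly negated) conjunction. Otherwise it is a (possibly negated)
disjunction. -/
def IsAnd (M : Model N S) (T : Set N) (x : N) : Prop := M.pair M.zero x ∈ T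

/-- The gate `x` is negated. -/
def IsNeg (M : Model N S) (T : Set N) (x : N) : Prop := M.pair M.one x ∈ T

/-- There is an edge from the gate `y` to the gate `x`. -/
def Edge (M : Model N S) (T : Set N) (y x : N) : Prop :=
  M.lt y x ∧ M.pair M.two (M.pair y x) ∈ T

/-- The gate `x` is an output gate. -/
def IsOut (M : Model N S) (T : Set N) (x : N) : Prop := M.pair M.three x ∈ T

/-- `T` codes a circuit with one output. -/
def IsCircuit (M : Model N S) (T : Set N) : Prop := ∃! o, M.IsOut T o

/-- The value of the gate `x` computed from the values of the preceding gates; `Y` is the set of the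
gates with value `1`. -/
def GateVal (M : Model N S) (T Y : Set N) (x : N) : Prop :=
  Xor (M.IsNeg T x)
    ((M.IsAnd T x ∧ ∀ y, M.Edge T y x → y ∈ Y) ∨ (¬ M.IsAnd T x ∧ ∃ y, M.Edge T y x ∧ y ∈ Y))

/-- `Y` is the computation of the circuit `T` on the input `A`, up to the gate `o`. -/
def IsComputation (M : Model N S) (n : N) (T A Y : Set N) (o : N) : Prop :=
  ∀ x, M.le x o →
    (M.lt x n → (x ∈ Y ↔ x ∈ A)) ∧ (M.le n x → (x ∈ Y ↔ M.GateVal T Y x))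

/-- `eval(T, A) = 1`, with the computation being an element of the model. -/
def Eval (M : Model N S) (n : N) (T : Set N) (A : S) : Prop :=
  ∃ (o : N) (Y : S), M.IsOut T o ∧ M.IsComputation n T (M.bits A) (M.bits Y) o ∧ M.mem o Y

/-- The circuits coded in the model. -/
def Circ (M : Model N S) : Type v := {Z : S // M.IsCircuit (M.bits Z)}

/-- The code of a circuit as a set of numbers. -/
def Circ.code {M : Model N S} (C : M.Circ) : Set N := M.bits C.1

/-! ### The two orders on circuits -/

/-- `C ≤_A C'`: in the model, `eval(C, A) ≤ eval(C', A)` for every assignment `A` to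
`p_0, …, p_{n-1}`. -/
def leA (M : Model N S) (n : N) (C C' : M.Circ) : Prop :=
  ∀ A : S, M.le (M.len A) n → M.Eval n C.code A → M.Eval n C'.code A

/-- The axioms of extended Frege, in sequent form. For every gate `x` of each circuit `D k` there is
a variable `q_{k,x}`. A sequent is given by the set `Γ` of its literals: `Γ true k x` says that
`q_{k,x}` occurs in it on the right, `Γ false k x` that `q_{k,x}` occurs in it on the left. The axioms
say that `q_{k,x}` is the input `p_x` if `x < n`, and they are the extension axioms defining
`q_{k,x}` from the variables of the gates below `x` if `n ≤ x`. In the latter case the boolean `s` is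
`false` exactly if the gate is negated, so that `Γ s k x` says that the literal `q_{k,x}` or
`¬ q_{k,x}` which is equivalent to the conjunction or disjunction at `x` belongs to `Γ`. The
definition allows weakening of axioms. -/
inductive EFAxiom (M : Model N S) (n : N) (D : N → Set N) (Γ : Bool → N → N → Prop) : Prop
  | identity (k x : N) (h : Γ false k x) (h' : Γ true k x)
  | input (k k' x : N) (hx : M.lt x n) (h : Γ false k x) (h' : Γ true k' x)
  | andLeft (k x y : N) (s : Bool) (hx : M.le n x) (hs : s = false ↔ M.IsNeg (D k) x)
      (hA : M.IsAnd (D k) x) (hy : M.Edge (D k) y x) (h : Γ (!s) k x) (h' : Γ true k y)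
  | andRight (k x : N) (s : Bool) (hx : M.le n x) (hs : s = false ↔ M.IsNeg (D k) x)
      (hA : M.IsAnd (D k) x) (h : ∀ y, M.Edge (D k) y x → Γ false k y) (h' : Γ s k x)
  | orLeft (k x : N) (s : Bool) (hx : M.le n x) (hs : s = false ↔ M.IsNeg (D k) x)
      (hA : ¬ M.IsAnd (D k) x) (h : Γ (!s) k x) (h' : ∀ y, M.Edge (D k) y x → Γ true k y)
  | orRight (k x y : N) (s : Bool) (hx : M.le n x) (hs : s = false ↔ M.IsNeg (D k) x)
      (hA : ¬ M.IsAnd (D k) x) (hy : M.Edge (D k) y x) (h : Γ false k y) (h' : Γ s k x)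

/-- The `l`-th sequent of the sequence coded by `Q`. -/
def line (M : Model N S) (Q : S) (l : N) : Bool → N → N → Prop :=
  fun b k x => M.mem (M.pair l (M.pair (bif b then M.one else M.zero) (M.pair k x))) Q

/-- The sequents `Γ₁` and `Γ₂` yield `Γ` by a cut on a variable (and weakening). -/
def IsCut (Γ₁ Γ₂ Γ : Bool → N → N → Prop) : Prop :=
  ∃ k x : N,
    (∀ b k' x', Γ₁ b k' x' → Γ b k' x' ∨ (b = true ∧ k' = k ∧ x' = x)) ∧
    (∀ b k' x', Γ₂ b k' x' → Γ b k' x' ∨ (b = false ∧ k' = k ∧ x' = x))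

/-- The circuits whose gates are the variables of an extended Frege proof of `C → C'`: number `0` is
`C`, number `1` is `C'`, and the others are arbitrary auxiliary circuits coded by the rows of `P`. -/
def proofCircuits (M : Model N S) (C C' : M.Circ) (P : S) (k : N) : Set N :=
  {j | (k = M.zero ∧ j ∈ C.code) ∨ (k = M.one ∧ j ∈ C'.code) ∨
    (k ≠ M.zero ∧ k ≠ M.one ∧ j ∈ M.row P k)}

/-- `(P, Q)` is an extended Frege proof of `C → C'` with last line number `m`. -/
def IsEFProof (M : Model N S) (n : N) (C C' : M.Circ) (P Q : S) (m : N) : Prop :=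
  (∀ l, M.le l m → M.EFAxiom n (M.proofCircuits C C' P) (M.line Q l) ∨
    ∃ l₁ l₂, M.lt l₁ l ∧ M.lt l₂ l ∧ IsCut (M.line Q l₁) (M.line Q l₂) (M.line Q l)) ∧
  ∃ o o', M.IsOut C.code o ∧ M.IsOut C'.code o' ∧
    ∀ b k x, M.line Q m b k x →
      (b = false ∧ k = M.zero ∧ x = o) ∨ (b = true ∧ k = M.one ∧ x = o')

/-- `C ≤_EF C'`: the model has an extended Frege proof of `C → C'`. -/
def leEF (M : Model N S) (n : N) (C C' : M.Circ) : Prop :=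
  ∃ (P Q : S) (m : N), M.IsEFProof n C C' P Q m

/-! ### Boolean-valued strings, ideals, filters and generic filters

The Boolean algebra `𝔹` is the set of circuits modulo `C = C' ↔ C ≤ C' ∧ C' ≤ C`, where `≤` is one of
the two orders above. A subset of `𝔹` is represented by the set of the circuits whose classes belong
to it, which is closed under this equivalence; for ideals and filters closure is automatic. -/

/-- `X : a → 𝔹` is a Boolean-valued string in the model: its rows `X(i)`, `i < a`, are circuits. -/
def IsBString (M : Model N S) (a : N) (X : S) : Prop :=
  ∀ i, M.lt i a → M.IsCircuit (M.row X i)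

/-- The place of the gate `x` of `X(i)` in the circuit `⋁_{i<a} X(i)`: the inputs are shared. -/
def CopyGate (M : Model N S) (n i x x' : N) : Prop :=
  (M.lt x n ∧ x' = x) ∨ (M.le n x ∧ x' = M.add n (M.pair i x))

/-- `B` is the circuit `⋁_{i<a} X(i)`: it contains copies of the circuits `X(i)`, and its output gate
is the disjunction of the copies of their output gates. -/
def IsBigOr (M : Model N S) (n a : N) (X : S) (B : Set N) : Prop :=
  (∃ o, M.IsOut B o ∧ M.le n o ∧ ¬ M.IsAnd B o ∧ ¬ M.IsNeg B o ∧
    ∀ u, M.Edge B u o ↔ ∃ i w, M.lt i a ∧ M.IsOut (M.row X i) w ∧ M.CopyGate n i w u) ∧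
  ∀ i w, M.lt i a → M.IsOut (M.row X i) w →
    ∀ x x', M.le n x → M.le x w → M.CopyGate n i x x' →
      (M.IsAnd B x' ↔ M.IsAnd (M.row X i) x) ∧ (M.IsNeg B x' ↔ M.IsNeg (M.row X i) x) ∧
      ∀ u, M.Edge B u x' ↔ ∃ y, M.Edge (M.row X i) y x ∧ M.CopyGate n i y u

/-- `I` is an ideal of `𝔹` with respect to the order `r`: it contains `0`, does not contain `1`, is
closed under binary joins, and is closed downwards. -/
structure IsIdeal (M : Model N S) (r : M.Circ → M.Circ → Prop) (I : Set M.Circ) : Prop where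
  zero_mem : ∀ C, (∀ C', r C C') → C ∈ I
  one_notMem : ∀ C, (∀ C', r C' C) → C ∉ I
  sup_mem : ∀ C₁ C₂ C, C₁ ∈ I → C₂ ∈ I →
    r C₁ C → r C₂ C → (∀ C', r C₁ C' → r C₂ C' → r C C') → C ∈ I
  lower : ∀ C C', r C C' → C' ∈ I → C ∈ I

/-- `I` is `M₀`-complete: if `X : a → 𝔹` belongs to the model and `X(i) ∈ I` for all `i < a`, then
`⋁_{i<a} X(i) ∈ I`. -/
def IsComplete (M : Model N S) (n : N) (I : Set M.Circ) : Prop :=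
  ∀ (a : N) (X : S), M.IsBString a X →
    (∀ i, M.lt i a → ∀ C : M.Circ, C.code = M.row X i → C ∈ I) →
    ∀ B : M.Circ, M.IsBigOr n a X B.code → B ∈ I

/-- `F` is a filter of `𝔹`: it contains `1`, does not contain `0`, is closed under binary meets, and is
closed upwards. -/
structure IsFilter (M : Model N S) (r : M.Circ → M.Circ → Prop) (F : Set M.Circ) : Prop where
  one_mem : ∀ C, (∀ C', r C' C) → C ∈ F
  zero_notMem : ∀ C, (∀ C', r C C') → C ∉ F
  inf_mem : ∀ C₁ C₂ C, C₁ ∈ F → C₂ ∈ F →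
    r C C₁ → r C C₂ → (∀ C', r C' C₁ → r C' C₂ → r C' C) → C ∈ F
  upper : ∀ C C', r C C' → C ∈ F → C' ∈ F

/-- `D` is a definable subset of `𝔹` (with parameters from the model). -/
def IsDefinable (M : Model N S) (r : M.Circ → M.Circ → Prop) (D : Set M.Circ) : Prop :=
  (∀ C C', r C C' → r C' C → C ∈ D → C' ∈ D) ∧
  ∃ (φ : Fml) (ν : ℕ → N) (σ : ℕ → S) (Z : ℕ),
    ∀ C : M.Circ, C ∈ D ↔ M.Realize φ ν (Function.update σ Z C.1)

/-- `D` is dense over the ideal `I`. -/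
def IsDense (M : Model N S) (r : M.Circ → M.Circ → Prop) (I D : Set M.Circ) : Prop :=
  ∀ C, C ∉ I → ∃ C', C' ∈ D ∧ C' ∉ I ∧ r C' C

/-- `G` is a generic filter over the ideal `I`. -/
structure IsGeneric (M : Model N S) (r : M.Circ → M.Circ → Prop) (I G : Set M.Circ) : Prop where
  filter : M.IsFilter r G
  meets : ∀ D, M.IsDefinable r D → M.IsDense r I D → ∃ C, C ∈ D ∧ C ∉ I ∧ C ∈ G

/-! ### The generic model -/

/-- `i_G(X) = {y < a : X(y) ∈ G}` for `X : a → 𝔹`. -/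
def iG (M : Model N S) (G : Set M.Circ) (a : N) (X : S) : Set N :=
  {y | M.lt y a ∧ ∃ C : M.Circ, C ∈ G ∧ C.code = M.row X y}

/-- `M[G]`, the set of all `i_G(X)` for Boolean-valued strings `X`. -/
def GenericStrings (M : Model N S) (G : Set M.Circ) : Type u :=
  {T : Set N // ∃ (a : N) (X : S), M.IsBString a X ∧ T = M.iG G a X}

/-- `b` is the length of the set `T` of numbers, that is, its least strict upper bound. -/
def IsLength (M : Model N S) (T : Set N) (b : N) : Prop :=
  (∀ y ∈ T, M.lt y b) ∧ ∀ b', (∀ y ∈ T, M.lt y b') → M.le b b'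

open Classical in
/-- The structure `(M₀, M[G])`: the number sort is that of the ground model, and `|T|` is the least
strict upper bound of `T` (with value `0` if there were none, in which case `BASIC₂` would fail). -/
noncomputable def generic (M : Model N S) (G : Set M.Circ) : Model N (M.GenericStrings G) where
  zero := M.zero
  succ := M.succ
  add := M.add
  mul := M.mul
  le := M.le
  len := fun T => if h : ∃ b, M.IsLength T.1 b then h.choose else M.zero
  mem := fun y T => y ∈ T.1

end Model

end TwoSorted

/-! For a string `Q` of the ground model, read as a network of gates without a distinguished output,
let `Val G Q x` say that the circuit given by `Q` with output gate `x` lies in `G`. The heart of the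
proof is a truth lemma, `Forcing.val_iff_gateVal`: the values `Val G Q x` satisfy the gate equations
of `Q`, even when gates have nonstandardly many predecessors. Up to any given bound a string of M[G]
is the sequence of values of consecutive gates of a single `Q` (`Forcing.exists_val_of_isGen`), and
conversely all such sequences are strings of M[G] (`Forcing.isGen_val`). Hence an axiom of VP holds
in M[G] as soon as the required string can be computed by gates added to `Q` inside M. A layer of
NOR gates gives closure under complements, intersections and bounded quantifiers, hence
comprehension (`Forcing.isGen_realize`); a network simulating circuit evaluation gives MCV
(`Forcing.exists_mcv`). Lengths exist because the gates "i is the least true index" satisfy a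
provable disjunction (`Forcing.exists_least_val`).

The truth lemma comes from one density argument, `Forcing.exists_val`: if the disjunction of the
gates x ∈ Γ of `Q` is provable, then one of them is in `G`. The circuits below some (Q, x), x ∈ Γ,
form a definable set. If it were not dense below C ∉ I, all meets C ∧ (Q, x) would be in I, hence so
would be their join by completeness; but C lies below that join. With new negation gates this
extends to sequents with negative literals (`Forcing.exists_true`), and for the sequents that
axiomatise a gate it is the gate equation.

Both orders are handled through one interface, `Calc`: a notion of provable sequent about the gates
of a sequence of circuits that contains the gate axioms, is closed under inductions internal to M,
and yields inequalities between circuits. For the semantic order "provable" means true under all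
evaluations, and MCV provides the evaluations (`exists_fullComp`). For the extended Frege order it
means derivable. There it is convenient to argue by case distinctions of standard depth (`Der`),
which may branch over nonstandardly many literals; `EFDer.exists_cut` turns them into sequences of
binary cuts. Inequalities that merely compare copies of the same circuit come from bisimulations
(`Calc.bisim`).

All of this takes place inside M, so sets and inductions need Σ₀ᴮ definitions. The classes `Fm`,
`Tm`, `Fs` let instance search verify them. -/

set_option linter.unusedSectionVars false

namespace TwoSorted

/-! ### Renaming of variables -/

/-- Renaming of the variables of a term. -/
def NumTerm.rename (f g : ℕ → ℕ) : NumTerm → NumTerm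
  | .var x => .var (f x)
  | .zero => .zero
  | .succ t => .succ (t.rename f g)
  | .add t t' => .add (t.rename f g) (t'.rename f g)
  | .mul t t' => .mul (t.rename f g) (t'.rename f g)
  | .len X => .len (g X)

/-- Renaming of all the variables of a formula, free and bound. -/
def Fml.rename (f g : ℕ → ℕ) : Fml → Fml
  | .eq t t' => .eq (t.rename f g) (t'.rename f g)
  | .le t t' => .le (t.rename f g) (t'.rename f g)
  | .mem t X => .mem (t.rename f g) (g X)
  | .strEq X Y => .strEq (g X) (g Y)
  | .neg φ => .neg (φ.rename f g)
  | .and φ ψ => .and (φ.rename f g) (ψ.rename f g)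
  | .or φ ψ => .or (φ.rename f g) (ψ.rename f g)
  | .ballNum x t φ => .ballNum (f x) (t.rename f g) (φ.rename f g)
  | .bexNum x t φ => .bexNum (f x) (t.rename f g) (φ.rename f g)
  | .allNum x φ => .allNum (f x) (φ.rename f g)
  | .exNum x φ => .exNum (f x) (φ.rename f g)
  | .allStr X φ => .allStr (g X) (φ.rename f g)
  | .exStr X φ => .exStr (g X) (φ.rename f g)

theorem Fml.IsSigmaZeroB.rename {f g : ℕ → ℕ} {φ : Fml} (h : φ.IsSigmaZeroB) :
    (φ.rename f g).IsSigmaZeroB := by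
  induction φ <;> simp_all [Fml.IsSigmaZeroB, Fml.rename]

namespace Model

variable {N : Type u} {S : Type v} [Nonempty S] {M : Model N S}

theorem termVal_rename (f g : ℕ → ℕ) (t : NumTerm) (ν : ℕ → N) (σ : ℕ → S) :
    M.termVal ν σ (t.rename f g) = M.termVal (ν ∘ f) (σ ∘ g) t := by
  induction t <;> simp_all [NumTerm.rename, termVal]

/-- Bound variables are renamed as well; injectivity prevents capture, because an update of the
assignment then commutes with the renaming. -/
theorem realize_rename {f g : ℕ → ℕ} (hf : f.Injective) (hg : g.Injective) (φ : Fml)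
    (ν : ℕ → N) (σ : ℕ → S) :
    M.Realize (φ.rename f g) ν σ ↔ M.Realize φ (ν ∘ f) (σ ∘ g) := by
  induction φ generalizing ν σ <;>
    simp_all [Fml.rename, Realize, termVal_rename, Function.update_comp_eq_of_injective]

/-! ### Definable predicates -/

/-- The assignment of `e` to the even variables and of `p` to the odd ones. -/
def mix {α : Type*} (e p : ℕ → α) (i : ℕ) : α := if i % 2 = 0 then e (i / 2) else p (i / 2)

theorem mix_even {α : Type*} (e p : ℕ → α) (i : ℕ) : mix e p (2 * i) = e i := by
  simp [mix]

theorem mix_odd {α : Type*} (e p : ℕ → α) (i : ℕ) : mix e p (2 * i + 1) = p i := by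
  simp [mix, Nat.add_mod]; congr 1; omega

/-- The renaming that moves the odd variable of number `i` to the odd variable of number `h i`. -/
def moveOdd (h : ℕ → ℕ) (i : ℕ) : ℕ := if i % 2 = 0 then i else 2 * h (i / 2) + 1

theorem moveOdd_injective {h : ℕ → ℕ} (hh : h.Injective) : (moveOdd h).Injective := by
  intro i j hij
  unfold moveOdd at hij
  split_ifs at hij with h1 h2 h2
  · exact hij
  · omega
  · omega
  · have := @hh (i / 2) (j / 2) (by omega)
    omega

theorem mix_comp_moveOdd {α : Type*} (e p : ℕ → α) (h : ℕ → ℕ) :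
    mix e p ∘ moveOdd h = mix e (p ∘ h) := by
  funext i
  simp only [Function.comp, mix, moveOdd]
  split_ifs with h1 h2
  · rfl
  · omega
  · congr 1; omega

variable (M) in
/-- `P` is the satisfaction relation of a formula with parameters, which is `Σ₀ᴮ` if `b` is true.
The arguments of `P` are the assignments of the variables that are not parameters. -/
class Fm (b : Bool) (P : (ℕ → N) → (ℕ → S) → Prop) : Prop where
  out : ∃ φ : Fml, (b = true → φ.IsSigmaZeroB) ∧ ∃ (p : ℕ → N) (q : ℕ → S),
    ∀ e s, M.Realize φ (mix e p) (mix s q) ↔ P e s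

variable (M) in
/-- `t` is the value of a term with parameters. -/
class Tm (t : (ℕ → N) → (ℕ → S) → N) : Prop where
  out : ∃ (τ : NumTerm) (p : ℕ → N) (q : ℕ → S), ∀ e s, M.termVal (mix e p) (mix s q) τ = t e s

/-- `X` is a string variable or a string parameter. -/
class Ss (X : (ℕ → S) → S) : Prop where
  out : ∃ (j : ℕ) (q : ℕ → S), ∀ s, mix s q j = X s

/-- The renaming of the variables of the first of two formulas. -/
def renL : ℕ → ℕ := moveOdd (2 * ·)

/-- The renaming of the variables of the second of two formulas. -/
def renR : ℕ → ℕ := moveOdd (2 * · + 1)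

theorem renL_injective : renL.Injective :=
  moveOdd_injective fun a b h => by simpa using h

theorem renR_injective : renR.Injective :=
  moveOdd_injective fun a b h => by simpa using h

/-- Even variables are arguments, shared by all formulas, and odd variables hold parameters. When
two formulas are combined, their parameters are interleaved by a second `mix`, and `renL`, `renR`
direct each formula to its own half. -/
theorem mix_comp_renL {α : Type*} (e p p' : ℕ → α) : mix e (mix p p') ∘ renL = mix e p := by
  rw [renL, mix_comp_moveOdd]
  congr 1
  exact funext (mix_even p p')

theorem mix_comp_renR {α : Type*} (e p p' : ℕ → α) : mix e (mix p p') ∘ renR = mix e p' := by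
  rw [renR, mix_comp_moveOdd]
  congr 1
  exact funext (mix_odd p p')

theorem realize_left (φ : Fml) (e p p' : ℕ → N) (s q q' : ℕ → S) :
    M.Realize (φ.rename renL renL) (mix e (mix p p')) (mix s (mix q q')) ↔
      M.Realize φ (mix e p) (mix s q) := by
  rw [realize_rename renL_injective renL_injective, mix_comp_renL, mix_comp_renL]

theorem realize_right (φ : Fml) (e p p' : ℕ → N) (s q q' : ℕ → S) :
    M.Realize (φ.rename renR renR) (mix e (mix p p')) (mix s (mix q q')) ↔
      M.Realize φ (mix e p') (mix s q') := by
  rw [realize_rename renR_injective renR_injective, mix_comp_renR, mix_comp_renR]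

theorem termVal_left (t : NumTerm) (e p p' : ℕ → N) (s q q' : ℕ → S) :
    M.termVal (mix e (mix p p')) (mix s (mix q q')) (t.rename renL renL) =
      M.termVal (mix e p) (mix s q) t := by
  rw [termVal_rename, mix_comp_renL, mix_comp_renL]

theorem termVal_right (t : NumTerm) (e p p' : ℕ → N) (s q q' : ℕ → S) :
    M.termVal (mix e (mix p p')) (mix s (mix q q')) (t.rename renR renR) =
      M.termVal (mix e p') (mix s q') t := by
  rw [termVal_rename, mix_comp_renR, mix_comp_renR]

/-! #### Terms -/

variable {t t' : (ℕ → N) → (ℕ → S) → N} {b : Bool}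


/-- The instances from here on mirror the constructors of terms and formulas, so that definability
of a predicate is found by instance search along its syntax. -/
instance Ss.const (X : S) : Ss (fun _ => X) := ⟨1, fun _ => X, fun _ => rfl⟩

instance Ss.var (i : ℕ) : Ss (fun s : ℕ → S => s i) :=
  ⟨2 * i, fun _ => Classical.arbitrary S, fun _ => mix_even _ _ _⟩

instance Tm.const (c : N) : Tm M (fun _ _ => c) :=
  ⟨.var 1, fun _ => c, fun _ => Classical.arbitrary S, fun _ _ => rfl⟩

instance Tm.var (i : ℕ) : Tm M (fun e _ => e i) :=
  ⟨.var (2 * i), fun _ => M.zero, fun _ => Classical.arbitrary S, fun _ _ => mix_even _ _ _⟩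

instance Tm.len (X : (ℕ → S) → S) [h : Ss X] : Tm M (fun _ s => M.len (X s)) := by
  obtain ⟨j, q, hj⟩ := h
  exact ⟨.len j, fun _ => M.zero, q, fun e s => by simp [termVal, hj]⟩

instance Tm.succ [h : Tm M t] : Tm M (fun e s => M.succ (t e s)) := by
  obtain ⟨τ, p, q, h⟩ := h
  exact ⟨.succ τ, p, q, fun e s => by simp [termVal, h]⟩

instance Tm.add [h : Tm M t] [h' : Tm M t'] : Tm M (fun e s => M.add (t e s) (t' e s)) := by
  obtain ⟨τ, p, q, h⟩ := h
  obtain ⟨τ', p', q', h'⟩ := h'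
  exact ⟨.add (τ.rename renL renL) (τ'.rename renR renR), mix p p', mix q q', fun e s => by
    simp [termVal, termVal_left, termVal_right, h, h']⟩

instance Tm.mul [h : Tm M t] [h' : Tm M t'] : Tm M (fun e s => M.mul (t e s) (t' e s)) := by
  obtain ⟨τ, p, q, h⟩ := h
  obtain ⟨τ', p', q', h'⟩ := h'
  exact ⟨.mul (τ.rename renL renL) (τ'.rename renR renR), mix p p', mix q q', fun e s => by
    simp [termVal, termVal_left, termVal_right, h, h']⟩

instance Tm.pair [h : Tm M t] [h' : Tm M t'] : Tm M (fun e s => M.pair (t e s) (t' e s)) := by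
  unfold Model.pair; infer_instance

/-! #### Formulas -/

theorem Fm.congr {P Q : (ℕ → N) → (ℕ → S) → Prop} (h : Fm M b P) (hPQ : ∀ e s, P e s ↔ Q e s) :
    Fm M b Q := by
  have : P = Q := by funext e s; exact propext (hPQ e s)
  exact this ▸ h

theorem Fm.of_true {P : (ℕ → N) → (ℕ → S) → Prop} (h : Fm M true P) : Fm M b P := by
  obtain ⟨φ, h1, h2⟩ := h
  exact ⟨φ, fun _ => h1 rfl, h2⟩

/-- A statement that does not depend on the arguments is either true or false, so however
complicated it is, `0 = 0` or its negation expresses it. -/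
instance Fm.const (p : Prop) : Fm M b (fun _ _ => p) := by
  by_cases hp : p
  · exact ⟨.eq .zero .zero, fun _ => trivial, fun _ => M.zero, fun _ => Classical.arbitrary S,
      fun e s => by simp [Realize, hp]⟩
  · exact ⟨.neg (.eq .zero .zero), fun _ => trivial, fun _ => M.zero, fun _ => Classical.arbitrary S,
      fun e s => by simp [Realize, hp]⟩

instance Fm.eq [h : Tm M t] [h' : Tm M t'] : Fm M b (fun e s => t e s = t' e s) := by
  obtain ⟨τ, p, q, h⟩ := h
  obtain ⟨τ', p', q', h'⟩ := h'
  exact ⟨.eq (τ.rename renL renL) (τ'.rename renR renR), fun _ => trivial, mix p p', mix q q', fun e s => by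
    simp [Realize, termVal_left, termVal_right, h, h']⟩

instance Fm.le [h : Tm M t] [h' : Tm M t'] : Fm M b (fun e s => M.le (t e s) (t' e s)) := by
  obtain ⟨τ, p, q, h⟩ := h
  obtain ⟨τ', p', q', h'⟩ := h'
  exact ⟨.le (τ.rename renL renL) (τ'.rename renR renR), fun _ => trivial, mix p p', mix q q', fun e s => by
    simp [Realize, termVal_left, termVal_right, h, h']⟩

instance Fm.mem {X : (ℕ → S) → S} [h : Tm M t] [h' : Ss X] :
    Fm M b (fun e s => M.mem (t e s) (X s)) := by
  obtain ⟨τ, p, q, h⟩ := h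
  obtain ⟨j, q', h'⟩ := h'
  refine ⟨.mem (τ.rename renL renL) (renR j), fun _ => trivial, mix p p, mix q q', fun e s => ?_⟩
  have := congrFun (mix_comp_renR s q q') j
  simp only [Function.comp] at this
  simp [Realize, termVal_left, h, h', this]

instance Fm.not {P : (ℕ → N) → (ℕ → S) → Prop} [h : Fm M b P] : Fm M b (fun e s => ¬ P e s) := by
  obtain ⟨φ, hφ, p, q, h⟩ := h
  exact ⟨.neg φ, hφ, p, q, fun e s => by simp [Realize, h]⟩

instance Fm.and {P Q : (ℕ → N) → (ℕ → S) → Prop} [h : Fm M b P] [h' : Fm M b Q] :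
    Fm M b (fun e s => P e s ∧ Q e s) := by
  obtain ⟨φ, hφ, p, q, h⟩ := h
  obtain ⟨φ', hφ', p', q', h'⟩ := h'
  exact ⟨.and (φ.rename renL renL) (φ'.rename renR renR), fun hb => ⟨(hφ hb).rename, (hφ' hb).rename⟩,
    mix p p', mix q q', fun e s => by simp [Realize, realize_left, realize_right, h, h']⟩

instance Fm.or {P Q : (ℕ → N) → (ℕ → S) → Prop} [h : Fm M b P] [h' : Fm M b Q] :
    Fm M b (fun e s => P e s ∨ Q e s) :=
  Fm.congr (P := fun e s => ¬ (¬ P e s ∧ ¬ Q e s)) inferInstance fun e s => by tauto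

instance Fm.imp {P Q : (ℕ → N) → (ℕ → S) → Prop} [h : Fm M b P] [h' : Fm M b Q] :
    Fm M b (fun e s => P e s → Q e s) :=
  Fm.congr (P := fun e s => ¬ (P e s ∧ ¬ Q e s)) inferInstance fun e s => by tauto

instance Fm.iff {P Q : (ℕ → N) → (ℕ → S) → Prop} [h : Fm M b P] [h' : Fm M b Q] :
    Fm M b (fun e s => P e s ↔ Q e s) :=
  Fm.congr (P := fun e s => (P e s → Q e s) ∧ (Q e s → P e s)) inferInstance fun e s => by tauto

instance Fm.xor {P Q : (ℕ → N) → (ℕ → S) → Prop} [h : Fm M b P] [h' : Fm M b Q] :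
    Fm M b (fun e s => Xor (P e s) (Q e s)) :=
  Fm.congr (P := fun e s => (P e s ∧ ¬ Q e s) ∨ (Q e s ∧ ¬ P e s)) inferInstance
    fun e s => by simp [Xor]

instance Fm.lt [Tm M t] [Tm M t'] : Fm M b (fun e s => M.lt (t e s) (t' e s)) := by
  unfold Model.lt; infer_instance

/-- The renaming that makes the variable of number `0` a parameter. -/
def bindZero (i : ℕ) : ℕ := if i = 0 then 1 else if i % 2 = 0 then i - 2 else i + 2

theorem bindZero_injective : bindZero.Injective := by
  intro i j hij
  unfold bindZero at hij
  split_ifs at hij <;> omega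

/-- Quantification in the style of de Bruijn: argument 0 moves to variable 1, where it gets bound,
the other arguments move down by one, and the parameters move up to make room. Accordingly, the
quantifier instances below ask for definability with the bound variable as argument 0 and all other
arguments shifted. -/
theorem update_mix_comp_bindZero {α : Type*} (e p : ℕ → α) (x y : α) :
    Function.update (mix e (fun i => if i = 0 then x else p (i - 1))) 1 y ∘ bindZero =
      mix (fun i => if i = 0 then y else e (i - 1)) p := by
  funext i
  obtain ⟨k, rfl | rfl⟩ := Nat.even_or_odd' i
  · rw [mix_even]
    rcases k with _ | k
    · simp [bindZero]
    · have : bindZero (2 * (k + 1)) = 2 * k := by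
        rw [bindZero, if_neg (by omega), if_pos (by omega)]; omega
      have h1 : 2 * k ≠ 1 := by omega
      rw [Function.comp, this, Function.update_of_ne h1, mix_even]
      simp
  · have : bindZero (2 * k + 1) = 2 * (k + 1) + 1 := by
      rw [bindZero, if_neg (by omega), if_neg (by omega)]; ring
    have h1 : 2 * (k + 1) + 1 ≠ 1 := by omega
    rw [mix_odd, Function.comp, this, Function.update_of_ne h1, mix_odd]
    simp

theorem realize_bindZero (φ : Fml) (e p : ℕ → N) (s q : ℕ → S) (x y : N) :
    M.Realize (φ.rename bindZero id)
        (Function.update (mix e (fun i => if i = 0 then x else p (i - 1))) 1 y) (mix s q) ↔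
      M.Realize φ (mix (fun i => if i = 0 then y else e (i - 1)) p) (mix s q) := by
  rw [realize_rename bindZero_injective Function.injective_id, update_mix_comp_bindZero]; rfl

theorem realize_bindZeroStr (φ : Fml) (e p : ℕ → N) (s q : ℕ → S) (X Y : S) :
    M.Realize (φ.rename id bindZero) (mix e p)
        (Function.update (mix s (fun i => if i = 0 then X else q (i - 1))) 1 Y) ↔
      M.Realize φ (mix e p) (mix (fun i => if i = 0 then Y else s (i - 1)) q) := by
  rw [realize_rename Function.injective_id bindZero_injective, update_mix_comp_bindZero]; rfl

instance Fm.exStr {R : (ℕ → N) → (ℕ → S) → S → Prop}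
    [h : Fm M false (fun e s => R e (fun i => s (i + 1)) (s 0))] :
    Fm M false (fun e s => ∃ X, R e s X) := by
  obtain ⟨φ, -, p, q, h⟩ := h
  refine ⟨.exStr 1 (φ.rename id bindZero), by simp, p,
    fun i => if i = 0 then Classical.arbitrary S else q (i - 1), fun e s => ?_⟩
  simp only [Realize, realize_bindZeroStr, h]
  simp

instance Fm.allStr {R : (ℕ → N) → (ℕ → S) → S → Prop}
    [h : Fm M false (fun e s => R e (fun i => s (i + 1)) (s 0))] :
    Fm M false (fun e s => ∀ X, R e s X) :=
  Fm.congr (P := fun e s => ¬ ∃ X, ¬ R e s X) inferInstance fun e s => by simp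

instance Fm.exNum {R : (ℕ → N) → (ℕ → S) → N → Prop}
    [h : Fm M false (fun e s => R (fun i => e (i + 1)) s (e 0))] :
    Fm M false (fun e s => ∃ y, R e s y) := by
  obtain ⟨φ, -, p, q, h⟩ := h
  refine ⟨.exNum 1 (φ.rename bindZero id), by simp,
    fun i => if i = 0 then M.zero else p (i - 1), q, fun e s => ?_⟩
  simp only [Realize, realize_bindZero, h]
  simp

instance Fm.allNum {R : (ℕ → N) → (ℕ → S) → N → Prop}
    [h : Fm M false (fun e s => R (fun i => e (i + 1)) s (e 0))] :
    Fm M false (fun e s => ∀ y, R e s y) :=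
  Fm.congr (P := fun e s => ¬ ∃ y, ¬ R e s y) inferInstance fun e s => by simp

theorem Tm.lift (h : Tm M t) : Tm M (fun e s => t (fun i => e (i + 1)) s) := by
  obtain ⟨τ, p, q, h⟩ := h
  refine ⟨τ.rename (fun i => if i % 2 = 0 then i + 2 else i) id, p, q, fun e s => ?_⟩
  rw [termVal_rename, ← h]
  congr 1
  funext i
  simp only [Function.comp, mix]
  split_ifs <;> first | rfl | omega | (congr 1; omega)

instance Fm.bexLt {R : (ℕ → N) → (ℕ → S) → N → Prop} [ht : Tm M t]
    [h : Fm M b (fun e s => R (fun i => e (i + 1)) s (e 0))] :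
    Fm M b (fun e s => ∃ y, M.lt y (t e s) ∧ R e s y) := by
  obtain ⟨φ, hφ, p, q, h⟩ := h
  obtain ⟨τ, p', q', ht⟩ := ht
  refine ⟨.bexNum (renL 1) (τ.rename renR renR) ((φ.rename bindZero id).rename renL renL),
    fun hb => (hφ hb).rename.rename, mix (fun i => if i = 0 then M.zero else p (i - 1)) p', mix q q',
    fun e s => ?_⟩
  simp only [Realize, termVal_right, ht]
  refine exists_congr fun y => and_congr_right fun _ => ?_
  rw [realize_rename renL_injective renL_injective,
    Function.update_comp_eq_of_injective _ renL_injective, mix_comp_renL, mix_comp_renL,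
    realize_bindZero, h]
  simp

instance Fm.ballLt {R : (ℕ → N) → (ℕ → S) → N → Prop} [ht : Tm M t]
    [h : Fm M b (fun e s => R (fun i => e (i + 1)) s (e 0))] :
    Fm M b (fun e s => ∀ y, M.lt y (t e s) → R e s y) :=
  Fm.congr (P := fun e s => ¬ ∃ y, M.lt y (t e s) ∧ ¬ R e s y) inferInstance fun e s => by
    simp

/-! ### Induction -/

theorem Basic.le_refl (h : M.Basic) (x : N) : M.le x x := by
  have := h.b8 x M.zero; rwa [h.b3] at this

theorem Basic.not_succ_le (h : M.Basic) {x y : N} (hxy : M.le (M.succ x) y) (hyx : M.le y x) :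
    False := by
  have := (h.b11 y x).1 hyx
  exact this.2 (h.b7 _ _ this.1 hxy)

/-- Comprehension gives the set Z of all y ≤ x up to which `P` holds, and the length axioms give Z a
largest element m. If m = x, then `P x`; otherwise m + 1 belongs to Z too, a contradiction. -/
theorem VZero.induction (hM : M.VZero) (P : N → Prop) [hP : Fm M true (fun e _ => P (e 0))]
    (h0 : P M.zero) (hs : ∀ x, P x → P (M.succ x)) (x : N) : P x := by
  by_contra hx
  obtain ⟨hB, hC⟩ := hM
  have hQ : Fm M true (fun e _ => ∀ y, M.lt y (M.succ (e 0)) → P y) := inferInstance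
  obtain ⟨φ, hφ, p, q, h⟩ := hQ
  obtain ⟨Z, hZ, hZ'⟩ := hC φ (hφ rfl) (mix (fun _ => M.zero) p)
    (mix (fun _ => Classical.arbitrary S) q) 0 (M.succ x)
  have hup (m : N) : Function.update (mix (fun _ => M.zero) p) 0 m =
      mix (fun i => if i = 0 then m else M.zero) p := by
    funext i
    obtain ⟨k, rfl | rfl⟩ := Nat.even_or_odd' i
    · rcases k with _ | k <;> simp [mix]
    · rw [Function.update_of_ne (by omega), mix_odd, mix_odd]
  simp only [hup, h, if_true] at hZ'
  have hx0 : M.lt M.zero (M.succ x) := (hB.b11 _ _).1 (hB.b9 x)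
  have h0Z : M.mem M.zero Z := by
    rw [hZ' _ hx0]
    intro y hy
    rwa [hB.b7 _ _ ((hB.b11 _ _).2 hy) (hB.b9 y)]
  obtain ⟨m, -, hm⟩ := hB.b12 (M.len Z) (hB.l1 _ _ h0Z).2.symm
  have hmZ := hB.l2 _ _ hm
  have hmx : M.le m x := by
    rw [← hm] at hZ
    rcases hB.b10 (M.succ x) m with h1 | h1
    · exact (hB.not_succ_le hZ h1).elim
    · by_cases h2 : m = M.succ x
      · rw [← h2] at hZ
        exact (hB.not_succ_le hZ (hB.le_refl m)).elim
      · exact (hB.b11 _ _).2 ⟨h1, h2⟩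
  have hmP := (hZ' m ((hB.b11 _ _).1 hmx)).1 hmZ
  by_cases hmx' : m = x
  · exact hx (hmx' ▸ hmP m ((hB.b11 _ _).1 (hB.le_refl m)))
  · have h1 : M.lt (M.succ m) (M.succ x) := by
      refine ⟨hm ▸ hZ, fun h => hmx' (hB.b2 _ _ h)⟩
    have : M.mem (M.succ m) Z := by
      rw [hZ' _ h1]
      intro y hy
      by_cases hym : y = M.succ m
      · rw [hym]; exact hs m (hmP m ((hB.b11 _ _).1 (hB.le_refl m)))
      · exact hmP y ⟨(hB.b11 _ _).2 hy, hym⟩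
    have := hB.l1 _ _ this
    exact this.2 hm

end Model

end TwoSorted

set_option linter.unusedSectionVars false

namespace TwoSorted

namespace Model

variable {N : Type u} {S : Type v} [Nonempty S] {M : Model N S}

/-! ### Arithmetic of V⁰ -/

namespace VZero

theorem zero_add (h : M.VZero) (x : N) : M.add M.zero x = x :=
  h.induction (fun x => M.add M.zero x = x) (h.1.b3 _) (fun x hx => by rw [h.1.b4, hx]) x

theorem succ_add (h : M.VZero) (x y : N) : M.add (M.succ x) y = M.succ (M.add x y) :=
  h.induction (fun y => M.add (M.succ x) y = M.succ (M.add x y)) (by rw [h.1.b3, h.1.b3])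
    (fun y hy => by rw [h.1.b4, hy, h.1.b4]) y

theorem add_comm (h : M.VZero) (x y : N) : M.add x y = M.add y x :=
  h.induction (fun y => M.add x y = M.add y x) (by rw [h.1.b3, h.zero_add])
    (fun y hy => by rw [h.1.b4, hy, h.succ_add]) y

theorem add_assoc (h : M.VZero) (x y z : N) : M.add (M.add x y) z = M.add x (M.add y z) :=
  h.induction (fun z => M.add (M.add x y) z = M.add x (M.add y z)) (by rw [h.1.b3, h.1.b3])
    (fun z hz => by rw [h.1.b4, hz, h.1.b4, h.1.b4]) z

theorem add_right_cancel (h : M.VZero) (x y z : N) : M.add x z = M.add y z → x = y :=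
  h.induction (fun z => M.add x z = M.add y z → x = y) (by rw [h.1.b3, h.1.b3]; exact id)
    (fun _ hz => by rw [h.1.b4, h.1.b4]; exact fun h' => hz (h.1.b2 _ _ h')) z

theorem zero_mul (h : M.VZero) (x : N) : M.mul M.zero x = M.zero :=
  h.induction (fun x => M.mul M.zero x = M.zero) (h.1.b5 _)
    (fun x hx => by rw [h.1.b6, hx, h.1.b3]) x

theorem succ_mul (h : M.VZero) (x y : N) : M.mul (M.succ x) y = M.add (M.mul x y) y :=
  h.induction (fun y => M.mul (M.succ x) y = M.add (M.mul x y) y) (by simp only [h.1.b5, h.1.b3])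
    (fun y hy => by
      rw [h.1.b6, hy, h.1.b6, h.1.b4, h.1.b4, h.add_assoc, h.add_assoc, h.add_comm y x]) y

theorem mul_comm (h : M.VZero) (x y : N) : M.mul x y = M.mul y x :=
  h.induction (fun y => M.mul x y = M.mul y x) (by rw [h.1.b5, h.zero_mul])
    (fun y hy => by rw [h.1.b6, hy, h.succ_mul]) y

theorem mul_add (h : M.VZero) (x y z : N) :
    M.mul x (M.add y z) = M.add (M.mul x y) (M.mul x z) :=
  h.induction (fun z => M.mul x (M.add y z) = M.add (M.mul x y) (M.mul x z))
    (by rw [h.1.b3, h.1.b5, h.1.b3])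
    (fun z hz => by rw [h.1.b4, h.1.b6, hz, h.1.b6, h.add_assoc]) z

theorem mul_assoc (h : M.VZero) (x y z : N) : M.mul (M.mul x y) z = M.mul x (M.mul y z) :=
  h.induction (fun z => M.mul (M.mul x y) z = M.mul x (M.mul y z)) (by simp only [h.1.b5])
    (fun z hz => by rw [h.1.b6, hz, h.1.b6, h.mul_add]) z

theorem mul_one (h : M.VZero) (x : N) : M.mul x M.one = x := by
  rw [one, h.1.b6, h.1.b5, h.zero_add]

theorem exists_add_eq (h : M.VZero) (x y : N) (hxy : M.le x y) : ∃ z, M.add x z = y := by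
  -- The bound on z makes the induction formula Σ₀ᴮ.
  have := h.induction (fun y => M.le x y → ∃ z, M.lt z (M.succ y) ∧ M.add x z = y)
    (fun hx => ⟨M.zero, (h.1.b11 _ _).1 (h.1.b9 _), by rw [h.1.b3]; exact h.1.b7 _ _ hx (h.1.b9 _)⟩)
    (fun y hy hx => by
      have key (z : N) (hz : M.add x z = M.succ y) :
          ∃ z, M.lt z (M.succ (M.succ y)) ∧ M.add x z = M.succ y := by
        refine ⟨z, (h.1.b11 _ _).1 ?_, hz⟩
        rw [← hz, h.add_comm]; exact h.1.b8 _ _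
      by_cases hxy : x = M.succ y
      · exact key M.zero (by rw [h.1.b3, hxy])
      · obtain ⟨z, -, hz⟩ := hy ((h.1.b11 _ _).2 ⟨hx, hxy⟩)
        exact key (M.succ z) (by rw [h.1.b4, hz])) y hxy
  obtain ⟨z, -, hz⟩ := this
  exact ⟨z, hz⟩

theorem le_iff_exists (h : M.VZero) (x y : N) : M.le x y ↔ ∃ z, y = M.add x z :=
  ⟨fun hxy => (h.exists_add_eq x y hxy).imp fun _ => Eq.symm, fun ⟨_, hz⟩ => hz ▸ h.1.b8 _ _⟩

/-- The numbers of a model of `V⁰` form a commutative semiring. -/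
@[reducible] def commSemiring (h : M.VZero) : CommSemiring N where
  add := M.add
  zero := M.zero
  mul := M.mul
  one := M.one
  add_assoc := h.add_assoc
  zero_add := h.zero_add
  add_zero := h.1.b3
  add_comm := h.add_comm
  nsmul := @nsmulRec N ⟨M.zero⟩ ⟨M.add⟩
  left_distrib := h.mul_add
  right_distrib x y z := by
    change M.mul (M.add x y) z = M.add (M.mul x z) (M.mul y z)
    rw [h.mul_comm, h.mul_add, h.mul_comm z, h.mul_comm z]
  zero_mul := h.zero_mul
  mul_zero := h.1.b5
  mul_assoc := h.mul_assoc
  one_mul x := by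
    change M.mul M.one x = x
    rw [h.mul_comm, h.mul_one]
  mul_one := h.mul_one
  mul_comm := h.mul_comm

open Classical in
/-- The numbers of a model of `V⁰` are linearly ordered. -/
@[reducible] noncomputable def linearOrder (h : M.VZero) : LinearOrder N where
  le := M.le
  le_refl := h.1.le_refl
  le_trans x y z hxy hyz := by
    obtain ⟨a, rfl⟩ := (h.le_iff_exists _ _).1 hxy
    obtain ⟨b, rfl⟩ := (h.le_iff_exists _ _).1 hyz
    rw [h.add_assoc]; exact h.1.b8 _ _
  le_antisymm := h.1.b7
  le_total := h.1.b10
  toDecidableLE := Classical.decRel _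

end VZero

/-! ### Transfer to ordered semirings -/

variable (M) in
/-- The operations of `M` are those of an ordered semiring, and `M` is a model of `V⁰`. -/
class Std [CommSemiring N] [LinearOrder N] : Prop where
  zero_eq : M.zero = 0
  succ_eq : ∀ x, M.succ x = x + 1
  add_eq : ∀ x y, M.add x y = x + y
  mul_eq : ∀ x y, M.mul x y = x * y
  le_iff : ∀ x y, M.le x y ↔ x ≤ y
  vzero : M.VZero

/-- Makes `ring`, `gcongr` and the general order lemmas available for the numbers of M. Strict
monotonicity rests on axiom `b12`: x < y holds exactly if y = x + (z + 1) for some z. -/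
theorem VZero.exists_std (h : M.VZero) : ∃ (_ : CommSemiring N) (_ : LinearOrder N)
    (_ : IsStrictOrderedRing N) (_ : CanonicallyOrderedAdd N), M.Std := by
  let := h.commSemiring
  let := h.linearOrder
  have hle : ∀ x y : N, x ≤ y ↔ ∃ z, y = x + z := h.le_iff_exists
  have hsucc : ∀ x, M.succ x = x + 1 := fun x => by
    change M.succ x = M.add x (M.succ M.zero)
    rw [h.1.b4, h.1.b3]
  have hcancel : ∀ x y z : N, x + z = y + z → x = y := h.add_right_cancel
  have hne : ∀ x : N, x + 1 ≠ 0 := fun x => by rw [← hsucc]; exact h.1.b1 x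
  have hlt : ∀ x y : N, x < y ↔ ∃ z, y = x + (z + 1) := by
    intro x y
    constructor
    · intro hxy
      obtain ⟨z, hz⟩ := (hle x y).1 hxy.le
      have hz0 : z ≠ 0 := by rintro rfl; rw [_root_.add_zero] at hz; exact hxy.ne hz.symm
      obtain ⟨w, -, hw⟩ := h.1.b12 z hz0
      exact ⟨w, by rw [hz, ← hsucc, hw]⟩
    · rintro ⟨z, rfl⟩
      refine lt_of_le_of_ne ((hle _ _).2 ⟨_, rfl⟩) fun h' => hne z (hcancel _ _ x ?_)
      rw [_root_.zero_add, _root_.add_comm, ← h']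
  have : CanonicallyOrderedAdd N :=
    { exists_add_of_le := fun {a b} hab => (hle a b).1 hab
      le_self_add := fun a b => (hle _ _).2 ⟨b, rfl⟩
      le_add_self := fun a b => (hle _ _).2 ⟨b, _root_.add_comm _ _⟩ }
  have hmul : ∀ a : N, 0 < a → ∀ b c : N, b < c → a * b < a * c := by
    intro a ha b c hbc
    obtain ⟨z, rfl⟩ := (hlt _ _).1 hbc
    obtain ⟨w, rfl⟩ := (hlt _ _).1 ha
    refine (hlt _ _).2 ⟨w * z + w + z, ?_⟩
    ring
  have : IsStrictOrderedRing N :=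
    { add_le_add_left := by
        intro a b hab c
        obtain ⟨z, rfl⟩ := (hle _ _).1 hab
        exact (hle _ _).2 ⟨z, by ring⟩
      le_of_add_le_add_left := by
        intro a b c hab
        obtain ⟨z, hz⟩ := (hle _ _).1 hab
        exact (hle _ _).2 ⟨z, hcancel _ _ a (by rw [_root_.add_comm c, hz]; ring)⟩
      zero_le_one := (hle _ _).2 ⟨1, by ring⟩
      exists_pair_ne := ⟨0 + 1, 0, hne 0⟩
      mul_lt_mul_of_pos_left := fun a ha b c hbc => hmul a ha b c hbc
      mul_lt_mul_of_pos_right := fun a ha b c hbc => by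
        rw [_root_.mul_comm b, _root_.mul_comm c]; exact hmul a ha b c hbc }
  exact ⟨inferInstance, inferInstance, inferInstance, inferInstance,
    ⟨rfl, hsucc, fun _ _ => rfl, fun _ _ => rfl, fun _ _ => Iff.rfl, h⟩⟩

end Model

end TwoSorted

set_option linter.unusedSectionVars false

namespace TwoSorted

namespace Model

variable {N : Type u} {S : Type v} [CommSemiring N] [LinearOrder N] [IsStrictOrderedRing N]
  [CanonicallyOrderedAdd N] [Nonempty S] {M : Model N S} [hM : M.Std]

/-! ### Definability and arithmetic in the standard notation -/

theorem lt_iff (x y : N) : M.lt x y ↔ x < y := by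
  rw [Model.lt, hM.le_iff, lt_iff_le_and_ne]

theorem one_eq : M.one = 1 := by rw [one, hM.zero_eq, hM.succ_eq, zero_add]

theorem two_eq : M.two = 2 := by rw [two, one_eq, hM.succ_eq, one_add_one_eq_two]

theorem three_eq : M.three = 3 := by rw [three, two_eq, hM.succ_eq, two_add_one_eq_three]

theorem lt_add_one (M : Model N S) [hM : M.Std] (x y : N) : x < y + 1 ↔ x ≤ y := by
  rw [← hM.le_iff, hM.vzero.1.b11, lt_iff, hM.succ_eq]

theorem add_one_le (M : Model N S) [hM : M.Std] (x y : N) : x + 1 ≤ y ↔ x < y := by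
  rw [← not_lt, lt_add_one M, not_le]

theorem exists_add_one (M : Model N S) [hM : M.Std] (x : N) (hx : x ≠ 0) : ∃ y, x = y + 1 := by
  obtain ⟨y, -, hy⟩ := hM.vzero.1.b12 x (by rwa [hM.zero_eq])
  exact ⟨y, by rw [← hy, hM.succ_eq]⟩

section Instances

variable {t t' : (ℕ → N) → (ℕ → S) → N} {b : Bool}

instance Tm.add' [Tm M t] [Tm M t'] : Tm M (fun e s => t e s + t' e s) := by
  simp only [← hM.add_eq]; infer_instance

instance Tm.mul' [Tm M t] [Tm M t'] : Tm M (fun e s => t e s * t' e s) := by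
  simp only [← hM.mul_eq]; infer_instance

instance Fm.le' [Tm M t] [Tm M t'] : Fm M b (fun e s => t e s ≤ t' e s) := by
  simp only [← hM.le_iff]; infer_instance

instance Fm.lt' [Tm M t] [Tm M t'] : Fm M b (fun e s => t e s < t' e s) := by
  simp only [← lt_iff (M := M)]; infer_instance

instance Fm.bexLt' {R : (ℕ → N) → (ℕ → S) → N → Prop} [Tm M t]
    [Fm M b (fun e s => R (fun i => e (i + 1)) s (e 0))] :
    Fm M b (fun e s => ∃ y, y < t e s ∧ R e s y) := by
  simp only [← lt_iff (M := M)]; infer_instance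

instance Fm.ballLt' {R : (ℕ → N) → (ℕ → S) → N → Prop} [Tm M t]
    [Fm M b (fun e s => R (fun i => e (i + 1)) s (e 0))] :
    Fm M b (fun e s => ∀ y, y < t e s → R e s y) := by
  simp only [← lt_iff (M := M)]; infer_instance

instance Fm.ne [Tm M t] [Tm M t'] : Fm M b (fun e s => t e s ≠ t' e s) := by
  unfold Ne; infer_instance

instance Fm.allBool {R : Bool → (ℕ → N) → (ℕ → S) → Prop}
    [h : Fm M b (fun e s => R true e s)] [h' : Fm M b (fun e s => R false e s)] :
    Fm M b (fun e s => ∀ c, R c e s) := by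
  simp only [Bool.forall_bool]; infer_instance

instance Fm.exBool {R : Bool → (ℕ → N) → (ℕ → S) → Prop}
    [h : Fm M b (fun e s => R true e s)] [h' : Fm M b (fun e s => R false e s)] :
    Fm M b (fun e s => ∃ c, R c e s) := by
  simp only [Bool.exists_bool]; infer_instance

variable (M) in
/-- `T` is a definable set of numbers. -/
class Fs (b : Bool) (T : (ℕ → N) → (ℕ → S) → Set N) : Prop where
  out : Fm M b (fun e s => e 0 ∈ T (fun i => e (i + 1)) s)

/-- Substitution of a term for the variable of number `0`. -/
theorem Fm.substZero {R : (ℕ → N) → (ℕ → S) → N → Prop}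
    (h : Fm M b (fun e s => R (fun i => e (i + 1)) s (e 0))) (ht : Tm M t) :
    Fm M b (fun e s => R e s (t e s)) := by
  have := ht.lift
  -- Substitution is expressed by a bounded quantifier, which preserves Σ₀ᴮ.
  refine Fm.congr (P := fun e s => ∃ y, y < t e s + 1 ∧ y = t e s ∧ R e s y) inferInstance ?_
  intro e s
  simp only [lt_add_one M]
  exact ⟨by rintro ⟨y, -, rfl, h⟩; exact h, fun h => ⟨_, le_rfl, rfl, h⟩⟩

instance Fs.mem {T : (ℕ → N) → (ℕ → S) → Set N} [h : Fs M b T] [ht : Tm M t] :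
    Fm M b (fun e s => t e s ∈ T e s) :=
  Fm.substZero (R := fun e s y => y ∈ T e s) h.out ht

instance Fs.bits {X : (ℕ → S) → S} [Ss X] : Fs M b (fun _ s => M.bits (X s)) :=
  ⟨by change Fm M b (fun e s => M.mem (e 0) (X s)); infer_instance⟩

instance Fs.row {X : (ℕ → S) → S} [Ss X] [ht : Tm M t] :
    Fs M b (fun e s => M.row (X s) (t e s)) := by
  have := ht.lift
  exact ⟨by
    change Fm M b (fun e s => M.mem (M.pair (t (fun i => e (i + 1)) s) (e 0)) (X s)); infer_instance⟩

instance Fm.isAnd {T : (ℕ → N) → (ℕ → S) → Set N} [Fs M b T] [Tm M t] :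
    Fm M b (fun e s => M.IsAnd (T e s) (t e s)) := by
  unfold IsAnd; infer_instance

instance Fm.isNeg {T : (ℕ → N) → (ℕ → S) → Set N} [Fs M b T] [Tm M t] :
    Fm M b (fun e s => M.IsNeg (T e s) (t e s)) := by
  unfold IsNeg; infer_instance

instance Fm.isOut {T : (ℕ → N) → (ℕ → S) → Set N} [Fs M b T] [Tm M t] :
    Fm M b (fun e s => M.IsOut (T e s) (t e s)) := by
  unfold IsOut; infer_instance

instance Fm.edge {T : (ℕ → N) → (ℕ → S) → Set N} [Fs M b T] [Tm M t] [Tm M t'] :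
    Fm M b (fun e s => M.Edge (T e s) (t e s) (t' e s)) := by
  unfold Edge; infer_instance

end Instances

section Substitution

variable {b : Bool}

theorem Fm.subst₁ {P : N → Prop} (h : Fm M b (fun e _ => P (e 0)))
    (t : (ℕ → N) → (ℕ → S) → N) [ht : Tm M t] : Fm M b (fun e s => P (t e s)) :=
  Fm.substZero (R := fun _ _ y => P y) h ht

/-- Permutes or spreads out the arguments, so that any of them can be brought into position 0 for
`Fm.substZero`. -/
theorem Fm.reindex {P : (ℕ → N) → (ℕ → S) → Prop} (h : Fm M b P) {f : ℕ → ℕ} (hf : f.Injective) :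
    Fm M b (fun e s => P (fun i => e (f i)) s) := by
  obtain ⟨φ, hφ, p, q, h⟩ := h
  have hev (i : ℕ) : 2 * i % 2 = 0 := by omega
  have hod (i : ℕ) : ¬ (2 * i + 1) % 2 = 0 := by omega
  have hg : Function.Injective (fun i => if i % 2 = 0 then 2 * f (i / 2) else i) := by
    intro i j hij
    simp only at hij
    split_ifs at hij
    · have := @hf (i / 2) (j / 2) (by omega)
      omega
    all_goals omega
  refine ⟨φ.rename (fun i => if i % 2 = 0 then 2 * f (i / 2) else i) id, fun hb => (hφ hb).rename,
    p, q, fun e s => ?_⟩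
  rw [realize_rename hg Function.injective_id, ← h]
  apply iff_of_eq
  congr 1
  funext i
  obtain ⟨k, rfl | rfl⟩ := Nat.even_or_odd' i
  · rw [Function.comp, if_pos (hev k), mix_even, mix_even]; simp
  · rw [Function.comp, if_neg (hod k), mix_odd, mix_odd]

/-- Composition of a definable relation with terms. -/
theorem Fm.subst₂ {P : N → N → Prop} (h : Fm M b (fun e _ => P (e 0) (e 1)))
    (t t' : (ℕ → N) → (ℕ → S) → N) [ht : Tm M t] [ht' : Tm M t'] :
    Fm M b (fun e s => P (t e s) (t' e s)) := by
  have h1 : Fm M b (fun e s => P (e 1) (e 0)) :=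
    h.reindex (f := fun i => if i = 0 then 1 else if i = 1 then 0 else i)
      (fun i j hij => by simp only at hij; split_ifs at hij <;> omega)
  have h2 : Fm M b (fun e s => P (e 0) (t' (fun i => e (i + 1)) s)) :=
    Fm.substZero (R := fun e s y => P (e 0) y) h1 ht'.lift
  exact Fm.substZero (R := fun e s y => P y (t' e s)) h2 ht

/-- Composition of a definable relation with terms. -/
theorem Fm.subst₃ {P : N → N → N → Prop} (h : Fm M b (fun e _ => P (e 0) (e 1) (e 2)))
    (t t' t'' : (ℕ → N) → (ℕ → S) → N) [ht : Tm M t] [ht' : Tm M t'] [ht'' : Tm M t''] :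
    Fm M b (fun e s => P (t e s) (t' e s) (t'' e s)) := by
  have h1 : Fm M b (fun e s => P (e 2) (e 1) (e 0)) :=
    h.reindex (f := fun i => if i = 0 then 2 else if i = 2 then 0 else i)
      (fun i j hij => by simp only at hij; split_ifs at hij <;> omega)
  have h2 : Fm M b (fun e s => P (e 1) (e 0) (t'' (fun i => e (i + 1 + 1)) s)) :=
    Fm.substZero (R := fun e s y => P (e 1) (e 0) y) h1 ht''.lift.lift
  have h3 : Fm M b (fun e s => P (e 0) (t' (fun i => e (i + 1)) s) (t'' (fun i => e (i + 1)) s)) :=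
    Fm.substZero (R := fun e s y => P (e 0) y (t'' (fun i => e (i + 1)) s)) h2 ht'.lift
  exact Fm.substZero (R := fun e s y => P y (t' e s) (t'' e s)) h3 ht

end Substitution

/-! ### Comprehension and least numbers -/

theorem lt_len {x : N} {X : S} (h : M.mem x X) : x < M.len X :=
  (lt_iff (M := M) _ _).1 (hM.vzero.1.l1 X x h)

/-- Comprehension decides membership below a, and |Y| ≤ a decides it from a on. -/
theorem exists_set (M : Model N S) [hM : M.Std] (P : N → Prop) [h : Fm M true (fun e _ => P (e 0))] (a : N) :
    ∃ Y : S, M.len Y ≤ a ∧ ∀ x, M.mem x Y ↔ x < a ∧ P x := by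
  obtain ⟨φ, hφ, p, q, h⟩ := h
  obtain ⟨Y, hY, hY'⟩ := hM.vzero.2 φ (hφ rfl) (mix (fun _ => M.zero) p)
    (mix (fun _ => Classical.arbitrary S) q) 0 a
  have hup (m : N) : Function.update (mix (fun _ => M.zero) p) 0 m =
      mix (fun i => if i = 0 then m else M.zero) p := by
    funext i
    obtain ⟨k, rfl | rfl⟩ := Nat.even_or_odd' i
    · rcases k with _ | k <;> simp [mix]
    · rw [Function.update_of_ne (by omega), mix_odd, mix_odd]
  simp only [hup, h, if_true, lt_iff] at hY'
  rw [hM.le_iff] at hY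
  refine ⟨Y, hY, fun x => ⟨fun hx => ?_, fun hx => (hY' x hx.1).2 hx.2⟩⟩
  have := (lt_len hx).trans_le hY
  exact ⟨this, (hY' x this).1 hx⟩

theorem exists_least (M : Model N S) [hM : M.Std] (P : N → Prop) [Fm M true (fun e _ => P (e 0))] {a : N} (ha : P a) :
    ∃ x, P x ∧ ∀ y < x, ¬ P y := by
  by_contra hcon
  push Not at hcon
  have := hM.vzero.induction (fun x => ∀ y, y < x + 1 → ¬ P y) (fun y hy hP => by
      obtain ⟨z, hz, -⟩ := hcon y hP
      rw [hM.zero_eq, zero_add] at hy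
      rw [← zero_add (1 : N), lt_add_one M] at hy
      exact not_lt_of_ge zero_le (hz.trans_le hy))
    (fun x hx y hy hP => by
      obtain ⟨z, hz, hPz⟩ := hcon y hP
      rw [lt_add_one M, hM.succ_eq] at hy
      exact hx z (hz.trans_le hy) hPz) a a ((lt_add_one M _ _).2 le_rfl)
  exact this ha

theorem strong_induction (M : Model N S) [hM : M.Std] (P : N → Prop) [Fm M true (fun e _ => P (e 0))]
    (h : ∀ x, (∀ y < x, P y) → P x) (x : N) : P x := by
  by_contra hx
  obtain ⟨y, hy, hy'⟩ := exists_least M (fun x => ¬ P x) hx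
  exact hy (h y fun z hz => not_not.1 (hy' z hz))

/-! ### Pairs -/

theorem pair_eq (x y : N) : M.pair x y = (x + y) * (x + y + 1) + 2 * y := by
  rw [pair, hM.add_eq, hM.mul_eq, hM.mul_eq, hM.add_eq, hM.succ_eq, two_eq]

/-- The pairing is twice Cantor's: the pairs with sum s get codes between s(s+1) and s(s+1) + 2s,
which is below (s+1)(s+2), where the next diagonal starts. Injectivity and all monotonicity
properties follow from this. -/
theorem pair_lt_pair_of_add_lt {x y x' y' : N} (h : x + y < x' + y') :
    M.pair x y < M.pair x' y' := by
  rw [pair_eq, pair_eq]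
  have h1 : x + y + 1 ≤ x' + y' := (add_one_le M _ _).2 h
  calc (x + y) * (x + y + 1) + 2 * y ≤ (x + y) * (x + y + 1) + 2 * (x + y) := by
        gcongr; exact le_add_self
    _ < (x + y) * (x + y + 1) + 2 * (x + y) + 2 := lt_add_of_pos_right _ two_pos
    _ = (x + y + 1) * (x + y + 1 + 1) := by ring
    _ ≤ (x' + y') * (x' + y' + 1) := by gcongr
    _ ≤ _ := le_self_add

theorem pair_inj {x y x' y' : N} : M.pair x y = M.pair x' y' ↔ x = x' ∧ y = y' := by
  refine ⟨fun h => ?_, by rintro ⟨rfl, rfl⟩; rfl⟩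
  rcases lt_trichotomy (x + y) (x' + y') with h1 | h1 | h1
  · exact absurd h (pair_lt_pair_of_add_lt h1).ne
  · rw [pair_eq, pair_eq, h1] at h
    have h2 : y = y' := mul_left_cancel₀ two_ne_zero (add_left_cancel h)
    subst h2
    exact ⟨add_right_cancel h1, rfl⟩
  · exact absurd h (pair_lt_pair_of_add_lt h1).ne'

theorem pair_le_pair {x y x' y' : N} (hx : x ≤ x') (hy : y ≤ y') :
    M.pair x y ≤ M.pair x' y' := by
  rw [pair_eq, pair_eq]; gcongr

theorem pair_lt_pair_left {x x' : N} (h : x < x') (y : N) : M.pair x y < M.pair x' y :=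
  pair_lt_pair_of_add_lt (by gcongr)

theorem pair_lt_pair_right (x : N) {y y' : N} (h : y < y') : M.pair x y < M.pair x y' :=
  pair_lt_pair_of_add_lt (by gcongr)

theorem pair_lt_pair {x y x' y' : N} (hx : x < x') (hy : y < y') :
    M.pair x y < M.pair x' y' :=
  pair_lt_pair_of_add_lt (by gcongr)

theorem add_le_pair (M : Model N S) [hM : M.Std] (x y : N) : x + y ≤ M.pair x y := by
  rw [pair_eq]
  calc x + y = (x + y) * 1 := (mul_one _).symm
    _ ≤ (x + y) * (x + y + 1) := by gcongr; exact le_add_self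
    _ ≤ _ := le_self_add

theorem left_le_pair (M : Model N S) [hM : M.Std] (x y : N) : x ≤ M.pair x y := le_self_add.trans (add_le_pair M x y)

theorem right_le_pair (M : Model N S) [hM : M.Std] (x y : N) : y ≤ M.pair x y := le_add_self.trans (add_le_pair M x y)

theorem left_lt_len {x y : N} {X : S} (h : M.mem (M.pair x y) X) : x < M.len X :=
  (left_le_pair M x y).trans_lt (lt_len h)

theorem right_lt_len {x y : N} {X : S} (h : M.mem (M.pair x y) X) : y < M.len X :=
  (right_le_pair M x y).trans_lt (lt_len h)

/-! ### Division with remainder -/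

/-- Division with remainder serves to arrange lines, gates and indices in blocks of width W. -/
theorem exists_mul_add (M : Model N S) [hM : M.Std] (W : N) (hW : 0 < W) (x : N) : ∃ l j, j < W ∧ x = l * W + j := by
  have := hM.vzero.induction (fun x => ∃ l, l < x + 1 ∧ ∃ j, j < W ∧ x = l * W + j)
    ⟨0, by rw [hM.zero_eq, zero_add]; exact one_pos, 0, hW, by simp [hM.zero_eq]⟩
    (fun x ⟨l, hl, j, hj, hx⟩ => by
      rw [hM.succ_eq]
      rcases ((add_one_le M _ _).2 hj).lt_or_eq with h | h
      · exact ⟨l, hl.trans_le le_self_add, j + 1, h, by rw [hx]; ring⟩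
      · exact ⟨l + 1, by gcongr, 0, hW, by rw [hx, add_assoc, h]; ring⟩) x
  obtain ⟨l, -, j, h⟩ := this
  exact ⟨l, j, h⟩

theorem mul_add_lt (M : Model N S) [hM : M.Std] {l l' W j : N} (hl : l < l') (hj : j < W) : l * W + j < l' * W := by
  have := (add_one_le M _ _).2 hl
  calc l * W + j < l * W + W := by gcongr
    _ = (l + 1) * W := by ring
    _ ≤ l' * W := by gcongr

theorem mul_add_inj (M : Model N S) [hM : M.Std] {l l' W j j' : N} (hj : j < W) (hj' : j' < W) :
    l * W + j = l' * W + j' ↔ l = l' ∧ j = j' := by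
  refine ⟨fun h => ?_, by rintro ⟨rfl, rfl⟩; rfl⟩
  rcases lt_trichotomy l l' with h1 | rfl | h1
  · exact absurd h ((mul_add_lt M h1 hj).trans_le le_self_add).ne
  · exact ⟨rfl, add_left_cancel h⟩
  · exact absurd h ((mul_add_lt M h1 hj').trans_le le_self_add).ne'

end Model

end TwoSorted

set_option linter.unusedSectionVars false

namespace TwoSorted

namespace Model

variable {N : Type u} {S : Type v} [CommSemiring N] [LinearOrder N] [IsStrictOrderedRing N]
  [CanonicallyOrderedAdd N] [Nonempty S] {M : Model N S} [hM : M.Std]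

/-! ### Gates -/

variable (M) in
/-- `T` and `T'` have the same gates, possibly with different output gates. -/
structure SameGates (T T' : Set N) : Prop where
  isAnd : ∀ x, M.IsAnd T x ↔ M.IsAnd T' x
  isNeg : ∀ x, M.IsNeg T x ↔ M.IsNeg T' x
  edge : ∀ y x, M.Edge T y x ↔ M.Edge T' y x

theorem SameGates.refl (T : Set N) : M.SameGates T T :=
  ⟨fun _ => Iff.rfl, fun _ => Iff.rfl, fun _ _ => Iff.rfl⟩

theorem SameGates.symm {T T' : Set N} (h : M.SameGates T T') : M.SameGates T' T :=
  ⟨fun x => (h.1 x).symm, fun x => (h.2 x).symm, fun y x => (h.3 y x).symm⟩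

theorem SameGates.trans {T T' T'' : Set N} (h : M.SameGates T T') (h' : M.SameGates T' T'') :
    M.SameGates T T'' :=
  ⟨fun x => (h.1 x).trans (h'.1 x), fun x => (h.2 x).trans (h'.2 x),
    fun y x => (h.3 y x).trans (h'.3 y x)⟩

theorem edge_lt {T : Set N} {y x : N} (h : M.Edge T y x) : y < x := (lt_iff (M := M) _ _).1 h.1

theorem isAnd_lt_len {X : S} {i x : N} (h : M.IsAnd (M.row X i) x) : x < M.len X :=
  (right_le_pair M _ _).trans_lt (right_lt_len (M := M) h)

theorem isNeg_lt_len {X : S} {i x : N} (h : M.IsNeg (M.row X i) x) : x < M.len X :=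
  (right_le_pair M _ _).trans_lt (right_lt_len (M := M) h)

theorem edge_lt_len {X : S} {i y x : N} (h : M.Edge (M.row X i) y x) : x < M.len X :=
  (right_le_pair M _ _).trans_lt ((right_le_pair M _ _).trans_lt (right_lt_len (M := M) h.2))

theorem isAnd_lt_len' {X : S} {x : N} (h : M.IsAnd (M.bits X) x) : x < M.len X :=
  right_lt_len (M := M) h

theorem isNeg_lt_len' {X : S} {x : N} (h : M.IsNeg (M.bits X) x) : x < M.len X :=
  right_lt_len (M := M) h

theorem edge_lt_len' {X : S} {y x : N} (h : M.Edge (M.bits X) y x) : x < M.len X :=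
  (right_le_pair M _ _).trans_lt (right_lt_len (M := M) h.2)

/-- Sequences of circuits are given by definable descriptions of their gates. -/
theorem exists_system (M : Model N S) [hM : M.Std] (a b : N) (A Ng O : N → N → Prop)
    (Ed : N → N → N → Prop)
    [hA : Fm M true (fun e _ => A (e 0) (e 1))] [hN : Fm M true (fun e _ => Ng (e 0) (e 1))]
    [hO : Fm M true (fun e _ => O (e 0) (e 1))] [hE : Fm M true (fun e _ => Ed (e 0) (e 1) (e 2))]
    (hA' : ∀ i x, A i x → i < a ∧ x < b) (hN' : ∀ i x, Ng i x → i < a ∧ x < b)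
    (hO' : ∀ i x, O i x → i < a ∧ x < b) (hE' : ∀ i y x, Ed i y x → i < a ∧ y < x ∧ x < b) :
    ∃ X : S, ∀ i, (∀ x, M.IsAnd (M.row X i) x ↔ A i x) ∧ (∀ x, M.IsNeg (M.row X i) x ↔ Ng i x) ∧
      (∀ x, M.IsOut (M.row X i) x ↔ O i x) ∧ ∀ y x, M.Edge (M.row X i) y x ↔ Ed i y x := by
  -- In this form the hypothesis acts as a local instance for `A` applied to arbitrary terms.
  have hA := hA.subst₂
  have hN := hN.subst₂
  have hO := hO.subst₂
  have hE := hE.subst₃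
  -- The tags 0, 1, 3, 2 of conjunctions, negations, outputs and edges differ, so the four disjuncts
  -- do not interfere. All quantifiers are bounded.
  obtain ⟨X, -, hX⟩ := exists_set M (fun v => ∃ i, i < a ∧ ∃ x, x < b ∧
    ((v = M.pair i (M.pair M.zero x) ∧ A i x) ∨ (v = M.pair i (M.pair M.one x) ∧ Ng i x) ∨
      (v = M.pair i (M.pair M.three x) ∧ O i x) ∨
      ∃ y, y < x ∧ v = M.pair i (M.pair M.two (M.pair y x)) ∧ Ed i y x))
    (M.pair a (M.pair 3 (M.pair b b)))
  have h0 : M.zero = 0 := hM.zero_eq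
  have h1 : M.one = 1 := one_eq
  have h2 : M.two = 2 := two_eq
  have h3 : M.three = 3 := three_eq
  have h01 : (0 : N) ≠ 1 := zero_ne_one
  have h12 : (1 : N) < 2 := one_lt_two
  have h23 : (2 : N) < 3 := by
    rw [← two_add_one_eq_three]; exact lt_add_of_pos_right _ one_pos
  have h02 : (0 : N) < 2 := two_pos
  have hb {i c x : N} (hi : i < a) (hc : c ≤ 3) (hx : x ≤ M.pair b b) :
      M.pair i (M.pair c x) < M.pair a (M.pair 3 (M.pair b b)) :=
    (pair_lt_pair_left hi _).trans_le (pair_le_pair le_rfl (pair_le_pair hc hx))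
  have hxb {x : N} (hx : x < b) : x ≤ M.pair b b := hx.le.trans (left_le_pair M b b)
  refine ⟨X, fun i => ⟨fun x => ?_, fun x => ?_, fun x => ?_, fun y x => ?_⟩⟩
  · change M.mem _ X ↔ _
    rw [hX]
    simp only [h0, h1, h2, h3, pair_inj]
    constructor
    · rintro ⟨-, i', -, x', -, (h | h | h | ⟨_, -, h⟩)⟩
      · obtain ⟨⟨rfl, -, rfl⟩, h⟩ := h; exact h
      · exact absurd h.1.2.1 h01
      · exact absurd h.1.2.1 (h02.trans h23).ne
      · exact absurd h.1.2.1 h02.ne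
    · intro h
      obtain ⟨hi, hx⟩ := hA' _ _ h
      exact ⟨hb hi zero_le (hxb hx), i, hi, x, hx, Or.inl ⟨⟨rfl, trivial, rfl⟩, h⟩⟩
  · change M.mem _ X ↔ _
    rw [hX]
    simp only [h0, h1, h2, h3, pair_inj]
    constructor
    · rintro ⟨-, i', -, x', -, (h | h | h | ⟨_, -, h⟩)⟩
      · exact absurd h.1.2.1 h01.symm
      · obtain ⟨⟨rfl, -, rfl⟩, h⟩ := h; exact h
      · exact absurd h.1.2.1 (h12.trans h23).ne
      · exact absurd h.1.2.1 h12.ne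
    · intro h
      obtain ⟨hi, hx⟩ := hN' _ _ h
      exact ⟨hb hi (h12.trans h23).le (hxb hx), i, hi, x, hx, Or.inr (Or.inl ⟨⟨rfl, trivial, rfl⟩, h⟩)⟩
  · change M.mem _ X ↔ _
    rw [hX]
    simp only [h0, h1, h2, h3, pair_inj]
    constructor
    · rintro ⟨-, i', -, x', -, (h | h | h | ⟨_, -, h⟩)⟩
      · exact absurd h.1.2.1 (h02.trans h23).ne'
      · exact absurd h.1.2.1 (h12.trans h23).ne'
      · obtain ⟨⟨rfl, -, rfl⟩, h⟩ := h; exact h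
      · exact absurd h.1.2.1 h23.ne'
    · intro h
      obtain ⟨hi, hx⟩ := hO' _ _ h
      exact ⟨hb hi le_rfl (hxb hx), i, hi, x, hx,
        Or.inr (Or.inr (Or.inl ⟨⟨rfl, trivial, rfl⟩, h⟩))⟩
  · change M.lt y x ∧ M.mem _ X ↔ _
    rw [hX]
    simp only [h0, h1, h2, h3, pair_inj, lt_iff]
    constructor
    · rintro ⟨-, -, i', -, x', -, (h | h | h | ⟨y', -, h⟩)⟩
      · exact absurd h.1.2.1 h02.ne'
      · exact absurd h.1.2.1 h12.ne'
      · exact absurd h.1.2.1 h23.ne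
      · obtain ⟨⟨rfl, -, rfl, rfl⟩, h⟩ := h; exact h
    · intro h
      obtain ⟨hi, hy, hx⟩ := hE' _ _ _ h
      exact ⟨hy, hb hi h23.le (pair_le_pair (hy.trans hx).le hx.le), i, hi, x, hx,
        Or.inr (Or.inr (Or.inr ⟨y, hy, ⟨rfl, trivial, rfl, rfl⟩, h⟩))⟩

/-- Circuits are given by definable descriptions of their gates. -/
theorem exists_network (M : Model N S) [hM : M.Std] (b : N) (A Ng O : N → Prop) (Ed : N → N → Prop)
    [hA : Fm M true (fun e _ => A (e 0))] [hN : Fm M true (fun e _ => Ng (e 0))]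
    [hO : Fm M true (fun e _ => O (e 0))] [hE : Fm M true (fun e _ => Ed (e 0) (e 1))]
    (hA' : ∀ x, A x → x < b) (hN' : ∀ x, Ng x → x < b)
    (hO' : ∀ x, O x → x < b) (hE' : ∀ y x, Ed y x → y < x ∧ x < b) :
    ∃ X : S, (∀ x, M.IsAnd (M.bits X) x ↔ A x) ∧ (∀ x, M.IsNeg (M.bits X) x ↔ Ng x) ∧
      (∀ x, M.IsOut (M.bits X) x ↔ O x) ∧ ∀ y x, M.Edge (M.bits X) y x ↔ Ed y x := by
  have hA := hA.subst₁
  have hN := hN.subst₁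
  have hO := hO.subst₁
  have hE := hE.subst₂
  obtain ⟨X, hX⟩ := exists_system M 1 b (fun i x => i = 0 ∧ A x) (fun i x => i = 0 ∧ Ng x)
    (fun i x => i = 0 ∧ O x) (fun i y x => i = 0 ∧ Ed y x)
    (by rintro i x ⟨rfl, h⟩; exact ⟨one_pos, hA' x h⟩)
    (by rintro i x ⟨rfl, h⟩; exact ⟨one_pos, hN' x h⟩)
    (by rintro i x ⟨rfl, h⟩; exact ⟨one_pos, hO' x h⟩)
    (by rintro i y x ⟨rfl, h⟩; exact ⟨one_pos, hE' y x h⟩)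
  obtain ⟨Y, -, hY⟩ := exists_set M (fun v => v ∈ M.row X 0) (M.len X)
  have : M.bits Y = M.row X 0 := by
    ext v
    exact (hY v).trans ⟨fun h => h.2, fun h => ⟨right_lt_len h, h⟩⟩
  refine ⟨Y, ?_⟩
  rw [this]
  simpa using hX 0

end Model

end TwoSorted

set_option linter.unusedSectionVars false

namespace TwoSorted

namespace Model

/-! ### Sequents and derivations by cases -/

/-- Sets of literals. -/
abbrev Seq (N : Type u) := Bool → N → N → Prop

variable {N : Type u} {S : Type v}

/-- The sequent `Γ` together with one more literal. -/
def Seq.ins (Γ : Seq N) (b : Bool) (k x : N) : Seq N :=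
  fun b' k' x' => Γ b' k' x' ∨ (b' = b ∧ k' = k ∧ x' = x)

theorem Seq.ins_le_ins {Γ Γ' : Seq N} (h : Γ ≤ Γ') (b : Bool) (k x : N) :
    Γ.ins b k x ≤ Γ'.ins b k x :=
  fun _ _ _ h' => h'.imp (h _ _ _) id

/-- Derivability of a sequent from a set of sequents by at most `d` nested case distinctions: if all
literals of `Γ` are false, then one of the literals of the chosen premise is true. -/
def Der : ℕ → Set (Seq N) → Seq N → Prop
  | 0, 𝒜, Γ => ∃ Δ ∈ 𝒜, Δ ≤ Γ
  | d + 1, 𝒜, Γ => ∃ Δ ∈ 𝒜, ∀ b k x, Δ b k x → Γ b k x ∨ Der d 𝒜 (Γ.ins (!b) k x)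

theorem Der.mono {𝒜 ℬ : Set (Seq N)} (h : ∀ Δ ∈ 𝒜, ∃ Δ' ∈ ℬ, Δ' ≤ Δ) {d : ℕ} {Γ Γ' : Seq N}
    (hΓ : Γ ≤ Γ') (hd : Der d 𝒜 Γ) : Der d ℬ Γ' := by
  induction d generalizing Γ Γ' with
  | zero =>
    obtain ⟨Δ, hΔ, hle⟩ := hd
    obtain ⟨Δ', hΔ', hle'⟩ := h Δ hΔ
    exact ⟨Δ', hΔ', hle'.trans (hle.trans hΓ)⟩
  | succ d ih =>
    obtain ⟨Δ, hΔ, hle⟩ := hd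
    obtain ⟨Δ', hΔ', hle'⟩ := h Δ hΔ
    refine ⟨Δ', hΔ', fun b k x hb => ?_⟩
    exact (hle b k x (hle' b k x hb)).imp (hΓ b k x) (ih (Seq.ins_le_ins hΓ _ _ _))

theorem Der.succ {𝒜 : Set (Seq N)} {d : ℕ} {Γ : Seq N} (hd : Der d 𝒜 Γ) : Der (d + 1) 𝒜 Γ := by
  induction d generalizing Γ with
  | zero =>
    obtain ⟨Δ, hΔ, hle⟩ := hd
    exact ⟨Δ, hΔ, fun b k x h => Or.inl (hle b k x h)⟩
  | succ d ih =>
    obtain ⟨Δ, hΔ, hle⟩ := hd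
    exact ⟨Δ, hΔ, fun b k x h => (hle b k x h).imp_right ih⟩

theorem Der.of_le {𝒜 : Set (Seq N)} {d d' : ℕ} (h : d ≤ d') {Γ : Seq N} (hd : Der d 𝒜 Γ) :
    Der d' 𝒜 Γ := by
  induction h with
  | refl => exact hd
  | step _ ih => exact ih.succ

/-- A sequent derivable from true sequents is true. -/
theorem Der.sound {𝒜 : Set (Seq N)} {v : N → N → Prop} {c : N → Prop}
    (h : ∀ Δ ∈ 𝒜, ∃ b k x, Δ b k x ∧ c k ∧ (b = true ↔ v k x)) {d : ℕ} {Γ : Seq N}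
    (hd : Der d 𝒜 Γ) : ∃ b k x, Γ b k x ∧ c k ∧ (b = true ↔ v k x) := by
  induction d generalizing Γ with
  | zero =>
    obtain ⟨Δ, hΔ, hle⟩ := hd
    obtain ⟨b, k, x, h1, h2⟩ := h Δ hΔ
    exact ⟨b, k, x, hle b k x h1, h2⟩
  | succ d ih =>
    obtain ⟨Δ, hΔ, hle⟩ := hd
    obtain ⟨b, k, x, h1, h2⟩ := h Δ hΔ
    rcases hle b k x h1 with h3 | h3
    · exact ⟨b, k, x, h3, h2⟩
    · obtain ⟨b', k', x', h4 | ⟨rfl, rfl, rfl⟩, h5⟩ := ih h3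
      · exact ⟨b', k', x', h4, h5⟩
      -- The true literal found in the branch would be the complement of the literal of Δ known to
      -- be true.
      · have := h2.2.trans h5.2.symm
        cases b <;> simp at this

variable [CommSemiring N] [LinearOrder N] [IsStrictOrderedRing N]
  [CanonicallyOrderedAdd N] [Nonempty S] {M : Model N S} [hM : M.Std]

/-! ### Sequences of sequents -/

instance Fm.line {c : Bool} {t t' t'' : (ℕ → N) → (ℕ → S) → N} {X : (ℕ → S) → S} {b : Bool} [Ss X]
    [Tm M t] [Tm M t'] [Tm M t''] :
    Fm M b (fun e s => M.line (X s) (t e s) c (t' e s) (t'' e s)) := by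
  unfold Model.line; infer_instance

/-- The code of a literal. -/
def litCode (M : Model N S) (b : Bool) (k x : N) : N :=
  M.pair (bif b then M.one else M.zero) (M.pair k x)

theorem line_iff (Q : S) (l : N) (b : Bool) (k x : N) :
    M.line Q l b k x ↔ M.mem (M.pair l (M.litCode b k x)) Q := Iff.rfl

instance Tm.litCode {c : Bool} {t t' : (ℕ → N) → (ℕ → S) → N} [Tm M t] [Tm M t'] :
    Tm M (fun e s => M.litCode c (t e s) (t' e s)) := by
  unfold Model.litCode; infer_instance

theorem litCode_inj {b b' : Bool} {k x k' x' : N} :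
    M.litCode b k x = M.litCode b' k' x' ↔ b = b' ∧ k = k' ∧ x = x' := by
  have h0 : M.zero = 0 := hM.zero_eq
  have h1 : M.one = 1 := one_eq
  rw [litCode, litCode, pair_inj, pair_inj, h0, h1]
  cases b <;> cases b' <;> simp

/-- A bound for the codes of literals. -/
def litBound (M : Model N S) (w : N) : N := M.pair M.one (M.pair w w)

theorem litCode_lt {b : Bool} {k x w : N} (hk : k < w) (hx : x < w) :
    M.litCode b k x < M.litBound w := by
  have h0 : M.zero = 0 := hM.zero_eq
  refine lt_of_le_of_lt (pair_le_pair (x' := M.one) ?_ le_rfl)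
    (pair_lt_pair_right _ (pair_lt_pair hk hx))
  cases b
  · exact h0 ▸ zero_le
  · exact le_rfl

theorem fst_lt_len {Q : S} {l k x : N} {b : Bool} (h : M.line Q l b k x) : k < M.len Q :=
  (left_le_pair M _ _).trans_lt ((right_le_pair M _ _).trans_lt (right_lt_len (M := M) h))

theorem snd_lt_len {Q : S} {l k x : N} {b : Bool} (h : M.line Q l b k x) : x < M.len Q :=
  (right_le_pair M _ _).trans_lt ((right_le_pair M _ _).trans_lt (right_lt_len (M := M) h))

/-- Sequences of sequents are given by definable descriptions. -/
theorem exists_lines (M : Model N S) [hM : M.Std] (a w : N) (Δ : N → Seq N)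
    [h : ∀ b, Fm M true (fun e _ => Δ (e 0) b (e 1) (e 2))]
    (hw : ∀ l b k x, Δ l b k x → l < a ∧ k < w ∧ x < w) :
    ∃ Q : S, ∀ l, M.line Q l = Δ l := by
  have h (b) := Fm.subst₃ (P := fun l k x => Δ l b k x) (h b)
  obtain ⟨Q, -, hQ⟩ := exists_set M (fun v => ∃ l, l < a ∧ ∃ k, k < w ∧ ∃ x, x < w ∧ ∃ b,
    v = M.pair l (M.litCode b k x) ∧ Δ l b k x) (M.pair a (M.litBound w))
  refine ⟨Q, fun l => ?_⟩
  funext b k x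
  rw [eq_iff_iff, line_iff, hQ]
  simp only [pair_inj, litCode_inj]
  constructor
  · rintro ⟨-, l', -, k', -, x', -, b', ⟨rfl, rfl, rfl, rfl⟩, h⟩; exact h
  · intro h
    obtain ⟨hl, hk, hx⟩ := hw _ _ _ _ h
    exact ⟨pair_lt_pair hl (litCode_lt hk hx), l, hl, k, hk, x, hx, b, ⟨rfl, rfl, rfl, rfl⟩, h⟩

/-- Sequences of blocks of sequents are given by definable descriptions. -/
theorem exists_lines₂ (M : Model N S) [hM : M.Std] (a W w : N) (Δ : N → N → Seq N)
    [h : ∀ b, Fm M true (fun e _ => Δ (e 0) (e 1) b (e 2) (e 3))]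
    (hw : ∀ l j b k x, Δ l j b k x → k < w ∧ x < w) :
    ∃ Q : S, ∀ l < a, ∀ j < W, M.line Q (l * W + j) = Δ l j := by
  have h (b) : Fm M true (fun e _ => Δ (e 1) (e 0) b (e 3) (e 4)) :=
    (h b).reindex (f := fun i => if i = 0 then 1 else if i = 1 then 0 else i + 1)
      (fun i j hij => by simp only at hij; split_ifs at hij <;> omega)
  obtain ⟨Q, hQ⟩ := exists_lines M (a * W) w (fun v b k x => v < a * W ∧ ∃ l, l < a ∧ ∃ j, j < W ∧
    v = l * W + j ∧ Δ l j b k x) (fun v b k x ⟨h1, l, hl, j, hj, _, h2⟩ => ⟨h1, hw _ _ _ _ _ h2⟩)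
  refine ⟨Q, fun l hl j hj => ?_⟩
  rw [hQ]
  funext b k x
  rw [eq_iff_iff]
  constructor
  · rintro ⟨-, l', hl', j', hj', h1, h2⟩
    obtain ⟨rfl, rfl⟩ := (mul_add_inj M hj hj').1 h1
    exact h2
  · exact fun h => ⟨mul_add_lt M hl hj, l, hl, j, hj, rfl, h⟩

/-- The set of the sequents before number `l` of the sequence coded by `V`. -/
def linesBefore (M : Model N S) (V : S) (l : N) : Set (Seq N) := {Δ | ∃ l', l' < l ∧ Δ = M.line V l'}

/-- Since d is a standard number, `Der d` unwinds into an actual formula. It is Σ₀ᴮ because the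
literals of the premises are bounded by |V|. -/
theorem Fm.der (V : S) (d : ℕ) (Γ : (ℕ → N) → (ℕ → S) → Seq N) (t : (ℕ → N) → (ℕ → S) → N)
    [ht : Tm M t] (h : ∀ b, Fm M true (fun e s => Γ (fun i => e (i + 2)) s b (e 0) (e 1))) :
    Fm M true (fun e s => Der d (M.linesBefore V (t e s)) (Γ e s)) := by
  induction d generalizing Γ t with
  | zero =>
    have h0 (b) : Fm M true (fun e s => Γ (fun i => e (i + 1 + 1 + 1)) s b (e 0) (e 1)) :=
      (h b).reindex (f := fun i => if i = 0 then 0 else if i = 1 then 1 else i + 1)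
        (fun i j hij => by simp only at hij; split_ifs at hij <;> omega)
    refine Fm.congr (P := fun e s => ∃ l, l < t e s ∧ ∀ b, ∀ x, x < M.len V → ∀ k, k < M.len V →
      M.line V l b k x → Γ e s b k x) inferInstance fun e s => ?_
    constructor
    · rintro ⟨l, hl, h⟩
      exact ⟨_, ⟨l, hl, rfl⟩, fun b k x h' => h b x (snd_lt_len h') k (fst_lt_len h') h'⟩
    · rintro ⟨_, ⟨l, hl, rfl⟩, h⟩
      exact ⟨l, hl, fun b x _ k _ h' => h b k x h'⟩
  | succ d ih =>
    have h0 (b) : Fm M true (fun e s => Γ (fun i => e (i + 1 + 1 + 1)) s b (e 0) (e 1)) :=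
      (h b).reindex (f := fun i => if i = 0 then 0 else if i = 1 then 1 else i + 1)
        (fun i j hij => by simp only at hij; split_ifs at hij <;> omega)
    have h1 (b c) : Fm M true (fun e s =>
        Seq.ins (Γ (fun i => e (i + 2 + 3)) s) c (e 2) (e 3) b (e 0) (e 1)) := by
      have : Fm M true (fun e s => Γ (fun i => e (i + 2 + 3)) s b (e 0) (e 1)) :=
        (h b).reindex (f := fun i => if i = 0 then 0 else if i = 1 then 1 else i + 3)
          (fun i j hij => by simp only at hij; split_ifs at hij <;> omega)
      unfold Seq.ins; infer_instance
    have h2 (c) := @ih (fun e s => Seq.ins (Γ (fun i => e (i + 3)) s) c (e 0) (e 1))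
      (fun e s => t (fun i => e (i + 3)) s) ht.lift.lift.lift (fun b => h1 b c)
    refine Fm.congr (P := fun e s => ∃ l, l < t e s ∧ ∀ b, ∀ x, x < M.len V → ∀ k, k < M.len V →
      M.line V l b k x → Γ e s b k x ∨ Der d (M.linesBefore V (t e s)) ((Γ e s).ins (!b) k x)) ?_
      fun e s => ?_
    · have h3 (c : Bool) : Fm M true (fun e s =>
          Der d (M.linesBefore V (t (fun i => e (i + 1 + 1 + 1)) s))
            (Seq.ins (Γ (fun i => e (i + 1 + 1 + 1)) s) (!c) (e 0) (e 1))) := h2 (!c)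
      infer_instance
    constructor
    · rintro ⟨l, hl, h⟩
      exact ⟨_, ⟨l, hl, rfl⟩, fun b k x h' => h b x (snd_lt_len h') k (fst_lt_len h') h'⟩
    · rintro ⟨_, ⟨l, hl, rfl⟩, h⟩
      exact ⟨l, hl, fun b x _ k _ h' => h b k x h'⟩

end Model

end TwoSorted

set_option linter.unusedSectionVars false
set_option synthInstance.maxSize 1000
set_option synthInstance.maxHeartbeats 200000

namespace TwoSorted

namespace Model

variable {N : Type u} {S : Type v} [CommSemiring N] [LinearOrder N] [IsStrictOrderedRing N]
  [CanonicallyOrderedAdd N] [Nonempty S] {M : Model N S} [hM : M.Std]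

/-! ### Extended Frege derivations by cases -/

theorem EFAxiom.mono {n : N} {D : N → Set N} {Γ Γ' : Seq N} (hΓ : Γ ≤ Γ') (h : M.EFAxiom n D Γ) :
    M.EFAxiom n D Γ' := by
  cases h with
  | identity k x h h' => exact .identity k x (hΓ _ _ _ h) (hΓ _ _ _ h')
  | input k k' x hx h h' => exact .input k k' x hx (hΓ _ _ _ h) (hΓ _ _ _ h')
  | andLeft k x y s hx hs hA hy h h' => exact .andLeft k x y s hx hs hA hy (hΓ _ _ _ h) (hΓ _ _ _ h')
  | andRight k x s hx hs hA h h' =>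
    exact .andRight k x s hx hs hA (fun y hy => hΓ _ _ _ (h y hy)) (hΓ _ _ _ h')
  | orLeft k x s hx hs hA h h' =>
    exact .orLeft k x s hx hs hA (hΓ _ _ _ h) (fun y hy => hΓ _ _ _ (h' y hy))
  | orRight k x y s hx hs hA hy h h' => exact .orRight k x y s hx hs hA hy (hΓ _ _ _ h) (hΓ _ _ _ h')

variable (M) in
/-- Every line before number `m` is an axiom or is derived by cases from earlier lines. -/
def EFDer (d : ℕ) (n : N) (D : N → Set N) (V : S) (m : N) : Prop :=
  ∀ l < m, M.EFAxiom n D (M.line V l) ∨ Der d (M.linesBefore V l) (M.line V l)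

variable (M) in
/-- Every line before number `m` is an axiom or is derived by a cut. -/
def EFCut (n : N) (D : N → Set N) (V : S) (m : N) : Prop :=
  ∀ l < m, M.EFAxiom n D (M.line V l) ∨
    ∃ l₁ l₂, l₁ < l ∧ l₂ < l ∧ IsCut (M.line V l₁) (M.line V l₂) (M.line V l)

/-- Consequently the first line of a derivation is an axiom, and it can be used to fill unused
positions. -/
theorem Der.not_empty {d : ℕ} {V : S} {Γ : Seq N} : ¬ Der d (M.linesBefore V 0) Γ := by
  cases d <;> rintro ⟨_, ⟨l, hl, -⟩, -⟩ <;> exact not_lt_of_ge zero_le hl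

theorem lt_of_mul_add_lt {l m W j : N} (h : l * W + j < m * W) :
    l < m := by
  by_contra hl
  have : m * W ≤ l * W := by gcongr; exact not_lt.1 hl
  exact absurd h (not_lt.2 (this.trans le_self_add))

/-- Every line Γ is replaced by a block with one position for each literal code and a last position
B for Γ itself. The position of a literal ℓ holds Γ, ℓ if that sequent is derivable with depth d +
1, and otherwise a copy of the first line. If Γ was derived with depth d + 2, the branches of its
outermost case distinction are now lines, and one case distinction remains. -/
theorem EFDer.step {d : ℕ} {n : N} {D : N → Set N} {V : S} {m : N} (hm : 0 < m)
    (h : M.EFDer (d + 2) n D V m) :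
    ∃ V' m', 0 < m' ∧ M.EFDer (d + 1) n D V' m' ∧ ∀ l < m, ∃ l' < m', M.line V' l' ≤ M.line V l := by
  set w := M.len V with hw
  set B := M.litBound w with hB
  have hcode {b : Bool} {k x l : N} (h : M.line V l b k x) : M.litCode b k x < B :=
    litCode_lt (fst_lt_len h) (snd_lt_len h)
  let G : N → N → Prop := fun l j => ∃ k, k < w ∧ ∃ x, x < w ∧ ∃ b, j = M.litCode b k x ∧
    Der (d + 1) (M.linesBefore V l) (Seq.ins (M.line V l) b k x)
  have hD (b : Bool) : Fm M true (fun e _ =>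
      Der (d + 1) (M.linesBefore V (e 0)) (Seq.ins (M.line V (e 0)) b (e 1) (e 2))) := by
    refine Fm.der V (d + 1) (fun e _ => Seq.ins (M.line V (e 0)) b (e 1) (e 2)) (fun e _ => e 0) ?_
    intro c
    unfold Seq.ins; infer_instance
  have hD (b : Bool) := Fm.subst₃ (P := fun l k x =>
      Der (d + 1) (M.linesBefore V l) (Seq.ins (M.line V l) b k x)) (hD b)
  have hG : Fm M true (fun e _ => G (e 0) (e 1)) := by
    simp only [G]; infer_instance
  have hG := hG.subst₂
  obtain ⟨V', hV'⟩ := exists_lines₂ M m (B + 1) w (fun l j b k x =>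
    (G l j ∧ (M.line V l b k x ∨ (k < w ∧ x < w ∧ j = M.litCode b k x))) ∨
    (¬ G l j ∧ j = B ∧ M.line V l b k x) ∨ (¬ G l j ∧ j ≠ B ∧ M.line V 0 b k x))
    (by
      rintro l j b k x (⟨-, h | h⟩ | ⟨-, -, h⟩ | ⟨-, -, h⟩)
      · exact ⟨fst_lt_len h, snd_lt_len h⟩
      · exact ⟨h.1, h.2.1⟩
      · exact ⟨fst_lt_len h, snd_lt_len h⟩
      · exact ⟨fst_lt_len h, snd_lt_len h⟩)
  have hjB {j : N} : j < B + 1 ↔ j ≤ B := lt_add_one M _ _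
  have hGB (l : N) : ¬ G l B := by
    rintro ⟨k, hk, x, hx, b, h, -⟩
    exact absurd (litCode_lt (M := M) (b := b) hk hx) (h ▸ lt_irrefl _)
  have hlast {l : N} (hl : l < m) : M.line V' (l * (B + 1) + B) = M.line V l := by
    rw [hV' l hl B (hjB.2 le_rfl)]
    funext b k x
    simp [hGB]
  have hins {l k x : N} {b : Bool} (hl : l < m) (hk : k < w) (hx : x < w)
      (hd : Der (d + 1) (M.linesBefore V l) (Seq.ins (M.line V l) b k x)) :
      M.line V' (l * (B + 1) + M.litCode b k x) = Seq.ins (M.line V l) b k x := by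
    rw [hV' l hl _ (hjB.2 (litCode_lt hk hx).le)]
    have hg : G l (M.litCode b k x) := ⟨k, hk, x, hx, b, rfl, hd⟩
    funext b' k' x'
    simp only [hg, true_and, not_true, false_and, or_false, litCode_inj, Seq.ins]
    apply propext
    constructor
    · rintro (h | ⟨-, -, rfl, rfl, rfl⟩)
      · exact Or.inl h
      · exact Or.inr ⟨rfl, rfl, rfl⟩
    · rintro (h | ⟨rfl, rfl, rfl⟩)
      · exact Or.inl h
      · exact Or.inr ⟨hk, hx, rfl, rfl, rfl⟩
  have hbefore {l v : N} (hl : l < m) (hv : l * (B + 1) ≤ v) :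
      ∀ Δ ∈ M.linesBefore V l, ∃ Δ' ∈ M.linesBefore V' v, Δ' ≤ Δ := by
    rintro _ ⟨l', hl', rfl⟩
    refine ⟨_, ⟨l' * (B + 1) + B, ?_, rfl⟩, (hlast (hl'.trans hl)).le⟩
    exact (mul_add_lt M hl' (hjB.2 le_rfl)).trans_le hv
  have hpos : 0 < B + 1 := lt_of_le_of_lt zero_le (hjB.2 le_rfl)
  refine ⟨V', m * (B + 1), mul_pos hm hpos, fun v hv => ?_, fun l hl =>
    ⟨_, mul_add_lt M hl (hjB.2 le_rfl), (hlast hl).le⟩⟩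
  obtain ⟨l, j, hj, rfl⟩ := exists_mul_add M (B + 1) hpos v
  have hl : l < m := lt_of_mul_add_lt hv
  by_cases hg : G l j
  · obtain ⟨k, hk, x, hx, b, rfl, hd⟩ := hg
    rw [hins hl hk hx hd]
    exact Or.inr (hd.mono (hbefore hl le_self_add) le_rfl)
  · by_cases hjb : j = B
    · subst hjb
      rw [hlast hl]
      rcases h l hl with h | h
      · exact Or.inl h
      · right
        obtain ⟨_, ⟨l', hl', rfl⟩, h⟩ := h
        refine Der.of_le (d := 1) (by omega) ⟨M.line V l', ?_, fun b k x hb => ?_⟩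
        · exact ⟨_, (mul_add_lt M hl' (hjB.2 le_rfl)).trans_le le_self_add,
            (hlast (hl'.trans hl)).symm⟩
        · refine (h b k x hb).imp_right fun h => ?_
          have h1 : k < w := fst_lt_len hb
          have h2 : x < w := snd_lt_len hb
          exact ⟨_, ⟨l * (B + 1) + M.litCode (!b) k x, by gcongr; exact litCode_lt h1 h2, rfl⟩,
            (hins hl h1 h2 h).le⟩
    · left
      have : M.line V' (l * (B + 1) + j) = M.line V 0 := by
        rw [hV' l hl j hj]
        funext b k x
        simp [hg, hjb]
      rw [this]
      exact (h 0 hm).resolve_right Der.not_empty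

/-- The literals of the premise Δ that are not in Γ are removed one at a time, in the order of their
codes. Position j of the block for Γ holds Γ together with the literals of Δ of code at least j;
passing to j + 1 is a cut with an earlier line contained in Γ and the complement of the literal of
code j. -/
theorem EFDer.cut {n : N} {D : N → Set N} {V : S} {m : N} (h : M.EFDer 1 n D V m) :
    ∃ V' m', M.EFCut n D V' m' ∧ ∀ l < m, ∃ l' < m', M.line V' l' ≤ M.line V l := by
  set w := M.len V with hw
  set B := M.litBound w with hB
  have hcode {b : Bool} {k x l : N} (h : M.line V l b k x) : M.litCode b k x < B :=
    litCode_lt (fst_lt_len h) (snd_lt_len h)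
  let G : N → N → Prop := fun l l₀ => l₀ < l ∧ ∀ b, ∀ k, k < w → ∀ x, x < w → M.line V l₀ b k x →
    M.line V l b k x ∨ ∃ l', l' < l ∧ ∀ b', ∀ k', k' < w → ∀ x', x' < w → M.line V l' b' k' x' →
      M.line V l b' k' x' ∨ (b' = (!b) ∧ k' = k ∧ x' = x)
  have hG : Fm M true (fun e _ => G (e 0) (e 1)) := by
    simp only [G]; infer_instance
  have hG := hG.subst₂
  -- The premise must be chosen definably, so the least suitable line `l₀` is taken.
  obtain ⟨V', hV'⟩ := exists_lines₂ M m (B + 1) w (fun l j b k x => M.line V l b k x ∨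
    ∃ l₀, l₀ < l ∧ (G l l₀ ∧ ∀ l₁, l₁ < l₀ → ¬ G l l₁) ∧ M.line V l₀ b k x ∧ j ≤ M.litCode b k x)
    (by
      rintro l j b k x (h | ⟨l₀, -, -, h, -⟩)
      · exact ⟨fst_lt_len h, snd_lt_len h⟩
      · exact ⟨fst_lt_len h, snd_lt_len h⟩)
  have hjB {j : N} : j < B + 1 ↔ j ≤ B := lt_add_one M _ _
  have hlast {l : N} (hl : l < m) : M.line V' (l * (B + 1) + B) = M.line V l := by
    rw [hV' l hl B (hjB.2 le_rfl)]
    funext b k x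
    apply propext
    constructor
    · rintro (h | ⟨l₀, -, -, h, h'⟩)
      · exact h
      · exact absurd (hcode h) (not_lt.2 h')
    · exact Or.inl
  have hpos : 0 < B + 1 := lt_of_le_of_lt zero_le (hjB.2 le_rfl)
  refine ⟨V', m * (B + 1), fun v hv => ?_, fun l hl =>
    ⟨_, mul_add_lt M hl (hjB.2 le_rfl), (hlast hl).le⟩⟩
  obtain ⟨l, j, hj, rfl⟩ := exists_mul_add M (B + 1) hpos v
  have hl : l < m := lt_of_mul_add_lt hv
  rcases h l hl with h | h
  · left
    refine h.mono ?_
    rw [hV' l hl j hj]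
    exact fun b k x h => Or.inl h
  right
  obtain ⟨l₀, hl₀, hmin⟩ : ∃ l₀, G l l₀ ∧ ∀ l₁, l₁ < l₀ → ¬ G l l₁ := by
    obtain ⟨_, ⟨l₀, hl₀, rfl⟩, h⟩ := h
    refine exists_least M (fun l₀ => G l l₀) (a := l₀) ⟨hl₀, fun b k _ x _ hb => ?_⟩
    refine (h b k x hb).imp_right ?_
    rintro ⟨_, ⟨l', hl', rfl⟩, h'⟩
    exact ⟨l', hl', fun b' k' _ x' _ hb' => h' b' k' x' hb'⟩
  have hline {j : N} (hj : j < B + 1) (b : Bool) (k x : N) : M.line V' (l * (B + 1) + j) b k x ↔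
      M.line V l b k x ∨ (M.line V l₀ b k x ∧ j ≤ M.litCode b k x) := by
    rw [hV' l hl j hj]
    constructor
    · rintro (h | ⟨l₁, -, h₁, h⟩)
      · exact Or.inl h
      · rcases lt_trichotomy l₀ l₁ with h2 | rfl | h2
        · exact absurd hl₀ (h₁.2 _ h2)
        · exact Or.inr h
        · exact absurd h₁.1 (hmin _ h2)
    · rintro (h | h)
      · exact Or.inl h
      · exact Or.inr ⟨l₀, hl₀.1, ⟨hl₀, hmin⟩, h⟩
  -- Position 0 contains all of Δ. It is a weakening of Δ, presented as a cut of Δ with itself on an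
  -- irrelevant variable.
  by_cases hj0 : j = 0
  · subst hj0
    have h1 := (mul_add_lt M hl₀.1 (hjB.2 (le_refl B))).trans_le (le_self_add (b := (0 : N)))
    refine ⟨_, _, h1, h1, 0, 0, ?_, ?_⟩ <;>
    · intro b k x hb
      rw [hlast (hl₀.1.trans hl)] at hb
      exact Or.inl ((hline hj _ _ _).2 (Or.inr ⟨hb, zero_le⟩))
  obtain ⟨i, rfl⟩ := exists_add_one M j hj0
  have hi : i < i + 1 := (lt_add_one M _ _).2 le_rfl
  have hi' : i < B + 1 := hi.trans hj
  have h1 : l * (B + 1) + i < l * (B + 1) + (i + 1) := by gcongr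
  -- If no literal outside Γ has code i, nothing has to be removed and the step is again a trivial
  -- cut.
  by_cases hlit : ∃ b k x, i = M.litCode b k x ∧ M.line V l₀ b k x ∧ ¬ M.line V l b k x
  · obtain ⟨b, k, x, rfl, hb, hb'⟩ := hlit
    obtain ⟨l', hl', h'⟩ := (hl₀.2 b k (fst_lt_len hb) x (snd_lt_len hb) hb).resolve_left hb'
    have h2 := (mul_add_lt M hl' (hjB.2 (le_refl B))).trans_le
      (le_self_add (b := (M.litCode b k x + 1 : N)))
    have hc1 : ∀ b' k' x', M.line V' (l * (B + 1) + M.litCode b k x) b' k' x' →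
        M.line V' (l * (B + 1) + (M.litCode b k x + 1)) b' k' x' ∨ (b' = b ∧ k' = k ∧ x' = x) := by
      intro b' k' x' h3
      rw [hline hi'] at h3
      rw [hline hj]
      rcases h3 with h3 | ⟨h3, h4⟩
      · exact Or.inl (Or.inl h3)
      · rcases h4.lt_or_eq with h4 | h4
        · exact Or.inl (Or.inr ⟨h3, (add_one_le M _ _).2 h4⟩)
        · obtain ⟨rfl, rfl, rfl⟩ := litCode_inj.1 h4
          exact Or.inr ⟨rfl, rfl, rfl⟩
    have hc2 : ∀ b' k' x', M.line V' (l' * (B + 1) + B) b' k' x' →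
        M.line V' (l * (B + 1) + (M.litCode b k x + 1)) b' k' x' ∨
          (b' = (!b) ∧ k' = k ∧ x' = x) := by
      intro b' k' x' h3
      rw [hlast (hl'.trans hl)] at h3
      rw [hline hj]
      exact (h' b' k' (fst_lt_len h3) x' (snd_lt_len h3) h3).imp_left Or.inl
    cases b
    · exact ⟨_, _, h2, h1, k, x, hc2, hc1⟩
    · exact ⟨_, _, h1, h2, k, x, hc1, hc2⟩
  · push Not at hlit
    refine ⟨_, _, h1, h1, 0, 0, ?_, ?_⟩ <;>
    · intro b k x hb
      left
      rw [hline hi'] at hb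
      rw [hline hj]
      rcases hb with hb | ⟨hb, h4⟩
      · exact Or.inl hb
      · rcases h4.lt_or_eq with h4 | h4
        · exact Or.inr ⟨hb, (add_one_le M _ _).2 h4⟩
        · exact Or.inl (hlit b k x h4 hb)

theorem EFDer.of_le {d d' : ℕ} (hd : d ≤ d') {n : N} {D : N → Set N} {V : S} {m : N}
    (h : M.EFDer d n D V m) : M.EFDer d' n D V m :=
  fun l hl => (h l hl).imp_right (Der.of_le hd)

/-- Derivations by cases are simulated by derivations with cuts. -/
theorem EFDer.exists_cut {d : ℕ} {n : N} {D : N → Set N} {V : S} {m : N} (hm : 0 < m)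
    (h : M.EFDer d n D V m) :
    ∃ V' m', M.EFCut n D V' m' ∧ ∀ l < m, ∃ l' < m', M.line V' l' ≤ M.line V l := by
  replace h : M.EFDer (d + 1) n D V m := h.of_le (by omega)
  -- Induction outside the model: the derivation is expanded only a standard number of times.
  induction d generalizing V m with
  | zero => exact h.cut
  | succ d ih =>
    obtain ⟨V₁, m₁, hm₁, h₁, h₁'⟩ := h.step hm
    obtain ⟨V₂, m₂, h₂, h₂'⟩ := ih hm₁ h₁
    refine ⟨V₂, m₂, h₂, fun l hl => ?_⟩
    obtain ⟨l', hl', hle⟩ := h₁' l hl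
    obtain ⟨l'', hl'', hle'⟩ := h₂' l' hl'
    exact ⟨l'', hl'', hle'.trans hle⟩

end Model

end TwoSorted

set_option linter.unusedSectionVars false
set_option synthInstance.maxSize 1000
set_option synthInstance.maxHeartbeats 200000

namespace TwoSorted

namespace Model

variable {N : Type u} {S : Type v} [CommSemiring N] [LinearOrder N] [IsStrictOrderedRing N]
  [CanonicallyOrderedAdd N] [Nonempty S] {M : Model N S} [hM : M.Std]

/-! ### Axioms for gates -/

/-- The sequent with two given literals. -/
def cl2 (b : Bool) (k x : N) (b' : Bool) (k' x' : N) : Seq N :=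
  fun β κ ξ => (β = b ∧ κ = k ∧ ξ = x) ∨ (β = b' ∧ κ = k' ∧ ξ = x')

variable (M) in
/-- A gate is the conjunction of the literals of its predecessors, up to signs: the literal of the
gate implies the literal of the predecessor `y`. -/
def leftSeq (T : Set N) (k x y : N) : Seq N :=
  fun β κ ξ => κ = k ∧ (((β = true ↔ ¬ (M.IsAnd T x ↔ ¬ M.IsNeg T x)) ∧ ξ = x) ∨
    ((β = true ↔ M.IsAnd T x) ∧ ξ = y))

variable (M) in
/-- A gate is the conjunction of the literals of its predecessors, up to signs: the literals of the
predecessors imply the literal of the gate. -/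
def rightSeq (T : Set N) (k x : N) : Seq N :=
  fun β κ ξ => κ = k ∧ (((β = true ↔ ¬ M.IsAnd T x) ∧ M.Edge T ξ x) ∨
    ((β = true ↔ (M.IsAnd T x ↔ ¬ M.IsNeg T x)) ∧ ξ = x))

variable (M) in
/-- The sequents expressing that the values of the gates are computed correctly. -/
def AxSet (n : N) (D : N → Set N) (c w : N) : Set (Seq N) :=
  {Γ | (∃ k < c, ∃ k' < c, ∃ x < n, Γ = cl2 false k x true k' x) ∨
    (∃ k < c, ∃ x < w, ∃ y, n ≤ x ∧ M.Edge (D k) y x ∧ Γ = M.leftSeq (D k) k x y) ∨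
    (∃ k < c, ∃ x < w, n ≤ x ∧ Γ = M.rightSeq (D k) k x)}

theorem efAxiom_cl2 {n : N} {D : N → Set N} {k k' x : N} (hx : x < n) :
    M.EFAxiom n D (cl2 false k x true k' x) :=
  .input k k' x ((lt_iff _ _).2 hx) (Or.inl ⟨rfl, rfl, rfl⟩) (Or.inr ⟨rfl, rfl, rfl⟩)

theorem efAxiom_leftSeq {n : N} {D : N → Set N} {k x y : N} (hx : n ≤ x) (hy : M.Edge (D k) y x) :
    M.EFAxiom n D (M.leftSeq (D k) k x y) := by
  have hx := (hM.le_iff n x).2 hx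
  by_cases hA : M.IsAnd (D k) x <;> by_cases hN : M.IsNeg (D k) x
  · exact .andLeft k x y false hx (by simp [hN]) hA hy ⟨rfl, Or.inl (by simp [hA, hN])⟩
      ⟨rfl, Or.inr (by simp [hA])⟩
  · exact .andLeft k x y true hx (by simp [hN]) hA hy ⟨rfl, Or.inl (by simp [hA, hN])⟩
      ⟨rfl, Or.inr (by simp [hA])⟩
  · exact .orRight k x y false hx (by simp [hN]) hA hy ⟨rfl, Or.inr (by simp [hA])⟩
      ⟨rfl, Or.inl (by simp [hA, hN])⟩
  · exact .orRight k x y true hx (by simp [hN]) hA hy ⟨rfl, Or.inr (by simp [hA])⟩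
      ⟨rfl, Or.inl (by simp [hA, hN])⟩

theorem efAxiom_rightSeq {n : N} {D : N → Set N} {k x : N} (hx : n ≤ x) :
    M.EFAxiom n D (M.rightSeq (D k) k x) := by
  have hx := (hM.le_iff n x).2 hx
  by_cases hA : M.IsAnd (D k) x <;> by_cases hN : M.IsNeg (D k) x
  · exact .andRight k x false hx (by simp [hN]) hA
      (fun y hy => ⟨rfl, Or.inl (by simp [hA, hy])⟩) ⟨rfl, Or.inr (by simp [hA, hN])⟩
  · exact .andRight k x true hx (by simp [hN]) hA
      (fun y hy => ⟨rfl, Or.inl (by simp [hA, hy])⟩) ⟨rfl, Or.inr (by simp [hA, hN])⟩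
  · exact .orLeft k x false hx (by simp [hN]) hA ⟨rfl, Or.inr (by simp [hA, hN])⟩
      (fun y hy => ⟨rfl, Or.inl (by simp [hA, hy])⟩)
  · exact .orLeft k x true hx (by simp [hN]) hA ⟨rfl, Or.inr (by simp [hA, hN])⟩
      (fun y hy => ⟨rfl, Or.inl (by simp [hA, hy])⟩)

/-! ### Renaming of circuits in derivations -/

/-- The image of a sequent under a renaming of the circuits. -/
def Seq.map (ρ : N → N) (Γ : Seq N) : Seq N := fun b κ x => ∃ k, κ = ρ k ∧ Γ b k x

/-- Axioms see the gates of a circuit but not its output. Thus circuits can be moved along any ρ,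
injective or not, which allows separate proofs to be merged over one common sequence of circuits. -/
theorem EFAxiom.map {n : N} {D D' : N → Set N} (ρ : N → N) (hD : ∀ k, M.SameGates (D k) (D' (ρ k)))
    {Γ : Seq N} (h : M.EFAxiom n D Γ) : M.EFAxiom n D' (Seq.map ρ Γ) := by
  cases h with
  | identity k x h h' => exact .identity (ρ k) x ⟨k, rfl, h⟩ ⟨k, rfl, h'⟩
  | input k k' x hx h h' => exact .input (ρ k) (ρ k') x hx ⟨k, rfl, h⟩ ⟨k', rfl, h'⟩
  | andLeft k x y s hx hs hA hy h h' =>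
    exact .andLeft (ρ k) x y s hx (hs.trans ((hD k).isNeg x)) (((hD k).isAnd x).1 hA)
      (((hD k).edge y x).1 hy) ⟨k, rfl, h⟩ ⟨k, rfl, h'⟩
  | andRight k x s hx hs hA h h' =>
    exact .andRight (ρ k) x s hx (hs.trans ((hD k).isNeg x)) (((hD k).isAnd x).1 hA)
      (fun y hy => ⟨k, rfl, h y (((hD k).edge y x).2 hy)⟩) ⟨k, rfl, h'⟩
  | orLeft k x s hx hs hA h h' =>
    exact .orLeft (ρ k) x s hx (hs.trans ((hD k).isNeg x)) (fun h => hA (((hD k).isAnd x).2 h))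
      ⟨k, rfl, h⟩ (fun y hy => ⟨k, rfl, h' y (((hD k).edge y x).2 hy)⟩)
  | orRight k x y s hx hs hA hy h h' =>
    exact .orRight (ρ k) x y s hx (hs.trans ((hD k).isNeg x)) (fun h => hA (((hD k).isAnd x).2 h))
      (((hD k).edge y x).1 hy) ⟨k, rfl, h⟩ ⟨k, rfl, h'⟩

theorem EFAxiom.congr {n : N} {D D' : N → Set N} (hD : ∀ k, M.SameGates (D k) (D' k)) {Γ : Seq N}
    (h : M.EFAxiom n D Γ) : M.EFAxiom n D' Γ :=
  (h.map id hD).mono (by rintro b _ x ⟨k, rfl, h⟩; exact h)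

theorem IsCut.map (ρ : N → N) {Γ₁ Γ₂ Γ : Seq N} (h : IsCut Γ₁ Γ₂ Γ) :
    IsCut (Seq.map ρ Γ₁) (Seq.map ρ Γ₂) (Seq.map ρ Γ) := by
  obtain ⟨k, x, h1, h2⟩ := h
  refine ⟨ρ k, x, ?_, ?_⟩
  · rintro b _ x' ⟨k', rfl, h⟩
    rcases h1 b k' x' h with h | ⟨rfl, rfl, rfl⟩
    · exact Or.inl ⟨k', rfl, h⟩
    · exact Or.inr ⟨rfl, rfl, rfl⟩
  · rintro b _ x' ⟨k', rfl, h⟩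
    rcases h2 b k' x' h with h | ⟨rfl, rfl, rfl⟩
    · exact Or.inl ⟨k', rfl, h⟩
    · exact Or.inr ⟨rfl, rfl, rfl⟩

/-- The only literal of `Γ₁` that can be missing from `Γ` is the cut variable, and once its negation
is added, `Γ₂` fits. -/
theorem IsCut.der {𝒜 : Set (Seq N)} {Γ₁ Γ₂ Γ : Seq N} (h : IsCut Γ₁ Γ₂ Γ) (h₁ : Γ₁ ∈ 𝒜)
    (h₂ : Γ₂ ∈ 𝒜) : Der 1 𝒜 Γ := by
  obtain ⟨k, x, h1, h2⟩ := h
  refine ⟨Γ₁, h₁, fun b k' x' hb => ?_⟩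
  refine (h1 b k' x' hb).imp_right ?_
  rintro ⟨rfl, rfl, rfl⟩
  exact ⟨Γ₂, h₂, fun b k x hb => h2 b k x hb⟩

theorem EFCut.exists_map {n : N} {D D' : N → Set N} {Q : S} {m : N} (h : M.EFCut n D Q m)
    (ρ : N → N) (w : N) [hρ : Fm M true (fun e _ => e 0 = ρ (e 1))] (hw : ∀ k < M.len Q, ρ k < w)
    (hD : ∀ k, M.SameGates (D k) (D' (ρ k))) :
    ∃ V, M.EFDer 1 n D' V m ∧ ∀ l, M.line V l = Seq.map ρ (M.line Q l) := by
  have hρ := Fm.subst₂ (P := fun v k => v = ρ k) hρ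
  obtain ⟨V, hV⟩ := exists_lines M (M.len Q) (w + M.len Q) (fun l b κ x =>
    ∃ k, k < M.len Q ∧ κ = ρ k ∧ M.line Q l b k x) (by
      rintro l b _ x ⟨k, hk, rfl, h⟩
      exact ⟨left_lt_len (M := M) h, (hw k hk).trans_le le_self_add,
        (snd_lt_len h).trans_le le_add_self⟩)
  have hV' (l : N) : M.line V l = Seq.map ρ (M.line Q l) := by
    rw [hV]
    funext b κ x
    apply propext
    exact ⟨fun ⟨k, _, h⟩ => ⟨k, h⟩, fun ⟨k, h1, h2⟩ => ⟨k, fst_lt_len h2, h1, h2⟩⟩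
  refine ⟨V, fun l hl => ?_, hV'⟩
  rcases h l hl with h | ⟨l₁, l₂, h1, h2, h⟩
  · rw [hV']; exact Or.inl (h.map ρ hD)
  · right
    refine IsCut.der (Γ₁ := M.line V l₁) (Γ₂ := M.line V l₂) ?_ ⟨l₁, h1, rfl⟩ ⟨l₂, h2, rfl⟩
    rw [hV', hV', hV']
    exact h.map ρ

/-! ### Provable sets of sequents -/

variable (M) in
/-- The sequents in `ℱ` have derivations about the circuits coded by `P`, in the sense of extended
Frege. -/
def PrEF (n : N) (P : S) (ℱ : Set (Seq N)) : Prop :=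
  -- `0 < m` guarantees a first line, which is an axiom available as padding.
  ∃ (d : ℕ) (V : S) (m : N), 0 < m ∧ M.EFDer d n (M.row P) V m ∧ ∀ Γ ∈ ℱ, ∃ l < m, M.line V l ≤ Γ

theorem PrEF.mono {n : N} {P : S} {ℱ ℱ' : Set (Seq N)} (h : M.PrEF n P ℱ)
    (hℱ : ∀ Γ ∈ ℱ', ∃ Γ' ∈ ℱ, Γ' ≤ Γ) : M.PrEF n P ℱ' := by
  obtain ⟨d, V, m, hm, hV, h⟩ := h
  refine ⟨d, V, m, hm, hV, fun Γ hΓ => ?_⟩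
  obtain ⟨Γ', hΓ', hle⟩ := hℱ Γ hΓ
  obtain ⟨l, hl, hle'⟩ := h Γ' hΓ'
  exact ⟨l, hl, hle'.trans hle⟩

/-- Concatenation of derivations. -/
theorem exists_append (M : Model N S) [hM : M.Std] (V : S) (m a w : N) (Δ : N → Seq N)
    [h : ∀ b, Fm M true (fun e _ => Δ (e 0) b (e 1) (e 2))]
    (hw : ∀ i < a, ∀ b k x, Δ i b k x → k < w ∧ x < w) :
    ∃ V', (∀ l < m, M.line V' l = M.line V l) ∧ ∀ i < a, M.line V' (m + i) = Δ i := by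
  have h (b : Bool) := Fm.subst₃ (P := fun l k x => Δ l b k x) (h b)
  obtain ⟨V', hV'⟩ := exists_lines M (m + a) (M.len V + w) (fun l b k x =>
    (l < m ∧ M.line V l b k x) ∨ ∃ i, i < a ∧ l = m + i ∧ Δ i b k x) (by
      rintro l b k x (⟨h1, h⟩ | ⟨i, hi, rfl, h⟩)
      · exact ⟨h1.trans_le le_self_add, (fst_lt_len h).trans_le le_self_add,
          (snd_lt_len h).trans_le le_self_add⟩
      · exact ⟨by gcongr, (hw i hi b k x h).1.trans_le le_add_self,
          (hw i hi b k x h).2.trans_le le_add_self⟩)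
  refine ⟨V', fun l hl => ?_, fun i hi => ?_⟩
  · rw [hV']
    funext b k x
    apply propext
    constructor
    · rintro (h | ⟨i, -, rfl, -⟩)
      · exact h.2
      · exact absurd hl (not_lt.2 le_self_add)
    · exact fun h => Or.inl ⟨hl, h⟩
  · rw [hV']
    funext b k x
    apply propext
    constructor
    · rintro (h | ⟨i', -, h, h'⟩)
      · exact absurd h.1 (not_lt.2 le_self_add)
      · rwa [add_left_cancel h]
    · exact fun h => Or.inr ⟨i, hi, rfl, h⟩

theorem lt_or_exists_add (l m : N) : l < m ∨ ∃ i, l = m + i :=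
  (lt_or_ge l m).imp_right exists_add_of_le

theorem PrEF.union {n : N} {P : S} {ℱ ℱ' : Set (Seq N)} (h : M.PrEF n P ℱ) (h' : M.PrEF n P ℱ') :
    M.PrEF n P (ℱ ∪ ℱ') := by
  obtain ⟨d, V, m, hm, hV, h⟩ := h
  obtain ⟨d', V', m', hm', hV', h'⟩ := h'
  obtain ⟨U, hU, hU'⟩ := exists_append M V m m' (M.len V') (M.line V')
    (fun i _ b k x h => ⟨fst_lt_len h, snd_lt_len h⟩)
  refine ⟨max d d', U, m + m', hm.trans_le le_self_add, fun l hl => ?_, ?_⟩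
  · rcases lt_or_exists_add l m with h | ⟨i, rfl⟩
    · rw [hU l h]
      refine (hV l h).imp_right fun hd => (hd.mono ?_ le_rfl).of_le (le_max_left _ _)
      rintro _ ⟨l', hl', rfl⟩
      exact ⟨_, ⟨l', hl', rfl⟩, (hU l' (hl'.trans h)).le⟩
    · have hi : i < m' := lt_of_add_lt_add_left hl
      rw [hU' i hi]
      refine (hV' i hi).imp_right fun hd => (hd.mono ?_ le_rfl).of_le (le_max_right _ _)
      rintro _ ⟨l', hl', rfl⟩
      exact ⟨_, ⟨m + l', by gcongr, rfl⟩, (hU' l' (hl'.trans hi)).le⟩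
  · rintro Γ (hΓ | hΓ)
    · obtain ⟨l, hl, hle⟩ := h Γ hΓ
      exact ⟨l, hl.trans_le le_self_add, (hU l hl).le.trans hle⟩
    · obtain ⟨l, hl, hle⟩ := h' Γ hΓ
      exact ⟨m + l, by gcongr, (hU' l hl).le.trans hle⟩

/-- Induction in derivations. -/
theorem PrEF.ind {n : N} {P : S} {ℱ : Set (Seq N)} (h : M.PrEF n P ℱ) (a w : N) (d : ℕ)
    (Δ : N → Seq N) (J : N → Prop) [hΔ : ∀ b, Fm M true (fun e _ => Δ (e 0) b (e 1) (e 2))]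
    [hJ : Fm M true (fun e _ => J (e 0))]
    (hw : ∀ i < a, J i → ∀ b k x, Δ i b k x → k < w ∧ x < w)
    (hd : ∀ i < a, J i → Der d (ℱ ∪ {Γ | ∃ j < i, J j ∧ Γ = Δ j}) (Δ i)) :
    M.PrEF n P (ℱ ∪ {Γ | ∃ j < a, J j ∧ Γ = Δ j}) := by
  obtain ⟨d', V, m, hm, hV, h⟩ := h
  have hΔ (b : Bool) := Fm.subst₃ (P := fun l k x => Δ l b k x) (hΔ b)
  have hJ := hJ.subst₁
  -- Indices outside `J` are padded with the first line of `V`.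
  obtain ⟨U, hU, hU'⟩ := exists_append M V m a (w + M.len V) (fun i b k x =>
      (J i ∧ Δ i b k x) ∨ (¬ J i ∧ M.line V 0 b k x))
    (by
      rintro i hi b k x (⟨h1, h⟩ | ⟨-, h⟩)
      · exact ⟨(hw i hi h1 b k x h).1.trans_le le_self_add,
          (hw i hi h1 b k x h).2.trans_le le_self_add⟩
      · exact ⟨(fst_lt_len h).trans_le le_add_self, (snd_lt_len h).trans_le le_add_self⟩)
  have hJU {i : N} (hi : i < a) (hJi : J i) : M.line U (m + i) = Δ i := by
    rw [hU' i hi]; funext b k x; simp [hJi]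
  refine ⟨max d d', U, m + a, hm.trans_le le_self_add, fun l hl => ?_, ?_⟩
  · rcases lt_or_exists_add l m with h | ⟨i, rfl⟩
    · rw [hU l h]
      refine (hV l h).imp_right fun hd => (hd.mono ?_ le_rfl).of_le (le_max_right _ _)
      rintro _ ⟨l', hl', rfl⟩
      exact ⟨_, ⟨l', hl', rfl⟩, (hU l' (hl'.trans h)).le⟩
    · have hi : i < a := lt_of_add_lt_add_left hl
      by_cases hJi : J i
      · right
        rw [hJU hi hJi]
        refine ((hd i hi hJi).mono ?_ le_rfl).of_le (le_max_left _ _)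
        rintro Γ (hΓ | ⟨j, hj, hJj, rfl⟩)
        · obtain ⟨l, hl, hle⟩ := h Γ hΓ
          exact ⟨_, ⟨l, hl.trans_le le_self_add, rfl⟩, (hU l hl).le.trans hle⟩
        · exact ⟨_, ⟨m + j, by gcongr, rfl⟩, (hJU (hj.trans hi) hJj).le⟩
      · left
        have : M.line U (m + i) = M.line V 0 := by
          rw [hU' i hi]; funext b k x; simp [hJi]
        rw [this]
        exact (hV 0 hm).resolve_right Der.not_empty
  · rintro Γ (hΓ | ⟨j, hj, hJj, rfl⟩)
    · obtain ⟨l, hl, hle⟩ := h Γ hΓ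
      exact ⟨l, hl.trans_le le_self_add, (hU l hl).le.trans hle⟩
    · exact ⟨m + j, by gcongr, (hJU hj hJj).le⟩

theorem PrEF.of_axiom (M : Model N S) [hM : M.Std] (n : N) (P : S) (a w : N)
    (Δ : N → Seq N) (J : N → Prop) [hΔ : ∀ b, Fm M true (fun e _ => Δ (e 0) b (e 1) (e 2))]
    [hJ : Fm M true (fun e _ => J (e 0))]
    (hw : ∀ i < a, J i → ∀ b k x, Δ i b k x → k < w ∧ x < w)
    (hd : ∀ i < a, J i → M.EFAxiom n (M.row P) (Δ i)) :
    M.PrEF n P {Γ | ∃ j < a, J j ∧ Γ = Δ j} := by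
  have hΔ (b : Bool) := Fm.subst₃ (P := fun l k x => Δ l b k x) (hΔ b)
  have hJ := hJ.subst₁
  -- Padding lines are identity axioms for the variable (0, 0). The additional line of number a
  -- makes the derivation nonempty even if a = 0.
  obtain ⟨V, hV⟩ := exists_lines M (a + 1) (w + 1) (fun l b k x =>
      l < a + 1 ∧ ((l < a ∧ J l ∧ Δ l b k x) ∨ (¬ (l < a ∧ J l) ∧ k = 0 ∧ x = 0)))
    (by
      rintro l b k x ⟨hl, ⟨h1, h2, h⟩ | ⟨-, rfl, rfl⟩⟩
      · exact ⟨hl, (hw l h1 h2 b k x h).1.trans_le le_self_add,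
          (hw l h1 h2 b k x h).2.trans_le le_self_add⟩
      · have : (0 : N) < w + 1 := (lt_add_one M _ _).2 zero_le
        exact ⟨hl, this, this⟩)
  have h1 {l : N} (hl : l < a) (hJl : J l) : M.line V l = Δ l := by
    have : l < a + 1 := hl.trans_le le_self_add
    rw [hV]; funext b k x; simp [hl, hJl, this]
  refine ⟨0, V, a + 1, (lt_add_one M _ _).2 zero_le, fun l hl => Or.inl ?_, ?_⟩
  · by_cases h : l < a ∧ J l
    · rw [h1 h.1 h.2]; exact hd l h.1 h.2
    · rw [hV]
      exact .identity 0 0 ⟨hl, Or.inr ⟨h, rfl, rfl⟩⟩ ⟨hl, Or.inr ⟨h, rfl, rfl⟩⟩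
  · rintro _ ⟨j, hj, hJj, rfl⟩
    exact ⟨j, hj.trans_le le_self_add, (h1 hj hJj).le⟩

end Model

end TwoSorted

set_option linter.unusedSectionVars false
set_option synthInstance.maxSize 1000
set_option synthInstance.maxHeartbeats 200000

namespace TwoSorted

namespace Model

variable {N : Type u} {S : Type v} [CommSemiring N] [LinearOrder N] [IsStrictOrderedRing N]
  [CanonicallyOrderedAdd N] [Nonempty S] {M : Model N S} [hM : M.Std]

/-! ### Derivability of the gate axioms, and sequences of strings -/

section Instances

variable {b c c' c'' : Bool} {t t' t₁ t₁' t₂ t₂' : (ℕ → N) → (ℕ → S) → N}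
  {T : (ℕ → N) → (ℕ → S) → Set N}

instance Fm.cl2 [Tm M t] [Tm M t'] [Tm M t₁] [Tm M t₁'] [Tm M t₂] [Tm M t₂'] :
    Fm M b (fun e s => cl2 c (t e s) (t' e s) c' (t₁ e s) (t₁' e s) c'' (t₂ e s) (t₂' e s)) := by
  unfold Model.cl2; infer_instance

instance Fm.leftSeq [Fs M b T] [Tm M t] [Tm M t'] [Tm M t₁] [Tm M t₂] [Tm M t₂'] :
    Fm M b (fun e s => M.leftSeq (T e s) (t e s) (t' e s) (t₁ e s) c (t₂ e s) (t₂' e s)) := by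
  unfold Model.leftSeq; infer_instance

instance Fm.rightSeq [Fs M b T] [Tm M t] [Tm M t'] [Tm M t₂] [Tm M t₂'] :
    Fm M b (fun e s => M.rightSeq (T e s) (t e s) (t' e s) c (t₂ e s) (t₂' e s)) := by
  unfold Model.rightSeq; infer_instance

instance Fm.gateVal {T' : (ℕ → N) → (ℕ → S) → Set N} [Fs M false T] [Fs M false T']
    [Tm M t] [h : Fs M false (fun e s => T (fun i => e (i + 1)) s)]
    [h' : Fs M false (fun e s => T' (fun i => e (i + 1)) s)]
    [ht : Tm M (fun e s => t (fun i => e (i + 1)) s)] :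
    Fm M false (fun e s => M.GateVal (T e s) (T' e s) (t e s)) := by
  unfold GateVal; infer_instance

end Instances

/-- Each of the three families of axioms is listed along the codes of its index tuples. The sequent
at a code is described through decoding by bounded quantifiers, so it depends definably on the code.
-/
theorem PrEF.axSet (M : Model N S) [hM : M.Std] (n : N) (P : S) (c w : N) :
    M.PrEF n P (M.AxSet n (M.row P) c w) := by
  have h1 := PrEF.of_axiom M n P (M.pair c (M.pair c n)) (c + n)
    (fun l b κ ξ => ∃ k, k < c ∧ ∃ k', k' < c ∧ ∃ x, x < n ∧ l = M.pair k (M.pair k' x) ∧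
      cl2 false k x true k' x b κ ξ)
    (fun l => ∃ k, k < c ∧ ∃ k', k' < c ∧ ∃ x, x < n ∧ l = M.pair k (M.pair k' x))
    (by
      rintro _ - - b κ ξ ⟨k, hk, k', hk', x, hx, -, ⟨rfl, rfl, rfl⟩ | ⟨rfl, rfl, rfl⟩⟩
      · exact ⟨hk.trans_le le_self_add, hx.trans_le le_add_self⟩
      · exact ⟨hk'.trans_le le_self_add, hx.trans_le le_add_self⟩)
    (by
      rintro _ - ⟨k, hk, k', hk', x, hx, rfl⟩
      refine (efAxiom_cl2 (k := k) (k' := k') hx).mono fun b κ ξ h => ?_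
      exact ⟨k, hk, k', hk', x, hx, rfl, h⟩)
  have h2 := PrEF.of_axiom M n P (M.pair c (M.pair w w)) (c + w)
    (fun l b κ ξ => ∃ k, k < c ∧ ∃ x, x < w ∧ ∃ y, y < x ∧ l = M.pair k (M.pair x y) ∧
      M.leftSeq (M.row P k) k x y b κ ξ)
    (fun l => ∃ k, k < c ∧ ∃ x, x < w ∧ ∃ y, y < x ∧ l = M.pair k (M.pair x y) ∧ n ≤ x ∧
      M.Edge (M.row P k) y x)
    (by
      rintro _ - - b κ ξ ⟨k, hk, x, hx, y, hy, -, rfl, ⟨-, rfl⟩ | ⟨-, rfl⟩⟩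
      · exact ⟨hk.trans_le le_self_add, hx.trans_le le_add_self⟩
      · exact ⟨hk.trans_le le_self_add, (hy.trans hx).trans_le le_add_self⟩)
    (by
      rintro _ - ⟨k, hk, x, hx, y, hy, rfl, hn, he⟩
      refine (efAxiom_leftSeq hn he).mono fun b κ ξ h => ?_
      exact ⟨k, hk, x, hx, y, hy, rfl, h⟩)
  have h3 := PrEF.of_axiom M n P (M.pair c w) (c + w)
    (fun l b κ ξ => ∃ k, k < c ∧ ∃ x, x < w ∧ l = M.pair k x ∧ M.rightSeq (M.row P k) k x b κ ξ)
    (fun l => ∃ k, k < c ∧ ∃ x, x < w ∧ l = M.pair k x ∧ n ≤ x)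
    (by
      rintro _ - - b κ ξ ⟨k, hk, x, hx, -, rfl, ⟨-, h⟩ | ⟨-, rfl⟩⟩
      · exact ⟨hk.trans_le le_self_add, ((edge_lt h).trans hx).trans_le le_add_self⟩
      · exact ⟨hk.trans_le le_self_add, hx.trans_le le_add_self⟩)
    (by
      rintro _ - ⟨k, hk, x, hx, rfl, hn⟩
      exact (efAxiom_rightSeq (k := k) hn).mono fun b κ ξ h => ⟨k, hk, x, hx, rfl, h⟩)
  refine ((h1.union h2).union h3).mono ?_
  rintro Γ (⟨k, hk, k', hk', x, hx, rfl⟩ | ⟨k, hk, x, hx, y, hn, he, rfl⟩ | ⟨k, hk, x, hx, hn, rfl⟩)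
  · refine ⟨_, Or.inl (Or.inl ⟨M.pair k (M.pair k' x), pair_lt_pair hk (pair_lt_pair hk' hx),
      ⟨k, hk, k', hk', x, hx, rfl⟩, rfl⟩), ?_⟩
    rintro b κ ξ ⟨k₁, -, k₂, -, x', -, h, h'⟩
    obtain ⟨rfl, rfl, rfl⟩ : k = k₁ ∧ k' = k₂ ∧ x = x' := by simpa only [pair_inj] using h
    exact h'
  · have hy := edge_lt he
    refine ⟨_, Or.inl (Or.inr ⟨M.pair k (M.pair x y), pair_lt_pair hk
      (pair_lt_pair hx (hy.trans hx)), ⟨k, hk, x, hx, y, hy, rfl, hn, he⟩, rfl⟩), ?_⟩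
    rintro b κ ξ ⟨k₁, -, x', -, y', -, h, h'⟩
    obtain ⟨rfl, rfl, rfl⟩ : k = k₁ ∧ x = x' ∧ y = y' := by simpa only [pair_inj] using h
    exact h'
  · refine ⟨_, Or.inr ⟨M.pair k x, pair_lt_pair hk hx, ⟨k, hk, x, hx, rfl, hn⟩, rfl⟩, ?_⟩
    rintro b κ ξ ⟨k₁, -, x', -, h, h'⟩
    obtain ⟨rfl, rfl⟩ := pair_inj.1 h
    exact h'

/-! ### Sequences of sets -/

theorem exists_rows (M : Model N S) [hM : M.Std] (a w : N) (T : N → Set N)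
    [h : Fm M true (fun e _ => e 0 ∈ T (e 1))] (hw : ∀ i, ∀ j ∈ T i, i < a ∧ j < w) :
    ∃ X : S, ∀ i, M.row X i = T i := by
  have h := Fm.subst₂ (P := fun j i => j ∈ T i) h
  obtain ⟨X, -, hX⟩ := exists_set M (fun v => ∃ i, i < a ∧ ∃ j, j < w ∧ v = M.pair i j ∧ j ∈ T i)
    (M.pair a w)
  refine ⟨X, fun i => ?_⟩
  ext j
  refine (hX _).trans ⟨?_, fun h => ?_⟩
  · rintro ⟨-, i', -, j', -, h, h'⟩
    obtain ⟨rfl, rfl⟩ := pair_inj.1 h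
    exact h'
  · obtain ⟨hi, hj⟩ := hw i j h
    exact ⟨pair_lt_pair hi hj, i, hi, j, hj, rfl, h⟩

theorem exists_bits_eq_row (M : Model N S) [hM : M.Std] (X : S) (i : N) :
    ∃ Y : S, M.bits Y = M.row X i := by
  obtain ⟨Y, -, hY⟩ := exists_set M (fun v => v ∈ M.row X i) (M.len X)
  refine ⟨Y, ?_⟩
  ext v
  exact (hY v).trans ⟨fun h => h.2, fun h => ⟨right_lt_len h, h⟩⟩

/-- Six strings and the rows of two more strings form a sequence of strings. -/
theorem exists_six_rows (M : Model N S) [hM : M.Std] (Z₀ Z₁ Z₂ Z₃ Z₄ Z₅ U U' : S) :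
    ∃ P : S, M.row P 0 = M.bits Z₀ ∧ M.row P 1 = M.bits Z₁ ∧ M.row P 2 = M.bits Z₂ ∧
      M.row P 3 = M.bits Z₃ ∧ M.row P 4 = M.bits Z₄ ∧ M.row P 5 = M.bits Z₅ ∧
      (∀ κ, M.row P (κ * 8 + 6) = M.row U κ) ∧ ∀ κ, M.row P (κ * 8 + 7) = M.row U' κ := by
  obtain ⟨w, h0, h1, h2, h3, h4, h5, h6, h7⟩ : ∃ w, M.len Z₀ ≤ w ∧ M.len Z₁ ≤ w ∧ M.len Z₂ ≤ w ∧
      M.len Z₃ ≤ w ∧ M.len Z₄ ≤ w ∧ M.len Z₅ ≤ w ∧ M.len U ≤ w ∧ M.len U' ≤ w :=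
    ⟨max (max (max (M.len Z₀) (M.len Z₁)) (max (M.len Z₂) (M.len Z₃)))
      (max (max (M.len Z₄) (M.len Z₅)) (max (M.len U) (M.len U'))), by simp⟩
  have l0 : (0 : N) < 8 := by norm_num
  have l1 : (1 : N) < 8 := by norm_num
  have l2 : (2 : N) < 8 := by norm_num
  have l3 : (3 : N) < 8 := by norm_num
  have l4 : (4 : N) < 8 := by norm_num
  have l5 : (5 : N) < 8 := by norm_num
  have l6 : (6 : N) < 8 := by norm_num
  have l7 : (7 : N) < 8 := by norm_num
  -- Residues modulo 8 keep the rows apart: the single strings use the numbers 0 to 5, the two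
  -- sequences the residues 6 and 7.
  have key {j κ j' : N} (hj : j < 8) (hj' : j' < 8) (hne : j ≠ j') : j ≠ κ * 8 + j' := by
    intro h
    have := (mul_add_inj M (l := 0) (l' := κ) hj hj').1 (by rw [zero_mul, zero_add]; exact h)
    exact hne this.2
  have key' {κ κ' j j' : N} (hj : j < 8) (hj' : j' < 8) :
    κ * 8 + j = κ' * 8 + j' ↔ κ = κ' ∧ j = j' := mul_add_inj M hj hj'
  have hlt {κ j : N} (hκ : κ < w) (hj : j < 8) : κ * 8 + j < w * 8 + 8 :=
    (mul_add_lt M hκ hj).trans_le le_self_add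
  have hlt' {j : N} (hj : j < 8) : j < w * 8 + 8 := hj.trans_le le_add_self
  obtain ⟨P, hP⟩ := exists_rows M (w * 8 + 8) w (fun i => {x | (i = 0 ∧ x ∈ M.bits Z₀) ∨
    (i = 1 ∧ x ∈ M.bits Z₁) ∨ (i = 2 ∧ x ∈ M.bits Z₂) ∨ (i = 3 ∧ x ∈ M.bits Z₃) ∨
    (i = 4 ∧ x ∈ M.bits Z₄) ∨ (i = 5 ∧ x ∈ M.bits Z₅) ∨
    (∃ κ, κ < w ∧ i = κ * 8 + 6 ∧ x ∈ M.row U κ) ∨ ∃ κ, κ < w ∧ i = κ * 8 + 7 ∧ x ∈ M.row U' κ})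
    (h := by simp only [Set.mem_ofPred_eq]; infer_instance) (by
      rintro i j (⟨rfl, h⟩ | ⟨rfl, h⟩ | ⟨rfl, h⟩ | ⟨rfl, h⟩ | ⟨rfl, h⟩ | ⟨rfl, h⟩ |
        ⟨κ, hκ, rfl, h⟩ | ⟨κ, hκ, rfl, h⟩)
      · exact ⟨hlt' l0, (lt_len h).trans_le h0⟩
      · exact ⟨hlt' l1, (lt_len h).trans_le h1⟩
      · exact ⟨hlt' l2, (lt_len h).trans_le h2⟩
      · exact ⟨hlt' l3, (lt_len h).trans_le h3⟩
      · exact ⟨hlt' l4, (lt_len h).trans_le h4⟩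
      · exact ⟨hlt' l5, (lt_len h).trans_le h5⟩
      · exact ⟨hlt hκ l6, (right_lt_len h).trans_le h6⟩
      · exact ⟨hlt hκ l7, (right_lt_len h).trans_le h7⟩)
  refine ⟨P, ?_, ?_, ?_, ?_, ?_, ?_, fun κ => ?_, fun κ => ?_⟩ <;> rw [hP] <;> ext x <;>
    simp only [Set.mem_ofPred_eq]
  · simp [key l0 l6, key l0 l7]
  · simp [key l1 l6, key l1 l7]
  · simp [key l2 l6, key l2 l7]
  · simp [key l3 l6, key l3 l7]
  · simp [key l4 l6, key l4 l7]
  · simp [key l5 l6, key l5 l7]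
  · simp only [(key l0 l6 (by norm_num)).symm, (key l1 l6 (by norm_num)).symm,
      (key l2 l6 (by norm_num)).symm, (key l3 l6 (by norm_num)).symm,
      (key l4 l6 (by norm_num)).symm, (key l5 l6 (by norm_num)).symm, false_and, false_or,
      key' l6 l6, key' l6 l7]
    constructor
    · rintro (⟨_, -, ⟨rfl, -⟩, h⟩ | ⟨_, -, ⟨-, h⟩, -⟩)
      · exact h
      · norm_num at h
    · exact fun h => Or.inl ⟨κ, (left_lt_len h).trans_le h6, ⟨rfl, trivial⟩, h⟩
  · simp only [(key l0 l7 (by norm_num)).symm, (key l1 l7 (by norm_num)).symm,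
      (key l2 l7 (by norm_num)).symm, (key l3 l7 (by norm_num)).symm,
      (key l4 l7 (by norm_num)).symm, (key l5 l7 (by norm_num)).symm, false_and, false_or,
      key' l7 l6, key' l7 l7]
    constructor
    · rintro (⟨_, -, ⟨-, h⟩, -⟩ | ⟨_, -, ⟨rfl, -⟩, h⟩)
      · norm_num at h
      · exact h
    · exact fun h => Or.inr ⟨κ, (left_lt_len h).trans_le h7, ⟨rfl, trivial⟩, h⟩

end Model

end TwoSorted

set_option linter.unusedSectionVars false
set_option synthInstance.maxSize 1000
set_option synthInstance.maxHeartbeats 200000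

namespace TwoSorted

namespace Model

variable {N : Type u} {S : Type v} [CommSemiring N] [LinearOrder N] [IsStrictOrderedRing N]
  [CanonicallyOrderedAdd N] [Nonempty S] {M : Model N S} [hM : M.Std]

/-! ### Calculi -/

variable (M) in
/-- A calculus for an order `r` on circuits. `Pr c P ℱ` says that the sequents in `ℱ` are provable
facts about the values of the gates of the circuits `P(k)`, `k < c`. -/
structure Calc (n : N) (r : M.Circ → M.Circ → Prop) where
  Pr : N → S → Set (Seq N) → Prop
  mono : ∀ {c P ℱ ℱ'}, Pr c P ℱ → (∀ Γ ∈ ℱ', ∃ Γ' ∈ ℱ, Γ' ≤ Γ) → Pr c P ℱ'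
  union : ∀ {c P ℱ ℱ'}, Pr c P ℱ → Pr c P ℱ' → Pr c P (ℱ ∪ ℱ')
  axSet : ∀ c P w, Pr c P (M.AxSet n (M.row P) c w)
  -- Here a may be nonstandard: this is induction inside M, with steps of a fixed standard depth.
  ind : ∀ {c P ℱ}, Pr c P ℱ → ∀ (a w : N) (d : ℕ) (Δ : N → Seq N) (J : N → Prop)
    [∀ b, Fm M true (fun e _ => Δ (e 0) b (e 1) (e 2))] [Fm M true (fun e _ => J (e 0))],
    (∀ i < a, J i → ∀ b k x, Δ i b k x → k < c ∧ x < w) →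
    (∀ i < a, J i → Der d (ℱ ∪ {Γ | ∃ j < i, J j ∧ Γ = Δ j}) (Δ i)) →
    Pr c P (ℱ ∪ {Γ | ∃ j < a, J j ∧ Γ = Δ j})
  concl : ∀ {c P} {C C' : M.Circ} {o o' : N}, 1 < c → M.SameGates (M.row P 0) C.code →
    M.SameGates (M.row P 1) C'.code → M.IsOut C.code o → M.IsOut C'.code o' →
    Pr c P {cl2 false 0 o true 1 o'} → r C C'
  -- Transitivity and meets need two inequalities over the same sequence of circuits. Rows 0 and 1
  -- are kept free for the circuits of the conclusion.
  hyps2 : ∀ {C₁ C₂ C₃ C₄ : M.Circ} {o₁ o₂ o₃ o₄ : N}, r C₁ C₂ → r C₃ C₄ → M.IsOut C₁.code o₁ →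
    M.IsOut C₂.code o₂ → M.IsOut C₃.code o₃ → M.IsOut C₄.code o₄ → ∀ Z Z' : S,
    ∃ P, M.row P 0 = M.bits Z ∧ M.row P 1 = M.bits Z' ∧ M.row P 2 = C₁.code ∧
      M.row P 3 = C₂.code ∧ M.row P 4 = C₃.code ∧ M.row P 5 = C₄.code ∧
      Pr 6 P {cl2 false 2 o₁ true 3 o₂, cl2 false 4 o₃ true 5 o₄}
  -- This makes the dense set in `Forcing.exists_val` definable.
  def_ : Fm M false (fun _ s => ∃ C C' : M.Circ, C.1 = s 0 ∧ C'.1 = s 1 ∧ r C C')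

/-! ### The calculus for extended Frege -/

variable (M) in
/-- The circuits in a proof, for arbitrary strings in place of circuits. -/
def proofRows (Z Z' P : S) (k : N) : Set N :=
  {j | (k = M.zero ∧ j ∈ M.bits Z) ∨ (k = M.one ∧ j ∈ M.bits Z') ∨
    (k ≠ M.zero ∧ k ≠ M.one ∧ j ∈ M.row P k)}

theorem proofCircuits_eq (C C' : M.Circ) (P : S) (k : N) :
    M.proofCircuits C C' P k = M.proofRows C.1 C'.1 P k := rfl

instance Fs.proofRows {b : Bool} {X X' Y : (ℕ → S) → S} {t : (ℕ → N) → (ℕ → S) → N} [Ss X] [Ss X']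
    [Ss Y] [ht : Tm M t] : Fs M b (fun e s => M.proofRows (X s) (X' s) (Y s) (t e s)) := by
  have := ht.lift
  refine ⟨?_⟩
  simp only [Model.proofRows, Set.mem_ofPred_eq]
  infer_instance

/-- Written as an explicit disjunction so that instance search can recognise a formula. -/
theorem efAxiom_iff {n : N} {D : N → Set N} {Γ : Seq N} : M.EFAxiom n D Γ ↔
    (∃ k x, Γ false k x ∧ Γ true k x) ∨
    (∃ k k' x, M.lt x n ∧ Γ false k x ∧ Γ true k' x) ∨
    (∃ k x y, ∃ s : Bool, M.le n x ∧ (s = false ↔ M.IsNeg (D k) x) ∧ M.IsAnd (D k) x ∧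
      M.Edge (D k) y x ∧ Γ (!s) k x ∧ Γ true k y) ∨
    (∃ k x, ∃ s : Bool, M.le n x ∧ (s = false ↔ M.IsNeg (D k) x) ∧ M.IsAnd (D k) x ∧
      (∀ y, M.Edge (D k) y x → Γ false k y) ∧ Γ s k x) ∨
    (∃ k x, ∃ s : Bool, M.le n x ∧ (s = false ↔ M.IsNeg (D k) x) ∧ ¬ M.IsAnd (D k) x ∧
      Γ (!s) k x ∧ ∀ y, M.Edge (D k) y x → Γ true k y) ∨
    (∃ k x y, ∃ s : Bool, M.le n x ∧ (s = false ↔ M.IsNeg (D k) x) ∧ ¬ M.IsAnd (D k) x ∧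
      M.Edge (D k) y x ∧ Γ false k y ∧ Γ s k x) := by
  constructor
  · rintro (⟨k, x, h, h'⟩ | ⟨k, k', x, hx, h, h'⟩ | ⟨k, x, y, s, h⟩ | ⟨k, x, s, h⟩ | ⟨k, x, s, h⟩ |
      ⟨k, x, y, s, h⟩)
    · exact Or.inl ⟨k, x, h, h'⟩
    · exact Or.inr (Or.inl ⟨k, k', x, hx, h, h'⟩)
    · exact Or.inr (Or.inr (Or.inl ⟨k, x, y, s, by tauto⟩))
    · exact Or.inr (Or.inr (Or.inr (Or.inl ⟨k, x, s, by tauto⟩)))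
    · exact Or.inr (Or.inr (Or.inr (Or.inr (Or.inl ⟨k, x, s, by tauto⟩))))
    · exact Or.inr (Or.inr (Or.inr (Or.inr (Or.inr ⟨k, x, y, s, by tauto⟩))))
  · rintro (⟨k, x, h, h'⟩ | ⟨k, k', x, hx, h, h'⟩ | ⟨k, x, y, s, h1, h2, h3, h4, h5, h6⟩ |
      ⟨k, x, s, h1, h2, h3, h4, h5⟩ | ⟨k, x, s, h1, h2, h3, h4, h5⟩ |
      ⟨k, x, y, s, h1, h2, h3, h4, h5, h6⟩)
    · exact .identity k x h h'
    · exact .input k k' x hx h h'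
    · exact .andLeft k x y s h1 h2 h3 h4 h5 h6
    · exact .andRight k x s h1 h2 h3 h4 h5
    · exact .orLeft k x s h1 h2 h3 h4 h5
    · exact .orRight k x y s h1 h2 h3 h4 h5 h6

instance Fm.efAxiom {X X' Y Q : (ℕ → S) → S} {t : (ℕ → N) → (ℕ → S) → N} {n : N} [Ss X] [Ss X']
    [Ss Y] [Ss Q] [ht : Tm M t] : Fm M false (fun e s =>
      M.EFAxiom n (M.proofRows (X s) (X' s) (Y s)) (M.line (Q s) (t e s))) := by
  have h1 := ht.lift
  have h2 := h1.lift
  have h3 := h2.lift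
  simp only [efAxiom_iff]
  infer_instance

instance Fm.isCircuit {X : (ℕ → S) → S} [Ss X] :
    Fm M false (fun _ s => M.IsCircuit (M.bits (X s))) := by
  unfold IsCircuit ExistsUnique
  infer_instance

instance Fm.isCut {Q : (ℕ → S) → S} {t t' t'' : (ℕ → N) → (ℕ → S) → N} [Ss Q]
    [ht : Tm M t] [ht' : Tm M t'] [ht'' : Tm M t''] :
    Fm M false (fun e s => IsCut (M.line (Q s) (t e s)) (M.line (Q s) (t' e s))
      (M.line (Q s) (t'' e s))) := by
  have h1 := ht.lift.lift
  have h2 := h1.lift.lift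
  have h1' := ht'.lift.lift
  have h2' := h1'.lift.lift
  have h1'' := ht''.lift.lift
  have h2'' := h1''.lift.lift
  unfold IsCut
  infer_instance

theorem fm_leEF (M : Model N S) [hM : M.Std] (n : N) :
    Fm M false (fun _ s => ∃ C C' : M.Circ, C.1 = s 0 ∧ C'.1 = s 1 ∧ M.leEF n C C') := by
  refine Fm.congr (P := fun _ s => M.IsCircuit (M.bits (s 0)) ∧ M.IsCircuit (M.bits (s 1)) ∧
    ∃ (P Q : S) (m : N), (∀ l, M.le l m →
      M.EFAxiom n (M.proofRows (s 0) (s 1) P) (M.line Q l) ∨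
      ∃ l₁ l₂, M.lt l₁ l ∧ M.lt l₂ l ∧ IsCut (M.line Q l₁) (M.line Q l₂) (M.line Q l)) ∧
    ∃ o o', M.IsOut (M.bits (s 0)) o ∧ M.IsOut (M.bits (s 1)) o' ∧
      ∀ b k x, M.line Q m b k x →
        (b = false ∧ k = M.zero ∧ x = o) ∨ (b = true ∧ k = M.one ∧ x = o')) ?_ fun _ s => ?_
  · infer_instance
  · constructor
    · rintro ⟨h, h', h''⟩
      exact ⟨⟨s 0, h⟩, ⟨s 1, h'⟩, rfl, rfl, h''⟩
    · rintro ⟨⟨_, h⟩, ⟨_, h'⟩, rfl, rfl, h''⟩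
      exact ⟨h, h', h''⟩

end Model

end TwoSorted

set_option linter.unusedSectionVars false
set_option synthInstance.maxSize 1000
set_option synthInstance.maxHeartbeats 200000

namespace TwoSorted

namespace Model

variable {N : Type u} {S : Type v} [CommSemiring N] [LinearOrder N] [IsStrictOrderedRing N]
  [CanonicallyOrderedAdd N] [Nonempty S] {M : Model N S} [hM : M.Std]

theorem IsCircuit.out_unique {T : Set N} (h : M.IsCircuit T) {o o' : N} (ho : M.IsOut T o)
    (ho' : M.IsOut T o') : o = o' := h.unique ho ho'

theorem proofRows_zero (Z Z' P : S) : M.proofRows Z Z' P 0 = M.bits Z := by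
  have h0 : M.zero = 0 := hM.zero_eq
  have h1 : M.one = 1 := one_eq
  ext j; simp [Model.proofRows, h0, h1]

theorem proofRows_one (Z Z' P : S) : M.proofRows Z Z' P 1 = M.bits Z' := by
  have h0 : M.zero = 0 := hM.zero_eq
  have h1 : M.one = 1 := one_eq
  ext j; simp [Model.proofRows, h0, h1]

theorem proofRows_of_ne (Z Z' P : S) {k : N} (hk : k ≠ 0) (hk' : k ≠ 1) :
    M.proofRows Z Z' P k = M.row P k := by
  have h0 : M.zero = 0 := hM.zero_eq
  have h1 : M.one = 1 := one_eq
  ext j; simp [Model.proofRows, h0, h1, hk, hk']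

/-- After case distinctions are replaced by cuts, the line of the conclusion is the last line of a
proof. Rows 0 and 1 of `P` need to agree with the two circuits only in their gates, since axioms
ignore outputs. -/
theorem PrEF.leEF {n : N} {P : S} {C C' : M.Circ} {o o' : N} (h0 : M.SameGates (M.row P 0) C.code)
    (h1 : M.SameGates (M.row P 1) C'.code) (ho : M.IsOut C.code o) (ho' : M.IsOut C'.code o')
    (h : M.PrEF n P {cl2 false 0 o true 1 o'}) : M.leEF n C C' := by
  obtain ⟨d, V, m, hm, hV, h⟩ := h
  obtain ⟨l, hl, hle⟩ := h _ rfl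
  obtain ⟨Q, m', hQ, hQ'⟩ := hV.exists_cut hm
  obtain ⟨l', hl', hle'⟩ := hQ' l hl
  have hD (k : N) : M.SameGates (M.row P k) (M.proofCircuits C C' P k) := by
    rw [proofCircuits_eq]
    by_cases hk : k = 0
    · rw [hk, proofRows_zero]; exact h0
    by_cases hk' : k = 1
    · rw [hk', proofRows_one]; exact h1
    rw [proofRows_of_ne _ _ _ hk hk']; exact .refl _
  refine ⟨P, Q, l', fun i hi => ?_, o, o', ho, ho', fun b k x hb => ?_⟩
  · rw [hM.le_iff] at hi
    simp only [lt_iff]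
    exact (hQ i (hi.trans_lt hl')).imp_left (EFAxiom.congr hD)
  · rw [show M.zero = 0 from hM.zero_eq, one_eq]
    exact hle b k x (hle' b k x hb)

/-- The proof is transported along 0 ↦ i, 1 ↦ i', κ ↦ 8κ + j. With the rows supplied by
`exists_six_rows`, two proofs fit side by side. -/
theorem IsEFProof.prEF {n : N} {C C' : M.Circ} {P Q : S} {m : N} (h : M.IsEFProof n C C' P Q m)
    {o o' : N} (ho : M.IsOut C.code o) (ho' : M.IsOut C'.code o') {P' : S} {i i' j : N}
    (hi : M.row P' i = C.code) (hi' : M.row P' i' = C'.code)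
    (hP : ∀ κ, M.row P' (κ * 8 + j) = M.row P κ) :
    M.PrEF n P' {cl2 false i o true i' o'} := by
  obtain ⟨h, o₁, o₁', ho₁, ho₁', hlast⟩ := h
  obtain rfl := C.2.out_unique ho ho₁
  obtain rfl := C'.2.out_unique ho' ho₁'
  obtain ⟨ρ, hρ⟩ : ∃ ρ : N → N, ρ = fun κ => if κ = 0 then i else if κ = 1 then i' else κ * 8 + j :=
    ⟨_, rfl⟩
  have hm : m < m + 1 := (lt_add_one M _ _).2 le_rfl
  obtain ⟨V, hV, hV'⟩ := EFCut.exists_map (M := M) (n := n) (D := M.proofCircuits C C' P)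
    (D' := M.row P') (Q := Q) (m := m + 1) (fun l hl => by
      rw [lt_add_one M] at hl
      simpa only [lt_iff] using h l ((hM.le_iff _ _).2 hl)) ρ (M.len Q * 8 + j + i + i' + 1)
    (hρ := by
      refine Fm.congr (P := fun e _ => (e 1 = 0 ∧ e 0 = i) ∨ (e 1 ≠ 0 ∧ e 1 = 1 ∧ e 0 = i') ∨
        (e 1 ≠ 0 ∧ e 1 ≠ 1 ∧ e 0 = e 1 * 8 + j)) ?_ fun e _ => ?_
      · infer_instance
      rw [hρ]
      by_cases h0 : e 1 = 0
      · simp [h0]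
      · by_cases h1 : e 1 = 1 <;> simp [h0, h1])
    (by
      intro k hk
      rw [lt_add_one M, hρ]
      have : k * 8 ≤ M.len Q * 8 := by gcongr
      simp only
      split_ifs
      · exact le_add_right le_add_self
      · exact le_add_self
      · exact le_add_right (le_add_right (by gcongr)))
    (by
      intro k
      rw [hρ, proofCircuits_eq]
      simp only
      split_ifs with h0 h1
      · rw [h0, proofRows_zero, hi]; exact .refl _
      · rw [h1, proofRows_one, hi']; exact .refl _
      · rw [proofRows_of_ne _ _ _ h0 h1, hP]; exact .refl _)
  refine ⟨1, V, m + 1, lt_of_le_of_lt zero_le hm, hV, ?_⟩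
  rintro _ rfl
  refine ⟨m, hm, ?_⟩
  rw [hV']
  rintro b _ x ⟨k, rfl, hb⟩
  rcases hlast b k x hb with ⟨rfl, rfl, rfl⟩ | ⟨rfl, rfl, rfl⟩
  · exact Or.inl ⟨rfl, by simp [hρ, show M.zero = 0 from hM.zero_eq], rfl⟩
  · exact Or.inr ⟨rfl, by simp [hρ, one_eq], rfl⟩

theorem nonempty_calc_leEF (M : Model N S) [hM : M.Std] (n : N) : Nonempty (M.Calc n (M.leEF n)) :=
  ⟨{  Pr := fun _ P ℱ => M.PrEF n P ℱ
      mono := PrEF.mono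
      union := PrEF.union
      axSet := fun c P w => PrEF.axSet M n P c w
      ind := fun {c _ _} h a w d Δ J _ _ hw hd => h.ind a (max c w) d Δ J
        (fun i hi hJ b k x hb => ⟨lt_max_of_lt_left (hw i hi hJ b k x hb).1,
          lt_max_of_lt_right (hw i hi hJ b k x hb).2⟩) hd
      concl := fun _ h0 h1 ho ho' h => h.leEF h0 h1 ho ho'
      hyps2 := by
        rintro C₁ C₂ C₃ C₄ o₁ o₂ o₃ o₄ ⟨P, Q, m, h⟩ ⟨P', Q', m', h'⟩ h₁ h₂ h₃ h₄ Z Z'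
        obtain ⟨U, hU0, hU1, hU2, hU3, hU4, hU5, hU6, hU7⟩ :=
          exists_six_rows M Z Z' C₁.1 C₂.1 C₃.1 C₄.1 P P'
        exact ⟨U, hU0, hU1, hU2, hU3, hU4, hU5,
          (h.prEF h₁ h₂ hU2 hU3 hU6).union (h'.prEF h₃ h₄ hU4 hU5 hU7)⟩
      def_ := fm_leEF M n }⟩

end Model

end TwoSorted

set_option linter.unusedSectionVars false
set_option synthInstance.maxSize 1000
set_option synthInstance.maxHeartbeats 200000

namespace TwoSorted

namespace Model

variable {N : Type u} {S : Type v} [CommSemiring N] [LinearOrder N] [IsStrictOrderedRing N]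
  [CanonicallyOrderedAdd N] [Nonempty S] {M : Model N S} [hM : M.Std]

/-! ### Evaluation of circuits -/

variable (M) in
/-- `Y` is the computation of all gates of `T` on the input `A`. -/
def FullComp (n : N) (T A Y : Set N) : Prop :=
  ∀ x, (x < n → (x ∈ Y ↔ x ∈ A)) ∧ (n ≤ x → (x ∈ Y ↔ M.GateVal T Y x))

theorem GateVal.congr {T T' Y Y' : Set N} (hT : M.SameGates T T') {x : N}
    (hY : ∀ y < x, y ∈ Y ↔ y ∈ Y') : M.GateVal T Y x ↔ M.GateVal T' Y' x := by
  have h1 : (∀ y, M.Edge T y x → y ∈ Y) ↔ ∀ y, M.Edge T' y x → y ∈ Y' := by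
    refine forall_congr' fun y => ?_
    rw [← hT.edge]
    exact imp_congr_right fun h => hY y (edge_lt h)
  have h2 : (∃ y, M.Edge T y x ∧ y ∈ Y) ↔ ∃ y, M.Edge T' y x ∧ y ∈ Y' := by
    refine exists_congr fun y => ?_
    rw [← hT.edge]
    exact and_congr_right fun h => hY y (edge_lt h)
  rw [GateVal, GateVal, h1, h2, hT.isAnd, hT.isNeg]

/-- Two computations on the same input agree up to the output, by strong induction on gates; and a
full computation is itself a witness for `Eval`. -/
theorem FullComp.eval {n : N} {T : Set N} {A X : S} {i : N}
    (h : M.FullComp n T (M.bits A) (M.row X i)) {C : M.Circ} (hT : M.SameGates T C.code) {o : N}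
    (ho : M.IsOut C.code o) : M.Eval n C.code A ↔ o ∈ M.row X i := by
  constructor
  · rintro ⟨o', Y, ho', hY, hoY⟩
    obtain rfl := C.2.out_unique ho ho'
    have key := strong_induction M (fun x => x ≤ o → (x ∈ M.bits Y ↔ x ∈ M.row X i)) (by
      intro x ih hx
      obtain ⟨h1, h2⟩ := hY x ((hM.le_iff _ _).2 hx)
      rcases lt_or_ge x n with hn | hn
      · rw [h1 ((lt_iff _ _).2 hn), (h x).1 hn]
      · rw [h2 ((hM.le_iff _ _).2 hn), (h x).2 hn]
        exact GateVal.congr hT.symm fun y hy => ih y hy (hy.le.trans hx))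
    exact (key o le_rfl).1 hoY
  · intro hoX
    obtain ⟨Y, hY⟩ := exists_bits_eq_row M X i
    refine ⟨o, Y, ho, fun x _ => ?_, by change o ∈ M.bits Y; rwa [hY]⟩
    rw [hY, lt_iff, hM.le_iff]
    exact ⟨(h x).1, fun hx => ((h x).2 hx).trans (GateVal.congr hT fun _ _ => Iff.rfl)⟩

/-- All gates of a sequence of circuits can be evaluated. -/
theorem exists_fullComp (hMCV : M.MCV) (n : N) (P A : S) (c : N) :
    ∃ Y : S, ∀ k < c, M.FullComp n (M.row P k) (M.bits A) (M.row Y k) := by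
  -- Every gate with a sign, a type or an incoming edge is below |P|; adding n covers the inputs.
  obtain ⟨w, hw⟩ : ∃ w, w = M.len P + n := ⟨_, rfl⟩
  have hwP : M.len P ≤ w := hw ▸ le_self_add
  have hwn : n ≤ w := hw ▸ le_add_self
  -- the sign of the literals of the predecessors
  obtain ⟨idx, hidx⟩ : ∃ idx : N → N → Bool → N,
      idx = fun k x σ => 2 * M.pair k x + (if σ then 3 else 2) := ⟨_, rfl⟩
  have hidxt (k x : N) : idx k x true = 2 * M.pair k x + 3 := by simp [hidx]
  have hidxf (k x : N) : idx k x false = 2 * M.pair k x + 2 := by simp [hidx]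
  have hle {k x : N} {σ : Bool} : 2 * M.pair k x + 2 ≤ idx k x σ := by
    cases σ <;> simp only [hidxt, hidxf, le_refl]
    gcongr; norm_num
  have hle' {k x : N} {σ : Bool} : idx k x σ < 2 * (M.pair k x + 1) + 2 := by
    have e : 2 * (M.pair k x + 1) + 2 = 2 * M.pair k x + 4 := by ring
    rw [e]
    cases σ <;> simp only [hidxt, hidxf] <;> gcongr <;> norm_num
  have hlt {k x k' x' : N} {σ σ' : Bool} (h : M.pair k x < M.pair k' x') :
      idx k x σ < idx k' x' σ' := by
    refine hle'.trans_le (le_trans ?_ hle)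
    gcongr
    exact (add_one_le M _ _).2 h
  have hinj {k x k' x' : N} {σ σ' : Bool} :
      idx k x σ = idx k' x' σ' ↔ k = k' ∧ x = x' ∧ σ = σ' := by
    refine ⟨fun h => ?_, by rintro ⟨rfl, rfl, rfl⟩; rfl⟩
    have h1 : M.pair k x = M.pair k' x' := by
      rcases lt_trichotomy (M.pair k x) (M.pair k' x') with h1 | h1 | h1
      · exact absurd h (hlt h1).ne
      · exact h1
      · exact absurd h (hlt h1).ne'
    obtain ⟨rfl, rfl⟩ := pair_inj.1 h1
    refine ⟨rfl, rfl, ?_⟩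
    have h23 : (2 : N) ≠ 3 := by norm_num
    cases σ <;> cases σ' <;> simp only [hidxt, hidxf, add_right_inj] at h
    · rfl
    · exact absurd h h23
    · exact absurd h.symm h23
    · rfl
  -- The numbers 0 and 1 are reserved for the constants in MCV.
  have h2 {k x : N} {σ : Bool} : 2 ≤ idx k x σ := le_trans le_add_self hle
  have hTm (σ : Bool) {t t' : (ℕ → N) → (ℕ → S) → N} [Tm M t] [Tm M t'] :
      Tm M (fun e s => idx (t e s) (t' e s) σ) := by
    cases σ <;> simp only [hidxt, hidxf] <;> infer_instance
  obtain ⟨B, hB⟩ : ∃ B, B = idx c w true := ⟨_, rfl⟩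
  have hBlt {k x : N} {σ : Bool} (hk : k < c) (hx : x < w) : idx k x σ < B := by
    rw [hB]; exact hlt (pair_lt_pair hk hx)
  -- MCV evaluates monotone circuits only, so each gate x is represented by two monotone gates, one
  -- for the literal x and one for ¬x. By De Morgan's laws the σ-literal of x is a conjunction or a
  -- disjunction of literals of the predecessors of x, all of the same sign.
  obtain ⟨C, -, hC⟩ := exists_set M (fun v => ∃ k, k < c ∧ ∃ x, x < w ∧ ∃ σ : Bool,
    v = idx k x σ ∧ n ≤ x ∧ (σ = true ↔ (M.IsAnd (M.row P k) x ↔ ¬ M.IsNeg (M.row P k) x))) B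
  -- An input literal is a disjunction whose only possible predecessor is the constant 1, joined to
  -- it exactly if the literal is true under `A`.
  obtain ⟨E, -, hE⟩ := exists_set M (fun v => ∃ k, k < c ∧ ∃ x, x < w ∧ ∃ σ : Bool,
    (x < n ∧ (σ = true ↔ M.mem x A) ∧ v = M.pair 1 (idx k x σ)) ∨
    (n ≤ x ∧ ∃ y, y < x ∧ ∃ τ : Bool, M.Edge (M.row P k) y x ∧
      (τ = true ↔ (σ = true ↔ ¬ M.IsNeg (M.row P k) x)) ∧ v = M.pair (idx k y τ) (idx k x σ)))
    (M.pair B B)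
  obtain ⟨Z, -, hZ1, hZ⟩ := hMCV B C E
  have hC' {k x : N} {σ : Bool} (hk : k < c) (hx : x < w) : M.mem (idx k x σ) C ↔
      n ≤ x ∧ (σ = true ↔ (M.IsAnd (M.row P k) x ↔ ¬ M.IsNeg (M.row P k) x)) := by
    rw [hC]
    constructor
    · rintro ⟨-, k', -, x', -, σ', h, h'⟩
      obtain ⟨rfl, rfl, rfl⟩ := hinj.1 h
      exact h'
    · exact fun h => ⟨hBlt hk hx, k, hk, x, hx, σ, rfl, h⟩
  have hEi {k x v : N} {σ : Bool} (hk : k < c) (hx : x < w) (hn : x < n) :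
      M.mem (M.pair v (idx k x σ)) E ↔ (σ = true ↔ M.mem x A) ∧ v = 1 := by
    rw [hE]
    simp only [pair_inj, hinj]
    constructor
    · rintro ⟨-, k', -, x', -, σ', ⟨-, h, rfl, rfl, rfl, rfl⟩ |
        ⟨h, y, -, τ, -, -, -, -, rfl, -⟩⟩
      · exact ⟨h, rfl⟩
      · exact absurd h (not_le.2 hn)
    · rintro ⟨h, rfl⟩
      refine ⟨pair_lt_pair ?_ (hBlt hk hx), k, hk, x, hx, σ, Or.inl ⟨hn, h, rfl, rfl, rfl, rfl⟩⟩
      exact lt_of_lt_of_le one_lt_two (h2.trans (hBlt (σ := true) hk hx).le)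
  have hEg {k x v : N} {σ : Bool} (hk : k < c) (hx : x < w) (hn : n ≤ x) :
      M.mem (M.pair v (idx k x σ)) E ↔ ∃ y, ∃ τ : Bool, M.Edge (M.row P k) y x ∧
        (τ = true ↔ (σ = true ↔ ¬ M.IsNeg (M.row P k) x)) ∧ v = idx k y τ := by
    rw [hE]
    simp only [pair_inj, hinj]
    constructor
    · rintro ⟨-, k', -, x', -, σ', ⟨h, -, -, -, rfl, -⟩ | ⟨h, y, -, τ, h1, h2, h3, rfl, rfl, rfl⟩⟩
      · exact absurd h (not_lt.2 hn)
      · exact ⟨y, τ, h1, h2, h3⟩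
    · rintro ⟨y, τ, h1, h2, rfl⟩
      have hy := edge_lt h1
      exact ⟨pair_lt_pair (hBlt hk (hy.trans hx)) (hBlt hk hx), k, hk, x, hx, σ,
        Or.inr ⟨hn, y, hy, τ, h1, h2, rfl, rfl, rfl, rfl⟩⟩
  rw [one_eq] at hZ1
  have hZ' {k x : N} {σ : Bool} (hk : k < c) (hx : x < w) := hZ (idx k x σ)
    ((lt_iff _ _).2 (hBlt hk hx)) (by rw [hM.le_iff, two_eq]; exact h2)
  simp only [lt_iff] at hZ'
  have hin {k x : N} {σ : Bool} (hk : k < c) (hx : x < w) (hn : x < n) :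
      M.mem (idx k x σ) Z ↔ (σ = true ↔ M.mem x A) := by
    rw [hZ' hk hx, hC' hk hx]
    simp only [hEi hk hx hn, not_le.2 hn, false_and, false_or, not_false_eq_true, true_and]
    constructor
    · rintro ⟨v, -, h, -⟩; exact h.1
    · exact fun h => ⟨1, one_lt_two.trans_le h2, ⟨h, rfl⟩, hZ1⟩
  have hg {k x : N} {σ : Bool} (hk : k < c) (hx : x < w) (hn : n ≤ x) :
      M.mem (idx k x σ) Z ↔
        ((σ = true ↔ (M.IsAnd (M.row P k) x ↔ ¬ M.IsNeg (M.row P k) x)) ∧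
          ∀ y, ∀ τ : Bool, M.Edge (M.row P k) y x →
            (τ = true ↔ (σ = true ↔ ¬ M.IsNeg (M.row P k) x)) → M.mem (idx k y τ) Z) ∨
        (¬ (σ = true ↔ (M.IsAnd (M.row P k) x ↔ ¬ M.IsNeg (M.row P k) x)) ∧
          ∃ y, ∃ τ : Bool, M.Edge (M.row P k) y x ∧
            (τ = true ↔ (σ = true ↔ ¬ M.IsNeg (M.row P k) x)) ∧ M.mem (idx k y τ) Z) := by
    rw [hZ' hk hx, hC' hk hx]
    simp only [hEg hk hx hn, hn, true_and]
    refine or_congr (and_congr_right fun _ => ?_) (and_congr_right fun _ => ?_)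
    · constructor
      · intro h y τ h1 h2
        exact h _ (hlt (pair_lt_pair_right _ (edge_lt h1))) ⟨y, τ, h1, h2, rfl⟩
      · rintro h _ - ⟨y, τ, h1, h2, rfl⟩
        exact h y τ h1 h2
    · constructor
      · rintro ⟨_, -, ⟨y, τ, h1, h2, rfl⟩, h⟩
        exact ⟨y, τ, h1, h2, h⟩
      · rintro ⟨y, τ, h1, h2, h⟩
        exact ⟨_, hlt (pair_lt_pair_right _ (edge_lt h1)), ⟨y, τ, h1, h2, rfl⟩, h⟩
  -- The two gates representing x have complementary values.
  have hdual {k : N} (hk : k < c) (x : N) :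
      x < w → (M.mem (idx k x true) Z ↔ ¬ M.mem (idx k x false) Z) := by
    refine strong_induction M (fun x => x < w →
      (M.mem (idx k x true) Z ↔ ¬ M.mem (idx k x false) Z)) (fun x ih hx => ?_) x
    rcases lt_or_ge x n with hn | hn
    · rw [hin hk hx hn, hin hk hx hn]; simp
    · have ih' {y : N} (hy : M.Edge (M.row P k) y x) := ih y (edge_lt hy) ((edge_lt hy).trans hx)
      rw [hg hk hx hn, hg hk hx hn]
      by_cases hA : M.IsAnd (M.row P k) x <;> by_cases hN : M.IsNeg (M.row P k) x <;>
        simp only [hA, hN, Bool.forall_bool, Bool.exists_bool] <;> simp <;> grind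
  obtain ⟨Y, hY⟩ := exists_rows M c w (fun k => {x | k < c ∧ x < w ∧ M.mem (idx k x true) Z})
    (h := by simp only [Set.mem_ofPred_eq]; infer_instance) (fun k x h => ⟨h.1, h.2.1⟩)
  refine ⟨Y, fun k hk x => ⟨fun hn => ?_, fun hn => ?_⟩⟩
  · have hx := hn.trans_le hwn
    rw [hY]
    change k < c ∧ x < w ∧ _ ↔ M.mem x A
    simp [hk, hx, hin hk hx hn]
  · have hYm {y : N} (hy : M.Edge (M.row P k) y x) :
        y ∈ M.row Y k ↔ M.mem (idx k y true) Z := by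
      have : y < w := (edge_lt hy).trans ((edge_lt_len hy).trans_le hwP)
      rw [hY]; simp [hk, this]
    have hYf {y : N} (hy : M.Edge (M.row P k) y x) :
        y ∈ M.row Y k ↔ ¬ M.mem (idx k y false) Z := by
      rw [hYm hy, hdual hk]
      exact (edge_lt hy).trans ((edge_lt_len hy).trans_le hwP)
    rcases lt_or_ge x w with hx | hx
    · have : x ∈ M.row Y k ↔ M.mem (idx k x true) Z := by rw [hY]; simp [hk, hx]
      rw [this, hg hk hx hn, GateVal]
      by_cases hA : M.IsAnd (M.row P k) x <;> by_cases hN : M.IsNeg (M.row P k) x <;>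
        simp only [hA, hN, Bool.forall_bool, Bool.exists_bool] <;> simp [Xor] <;> grind
    -- Gates from w on are unnegated disjunctions without predecessors, so their value is 0.
    · have h1 : x ∉ M.row Y k := by rw [hY]; simp [not_lt.2 hx]
      have h2 : ¬ M.IsAnd (M.row P k) x := fun h => absurd (isAnd_lt_len h) (not_lt.2 (hwP.trans hx))
      have h3 : ¬ M.IsNeg (M.row P k) x := fun h => absurd (isNeg_lt_len h) (not_lt.2 (hwP.trans hx))
      have h4 (y : N) : ¬ M.Edge (M.row P k) y x :=
        fun h => absurd (edge_lt_len h) (not_lt.2 (hwP.trans hx))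
      simp [GateVal, Xor, h1, h2, h3, h4]

end Model

end TwoSorted

set_option linter.unusedSectionVars false
set_option synthInstance.maxSize 1000
set_option synthInstance.maxHeartbeats 200000

namespace TwoSorted

namespace Model

variable {N : Type u} {S : Type v} [CommSemiring N] [LinearOrder N] [IsStrictOrderedRing N]
  [CanonicallyOrderedAdd N] [Nonempty S] {M : Model N S} [hM : M.Std]

/-! ### The calculus of evaluations -/

variable (M) in
/-- The sequents in `ℱ` are true for all values of the inputs. -/
def PrA (n c : N) (P : S) (ℱ : Set (Seq N)) : Prop :=
  ∀ A Y : S, (∀ k < c, M.FullComp n (M.row P k) (M.bits A) (M.row Y k)) →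
    ∀ Γ ∈ ℱ, ∃ b k x, Γ b k x ∧ k < c ∧ (b = true ↔ x ∈ M.row Y k)

open Classical in
theorem FullComp.leftSeq {n : N} {T A Y : Set N} (h : M.FullComp n T A Y) {x y k : N} (hx : n ≤ x)
    (hy : M.Edge T y x) : ∃ b ξ, M.leftSeq T k x y b k ξ ∧ (b = true ↔ ξ ∈ Y) := by
  have hv := (h x).2 hx
  by_cases hyY : M.IsAnd T x ↔ y ∈ Y
  · exact ⟨decide (y ∈ Y), y, ⟨rfl, Or.inr (by simp [hyY])⟩, by simp⟩
  · refine ⟨decide (x ∈ Y), x, ⟨rfl, Or.inl ⟨?_, rfl⟩⟩, by simp⟩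
    simp only [decide_eq_true_eq, hv, GateVal, Xor]
    by_cases hA : M.IsAnd T x
    · have : ¬ ∀ y, M.Edge T y x → y ∈ Y := fun h => hyY (by simp [hA, h y hy])
      simp [hA, this]
    · have : ∃ y, M.Edge T y x ∧ y ∈ Y := ⟨y, hy, by by_contra h; exact hyY (by simp [hA, h])⟩
      simp [hA, this]

open Classical in
theorem FullComp.rightSeq {n : N} {T A Y : Set N} (h : M.FullComp n T A Y) {x k : N} (hx : n ≤ x) :
    ∃ b ξ, M.rightSeq T k x b k ξ ∧ (b = true ↔ ξ ∈ Y) := by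
  have hv := (h x).2 hx
  by_cases hyY : ∃ y, M.Edge T y x ∧ (y ∈ Y ↔ ¬ M.IsAnd T x)
  · obtain ⟨y, hy, hyY⟩ := hyY
    exact ⟨decide (y ∈ Y), y, ⟨rfl, Or.inl ⟨by simp [hyY], hy⟩⟩, by simp⟩
  · push Not at hyY
    refine ⟨decide (x ∈ Y), x, ⟨rfl, Or.inr ⟨?_, rfl⟩⟩, by simp⟩
    simp only [decide_eq_true_eq, hv, GateVal, Xor]
    by_cases hA : M.IsAnd T x
    · have : ∀ y, M.Edge T y x → y ∈ Y := fun y hy => by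
        have := hyY y hy; simp only [hA] at this; tauto
      simp only [hA, true_and, not_true, false_and, or_false, true_iff]
      tauto
    · have : ¬ ∃ y, M.Edge T y x ∧ y ∈ Y := fun ⟨y, hy, h⟩ => by
        have := hyY y hy; simp only [hA] at this; tauto
      simp only [hA, this, false_and, and_false, or_false, false_iff, not_false_eq_true]
      tauto

open Classical in
theorem PrA.axSet (M : Model N S) [hM : M.Std] (n c : N) (P : S) (w : N) :
    M.PrA n c P (M.AxSet n (M.row P) c w) := by
  rintro A Y hY _ (⟨k, hk, k', hk', x, hx, rfl⟩ | ⟨k, hk, x, -, y, hn, he, rfl⟩ |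
    ⟨k, hk, x, -, hn, rfl⟩)
  · by_cases hA : x ∈ M.bits A
    · exact ⟨true, k', x, Or.inr ⟨rfl, rfl, rfl⟩, hk', by simp [((hY k' hk') x).1 hx, hA]⟩
    · exact ⟨false, k, x, Or.inl ⟨rfl, rfl, rfl⟩, hk, by simp [((hY k hk) x).1 hx, hA]⟩
  · obtain ⟨b, ξ, h1, h2⟩ := (hY k hk).leftSeq (k := k) hn he
    exact ⟨b, k, ξ, h1, hk, h2⟩
  · obtain ⟨b, ξ, h1, h2⟩ := (hY k hk).rightSeq (k := k) hn
    exact ⟨b, k, ξ, h1, hk, h2⟩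

/-- Case derivations preserve truth, so strong induction inside M applies. The bounds c and w make
"Δ i contains a true literal" a Σ₀ᴮ statement. -/
theorem PrA.ind {n c : N} {P : S} {ℱ : Set (Seq N)} (h : M.PrA n c P ℱ) (a w : N) (d : ℕ)
    (Δ : N → Seq N) (J : N → Prop) [hΔ : ∀ b, Fm M true (fun e _ => Δ (e 0) b (e 1) (e 2))]
    [hJ : Fm M true (fun e _ => J (e 0))]
    (hw : ∀ i < a, J i → ∀ b k x, Δ i b k x → k < c ∧ x < w)
    (hd : ∀ i < a, J i → Der d (ℱ ∪ {Γ | ∃ j < i, J j ∧ Γ = Δ j}) (Δ i)) :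
    M.PrA n c P (ℱ ∪ {Γ | ∃ j < a, J j ∧ Γ = Δ j}) := by
  have hΔ (b : Bool) := Fm.subst₃ (P := fun l k x => Δ l b k x) (hΔ b)
  have hJ := hJ.subst₁
  intro A Y hY
  have key (i : N) : i < a → J i → ∃ b, ∃ k, k < c ∧ ∃ x, x < w ∧ Δ i b k x ∧
      (b = true ↔ x ∈ M.row Y k) := by
    refine strong_induction M (fun i => i < a → J i → ∃ b, ∃ k, k < c ∧ ∃ x, x < w ∧ Δ i b k x ∧
      (b = true ↔ x ∈ M.row Y k)) (fun i ih hi hJi => ?_) i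
    obtain ⟨b, k, x, h1, h2, h3⟩ := (hd i hi hJi).sound (v := fun k x => x ∈ M.row Y k)
      (c := fun k => k < c) (by
        rintro Γ (hΓ | ⟨j, hj, hJj, rfl⟩)
        · exact h A Y hY Γ hΓ
        · obtain ⟨b, k, hk, x, -, h1, h2⟩ := ih j hj (hj.trans hi) hJj
          exact ⟨b, k, x, h1, hk, h2⟩)
    exact ⟨b, k, h2, x, (hw i hi hJi b k x h1).2, h1, h3⟩
  rintro Γ (hΓ | ⟨j, hj, hJj, rfl⟩)
  · exact h A Y hY Γ hΓ
  · obtain ⟨b, k, hk, x, -, h1, h2⟩ := key j hj hJj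
    exact ⟨b, k, x, h1, hk, h2⟩

theorem PrA.leA (hMCV : M.MCV) {n c : N} {P : S} {C C' : M.Circ} {o o' : N} (hc : 1 < c)
    (h0 : M.SameGates (M.row P 0) C.code) (h1 : M.SameGates (M.row P 1) C'.code)
    (ho : M.IsOut C.code o) (ho' : M.IsOut C'.code o')
    (h : M.PrA n c P {cl2 false 0 o true 1 o'}) : M.leA n C C' := by
  intro A _ hC
  obtain ⟨Y, hY⟩ := exists_fullComp hMCV n P A c
  obtain ⟨b, k, x, ⟨rfl, rfl, rfl⟩ | ⟨rfl, rfl, rfl⟩, -, h3⟩ := h A Y hY _ rfl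
  · rw [(hY 0 (zero_lt_one.trans hc)).eval h0 ho] at hC
    exact absurd (h3.2 hC) (by simp)
  · rw [(hY 1 hc).eval h1 ho']
    exact h3.1 rfl

theorem leA.prA {n c : N} {P : S} {C C' : M.Circ} {o o' k k' : N} (h : M.leA n C C')
    (hk : k < c) (hk' : k' < c) (h0 : M.row P k = C.code) (h1 : M.row P k' = C'.code)
    (ho : M.IsOut C.code o) (ho' : M.IsOut C'.code o') :
    M.PrA n c P {cl2 false k o true k' o'} := by
  rintro A Y hY _ rfl
  by_cases hC : o ∈ M.row Y k
  · refine ⟨true, k', o', Or.inr ⟨rfl, rfl, rfl⟩, hk', ?_⟩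
    -- The order only speaks about assignments of length at most n, so `A` is truncated. Values at n
    -- and above are never read.
    obtain ⟨A', hA', hA⟩ := exists_set M (fun x => M.mem x A) n
    have hfc {i : N} (hi : i < c) : M.FullComp n (M.row P i) (M.bits A') (M.row Y i) := by
      refine fun x => ⟨fun hx => ?_, (hY i hi x).2⟩
      rw [(hY i hi x).1 hx]
      exact ((hA x).trans (and_iff_right hx)).symm
    have := h A' ((hM.le_iff _ _).2 hA')
      (((hfc hk).eval (h0 ▸ SameGates.refl _) ho).2 hC)
    rw [(hfc hk').eval (h1 ▸ SameGates.refl _) ho'] at this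
    simp [this]
  · exact ⟨false, k, o, Or.inl ⟨rfl, rfl, rfl⟩, hk, by simp [hC]⟩

theorem fm_leA (M : Model N S) [hM : M.Std] (n : N) :
    Fm M false (fun _ s => ∃ C C' : M.Circ, C.1 = s 0 ∧ C'.1 = s 1 ∧ M.leA n C C') := by
  refine Fm.congr (P := fun _ s => M.IsCircuit (M.bits (s 0)) ∧ M.IsCircuit (M.bits (s 1)) ∧
    ∀ A, M.le (M.len A) n → M.Eval n (M.bits (s 0)) A → M.Eval n (M.bits (s 1)) A) ?_ fun _ s => ?_
  · unfold Eval IsComputation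
    infer_instance
  · constructor
    · rintro ⟨h, h', h''⟩
      exact ⟨⟨s 0, h⟩, ⟨s 1, h'⟩, rfl, rfl, h''⟩
    · rintro ⟨⟨_, h⟩, ⟨_, h'⟩, rfl, rfl, h''⟩
      exact ⟨h, h', h''⟩

theorem nonempty_calc_leA (hMCV : M.MCV) (n : N) : Nonempty (M.Calc n (M.leA n)) :=
  ⟨{  Pr := fun c P ℱ => M.PrA n c P ℱ
      mono := fun h hℱ A Y hY Γ hΓ => by
        obtain ⟨Γ', hΓ', hle⟩ := hℱ Γ hΓ
        obtain ⟨b, k, x, h1, h2⟩ := h A Y hY Γ' hΓ'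
        exact ⟨b, k, x, hle _ _ _ h1, h2⟩
      union := fun h h' A Y hY Γ hΓ => hΓ.elim (h A Y hY Γ) (h' A Y hY Γ)
      axSet := fun c P w => PrA.axSet M n c P w
      ind := fun h a w d Δ J _ _ hw hd => h.ind a w d Δ J hw hd
      concl := fun hc h0 h1 ho ho' h => h.leA hMCV hc h0 h1 ho ho'
      hyps2 := by
        intro C₁ C₂ C₃ C₄ o₁ o₂ o₃ o₄ h h' h₁ h₂ h₃ h₄ Z Z'
        obtain ⟨U, hU0, hU1, hU2, hU3, hU4, hU5, -⟩ :=
          exists_six_rows M Z Z' C₁.1 C₂.1 C₃.1 C₄.1 Z Z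
        refine ⟨U, hU0, hU1, hU2, hU3, hU4, hU5, fun A Y hY Γ hΓ => ?_⟩
        rcases hΓ with rfl | rfl
        · exact h.prA (c := 6) (by norm_num) (by norm_num) hU2 hU3 h₁ h₂ A Y hY _ rfl
        · exact h'.prA (c := 6) (by norm_num) (by norm_num) hU4 hU5 h₃ h₄ A Y hY _ rfl
      def_ := fm_leA M n }⟩

end Model

end TwoSorted

set_option linter.unusedSectionVars false
set_option synthInstance.maxSize 1000
set_option synthInstance.maxHeartbeats 200000

namespace TwoSorted

namespace Model

variable {N : Type u} {S : Type v} [CommSemiring N] [LinearOrder N] [IsStrictOrderedRing N]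
  [CanonicallyOrderedAdd N] [Nonempty S] {M : Model N S} [hM : M.Std]

/-! ### Bisimilar gates -/

/-- All four types of gates are treated alike: the literal of x with sign s is the conjunction of
the literals of its predecessors with sign a. For disjunctions a is false, since they are negated
conjunctions of negated predecessors. -/
theorem leftSeq_iff {T : Set N} {k x y : N} {s a : Bool}
    (hs : s = true ↔ (M.IsAnd T x ↔ ¬ M.IsNeg T x)) (ha : a = true ↔ M.IsAnd T x) (β : Bool)
    (κ ξ : N) : M.leftSeq T k x y β κ ξ ↔ κ = k ∧ ((β = !s ∧ ξ = x) ∨ (β = a ∧ ξ = y)) := by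
  rw [leftSeq, ← hs, ← ha]
  cases s <;> cases a <;> cases β <;> simp

theorem rightSeq_iff {T : Set N} {k x : N} {s a : Bool}
    (hs : s = true ↔ (M.IsAnd T x ↔ ¬ M.IsNeg T x)) (ha : a = true ↔ M.IsAnd T x) (β : Bool)
    (κ ξ : N) : M.rightSeq T k x β κ ξ ↔ κ = k ∧ ((β = !a ∧ M.Edge T ξ x) ∨ (β = s ∧ ξ = x)) := by
  rw [rightSeq, ← hs, ← ha]
  cases s <;> cases a <;> cases β <;> simp

/-- Suppose that the s-literal of x and the complementary literal of x' are both false. Then some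
predecessor y of x has a false a-literal, whereas all predecessors of x' have true a-literals,
against the implication for the partner y' of y. This uses one right axiom and one left axiom, hence
depth 2. -/
theorem der_gate {𝒜 : Set (Seq N)} {Γ : Seq N} {T T' : Set N} {k k' x x' : N} {s a : Bool}
    (hs : s = true ↔ (M.IsAnd T x ↔ ¬ M.IsNeg T x)) (ha : a = true ↔ M.IsAnd T x)
    (hA : M.IsAnd T x ↔ M.IsAnd T' x') (hN : M.IsNeg T x ↔ M.IsNeg T' x')
    (h : Γ s k x) (h' : Γ (!s) k' x') (hr : M.rightSeq T k x ∈ 𝒜)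
    (hl : ∀ y', M.Edge T' y' x' → M.leftSeq T' k' x' y' ∈ 𝒜)
    (hE : ∀ y, M.Edge T y x → ∃ y', M.Edge T' y' x' ∧ cl2 a k y (!a) k' y' ∈ 𝒜) :
    Der 2 𝒜 Γ := by
  refine ⟨_, hr, fun β κ ξ hβ => ?_⟩
  obtain ⟨rfl, ⟨rfl, he⟩ | ⟨rfl, rfl⟩⟩ := (rightSeq_iff hs ha _ _ _).1 hβ
  · right
    obtain ⟨y', he', hy'⟩ := hE ξ he
    refine ⟨_, hl y' he', fun β κ' ξ' hβ => ?_⟩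
    obtain ⟨rfl, ⟨rfl, rfl⟩ | ⟨rfl, rfl⟩⟩ :=
      (leftSeq_iff (by rw [hs, hA, hN]) (by rw [ha, hA]) _ _ _).1 hβ
    · exact Or.inl (Or.inl h')
    · refine Or.inr ⟨_, hy', ?_⟩
      rintro _ _ _ (⟨rfl, rfl, rfl⟩ | ⟨rfl, rfl, rfl⟩)
      · exact Or.inl (Or.inr ⟨by simp, rfl, rfl⟩)
      · exact Or.inr ⟨rfl, rfl, rfl⟩
  · exact Or.inl h

variable (M) in
/-- `R` is a bisimulation between the gates of `T` and the gates of `T'`. -/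
structure IsBisim (n : N) (T T' : Set N) (R : N → N → Prop) : Prop where
  cases : ∀ x x', R x x' → (x < n ∧ x' = x) ∨ (n ≤ x ∧ n ≤ x')
  isAnd : ∀ x x', R x x' → n ≤ x → (M.IsAnd T x ↔ M.IsAnd T' x')
  isNeg : ∀ x x', R x x' → n ≤ x → (M.IsNeg T x ↔ M.IsNeg T' x')
  forth : ∀ x x', R x x' → n ≤ x → ∀ y, M.Edge T y x → ∃ y', M.Edge T' y' x' ∧ R y y'
  back : ∀ x x', R x x' → n ≤ x → ∀ y', M.Edge T' y' x' → ∃ y, M.Edge T y x ∧ R y y'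

-- Induction inside M on the code of the pair (x, x'), which decreases along edges. The implications
-- in both directions are proved simultaneously, because negated gates and disjunctions reverse
-- signs.
open Classical in
theorem Calc.bisim {n : N} {r : M.Circ → M.Circ → Prop} (K : M.Calc n r) {c : N} {P : S} {k k' : N}
    (hk : k < c) (hk' : k' < c) {R : N → N → Prop} [hR : Fm M true (fun e _ => R (e 0) (e 1))]
    (w : N) (hw : ∀ x x', R x x' → x < w ∧ x' < w) (h : M.IsBisim n (M.row P k) (M.row P k') R) :
    K.Pr c P {Γ | ∃ x x' s, R x x' ∧ Γ = cl2 s k x (!s) k' x'} := by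
  have hR := hR.subst₂
  obtain ⟨E, hE⟩ : ∃ E : N → N → Bool → N,
    E = fun x x' s => M.pair (M.pair x x') (if s then 1 else 0) := ⟨_, rfl⟩
  have hTm (s : Bool) {t t' : (ℕ → N) → (ℕ → S) → N} [Tm M t] [Tm M t'] :
      Tm M (fun e σ => E (t e σ) (t' e σ) s) := by
    rw [hE]; infer_instance
  have hEinj {x x' y y' : N} {s t : Bool} : E x x' s = E y y' t ↔ x = y ∧ x' = y' ∧ s = t := by
    rw [hE]; simp only [pair_inj]; cases s <;> cases t <;> simp
  have hElt {x x' y y' : N} {s t : Bool} (h1 : y < x) (h2 : y' < x') : E y y' t < E x x' s := by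
    have h3 : M.pair y y' + (if t then 1 else 0) < M.pair x x' + (if s then 1 else 0) := by
      calc M.pair y y' + (if t then 1 else 0) ≤ M.pair y y' + 1 := by
            gcongr; split_ifs <;> simp
        _ ≤ M.pair y x' := (add_one_le M _ _).2 (pair_lt_pair_right _ h2)
        _ < M.pair x x' := pair_lt_pair_left h1 _
        _ ≤ _ := le_self_add
    rw [hE]
    exact pair_lt_pair_of_add_lt h3
  have hJ {x x' : N} {s : Bool} (h : R x x') : ∃ y, y < w ∧ ∃ y', y' < w ∧ ∃ t, E x x' s = E y y' t ∧
      R y y' := ⟨x, (hw x x' h).1, x', (hw x x' h).2, s, rfl, h⟩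
  have hΔ {x x' : N} {s : Bool} (hR : R x x') : (fun b κ ξ => ∃ y, y < w ∧ ∃ y', y' < w ∧ ∃ t : Bool,
      E x x' s = E y y' t ∧ cl2 t k y (!t) k' y' b κ ξ) = cl2 s k x (!s) k' x' := by
    funext b κ ξ
    apply propext
    constructor
    · rintro ⟨y, -, y', -, t, h1, h2⟩
      obtain ⟨rfl, rfl, rfl⟩ := hEinj.1 h1
      exact h2
    · exact fun h => ⟨x, (hw x x' hR).1, x', (hw x x' hR).2, s, rfl, h⟩
  have key := K.ind (K.axSet c P w) (E w w true) w 2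
    (fun i b κ ξ => ∃ y, y < w ∧ ∃ y', y' < w ∧ ∃ t : Bool, i = E y y' t ∧
      cl2 t k y (!t) k' y' b κ ξ)
    (fun i => ∃ y, y < w ∧ ∃ y', y' < w ∧ ∃ t : Bool, i = E y y' t ∧ R y y')
    (by
      rintro _ - - b κ ξ ⟨y, hy, y', hy', t, -, ⟨-, rfl, rfl⟩ | ⟨-, rfl, rfl⟩⟩
      · exact ⟨hk, hy⟩
      · exact ⟨hk', hy'⟩) ?_
  · refine K.mono key ?_
    rintro _ ⟨x, x', s, h, rfl⟩
    refine ⟨_, Or.inr ⟨E x x' s, hElt (hw x x' h).1 (hw x x' h).2, hJ h, rfl⟩, (hΔ h).le⟩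
  · rintro _ - ⟨x, hx, x', hx', s, rfl, hxx⟩
    rw [hΔ hxx]
    rcases h.cases x x' hxx with ⟨hn, rfl⟩ | ⟨hn, hn'⟩
    · refine Der.of_le (d := 0) (by omega) ?_
      cases s
      · exact ⟨_, Or.inl (Or.inl ⟨k, hk, k', hk', x', hn, rfl⟩), le_rfl⟩
      · exact ⟨_, Or.inl (Or.inl ⟨k', hk', k, hk, x', hn, rfl⟩), fun _ _ _ h => h.symm⟩
    · obtain ⟨s₀, hs₀⟩ : ∃ s₀ : Bool, s₀ = true ↔
        (M.IsAnd (M.row P k) x ↔ ¬ M.IsNeg (M.row P k) x) := ⟨decide _, decide_eq_true_iff⟩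
      obtain ⟨a, ha⟩ : ∃ a : Bool, a = true ↔ M.IsAnd (M.row P k) x := ⟨decide _, decide_eq_true_iff⟩
      have hA := h.isAnd x x' hxx hn
      have hN := h.isNeg x x' hxx hn
      have hcl {y y' : N} {t : Bool} (hy : y < x) (hy' : y' < x') (h : R y y') :
          cl2 t k y (!t) k' y' ∈ {Γ | ∃ j < E x x' s, (∃ y, y < w ∧ ∃ y', y' < w ∧ ∃ t : Bool,
            j = E y y' t ∧ R y y') ∧ Γ = fun b κ ξ => ∃ y, y < w ∧ ∃ y', y' < w ∧ ∃ t : Bool,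
            j = E y y' t ∧ cl2 t k y (!t) k' y' b κ ξ} :=
        ⟨E y y' t, hElt hy hy', hJ h, (hΔ h).symm⟩
      -- The two signs are the same argument with the circuits exchanged, using `forth` in one case
      -- and `back` in the other.
      rcases Bool.eq_or_eq_not s s₀ with rfl | rfl
      · refine der_gate hs₀ ha hA hN (Or.inl ⟨rfl, rfl, rfl⟩) (Or.inr ⟨rfl, rfl, rfl⟩)
          (Or.inl (Or.inr (Or.inr ⟨k, hk, x, hx, hn, rfl⟩)))
          (fun y' hy' => Or.inl (Or.inr (Or.inl ⟨k', hk', x', hx', y', hn', hy', rfl⟩)))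
          fun y hy => ?_
        obtain ⟨y', hy', hR'⟩ := h.forth x x' hxx hn y hy
        exact ⟨y', hy', Or.inr (hcl (edge_lt hy) (edge_lt hy') hR')⟩
      · refine der_gate (T := M.row P k') (T' := M.row P k) (k := k') (k' := k) (x := x') (x' := x)
          (by rw [hs₀, hA, hN]) (by rw [ha, hA]) hA.symm hN.symm
          (Or.inr ⟨by simp, rfl, rfl⟩) (Or.inl ⟨rfl, rfl, rfl⟩)
          (Or.inl (Or.inr (Or.inr ⟨k', hk', x', hx', hn', rfl⟩)))
          (fun y' hy' => Or.inl (Or.inr (Or.inl ⟨k, hk, x, hx, y', hn, hy', rfl⟩)))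
          fun y' hy' => ?_
        obtain ⟨y, hy, hR'⟩ := h.back x x' hxx hn y' hy'
        refine ⟨y, hy, Or.inr ?_⟩
        have := hcl (t := !a) (edge_lt hy) (edge_lt hy') hR'
        rw [Bool.not_not] at this
        convert this using 1
        funext b κ ξ
        exact propext or_comm

end Model

end TwoSorted

set_option linter.unusedSectionVars false
set_option synthInstance.maxSize 1000
set_option synthInstance.maxHeartbeats 200000

namespace TwoSorted

namespace Model

variable {N : Type u} {S : Type v} [CommSemiring N] [LinearOrder N] [IsStrictOrderedRing N]
  [CanonicallyOrderedAdd N] [Nonempty S] {M : Model N S} [hM : M.Std]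

instance Fm.strEq {b : Bool} {X X' : (ℕ → S) → S} [h : Ss X] [h' : Ss X'] :
    Fm M b (fun _ s => X s = X' s) := by
  obtain ⟨j, q, h⟩ := h
  obtain ⟨j', q', h'⟩ := h'
  refine ⟨.strEq (renL j) (renR j'), fun _ => trivial, fun _ => M.zero, mix q q', fun e s => ?_⟩
  have h1 := congrFun (mix_comp_renL s q q') j
  have h2 := congrFun (mix_comp_renR s q q') j'
  simp only [Function.comp] at h1 h2
  simp [Realize, h1, h2, h, h']

/-! ### Closure properties of bisimulations -/

theorem IsBisim.le_left {n : N} {T T' : Set N} {R : N → N → Prop} (h : M.IsBisim n T T' R)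
    {x x' : N} (hR : R x x') (hx : n ≤ x') : n ≤ x := by
  rcases h.cases x x' hR with ⟨h1, rfl⟩ | ⟨h1, -⟩
  · exact hx
  · exact h1

theorem IsBisim.congr {n : N} {T T' T₁ T₁' : Set N} {R : N → N → Prop} (h : M.IsBisim n T T' R)
    (hT : M.SameGates T T₁) (hT' : M.SameGates T' T₁') : M.IsBisim n T₁ T₁' R where
  cases := h.cases
  isAnd x x' hR hx := by rw [← hT.isAnd, ← hT'.isAnd]; exact h.isAnd x x' hR hx
  isNeg x x' hR hx := by rw [← hT.isNeg, ← hT'.isNeg]; exact h.isNeg x x' hR hx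
  forth x x' hR hx y hy := by
    obtain ⟨y', h1, h2⟩ := h.forth x x' hR hx y ((hT.edge _ _).2 hy)
    exact ⟨y', (hT'.edge _ _).1 h1, h2⟩
  back x x' hR hx y hy := by
    obtain ⟨y', h1, h2⟩ := h.back x x' hR hx y ((hT'.edge _ _).2 hy)
    exact ⟨y', (hT.edge _ _).1 h1, h2⟩

theorem IsBisim.symm {n : N} {T T' : Set N} {R : N → N → Prop} (h : M.IsBisim n T T' R) :
    M.IsBisim n T' T (fun x x' => R x' x) where
  cases x x' hR := by
    rcases h.cases x' x hR with ⟨h1, rfl⟩ | ⟨h1, h2⟩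
    · exact Or.inl ⟨h1, rfl⟩
    · exact Or.inr ⟨h2, h1⟩
  isAnd x x' hR hx := (h.isAnd x' x hR (h.le_left hR hx)).symm
  isNeg x x' hR hx := (h.isNeg x' x hR (h.le_left hR hx)).symm
  forth x x' hR hx := h.back x' x hR (h.le_left hR hx)
  back x x' hR hx := h.forth x' x hR (h.le_left hR hx)

theorem IsBisim.comp {n : N} {T T' T'' : Set N} {R R' : N → N → Prop} (h : M.IsBisim n T T' R)
    (h' : M.IsBisim n T' T'' R') : M.IsBisim n T T'' (fun x z => ∃ y, R x y ∧ R' y z) where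
  cases x z := by
    rintro ⟨y, h1, h2⟩
    rcases h.cases x y h1 with ⟨h3, rfl⟩ | ⟨h3, h4⟩
    · rcases h'.cases y z h2 with h5 | ⟨h5, -⟩
      · exact Or.inl h5
      · exact absurd h3 (not_lt.2 h5)
    · rcases h'.cases y z h2 with ⟨h5, -⟩ | ⟨-, h6⟩
      · exact absurd h5 (not_lt.2 h4)
      · exact Or.inr ⟨h3, h6⟩
  isAnd x z := by
    rintro ⟨y, h1, h2⟩ hx
    exact (h.isAnd x y h1 hx).trans (h'.isAnd y z h2 (h.symm.le_left h1 hx))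
  isNeg x z := by
    rintro ⟨y, h1, h2⟩ hx
    exact (h.isNeg x y h1 hx).trans (h'.isNeg y z h2 (h.symm.le_left h1 hx))
  forth x z := by
    rintro ⟨y, h1, h2⟩ hx u hu
    obtain ⟨u', h3, h4⟩ := h.forth x y h1 hx u hu
    obtain ⟨u'', h5, h6⟩ := h'.forth y z h2 (h.symm.le_left h1 hx) u' h3
    exact ⟨u'', h5, u', h4, h6⟩
  back x z := by
    rintro ⟨y, h1, h2⟩ hx u hu
    obtain ⟨u', h3, h4⟩ := h'.back y z h2 (h.symm.le_left h1 hx) u hu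
    obtain ⟨u'', h5, h6⟩ := h.back x y h1 hx u' h3
    exact ⟨u'', h5, u', h6, h4⟩

theorem IsBisim.iUnion {n : N} {T T' : Set N} {J : N → Prop} {R : N → N → N → Prop}
    (h : ∀ i, J i → M.IsBisim n T T' (R i)) :
    M.IsBisim n T T' (fun x x' => ∃ i, J i ∧ R i x x') where
  cases := by rintro x x' ⟨i, hi, hR⟩; exact (h i hi).cases x x' hR
  isAnd := by rintro x x' ⟨i, hi, hR⟩; exact (h i hi).isAnd x x' hR
  isNeg := by rintro x x' ⟨i, hi, hR⟩; exact (h i hi).isNeg x x' hR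
  forth := by
    rintro x x' ⟨i, hi, hR⟩ hx y hy
    obtain ⟨y', h1, h2⟩ := (h i hi).forth x x' hR hx y hy
    exact ⟨y', h1, i, hi, h2⟩
  back := by
    rintro x x' ⟨i, hi, hR⟩ hx y hy
    obtain ⟨y', h1, h2⟩ := (h i hi).back x x' hR hx y hy
    exact ⟨y', h1, i, hi, h2⟩

/-- A copy of a circuit inside another one. -/
theorem IsBisim.of_edge {n : N} {T T' : Set N} {R : N → N → Prop}
    (h : ∀ x x', R x x' → (x < n ∧ x' = x) ∨ (n ≤ x ∧ n ≤ x'))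
    (h' : ∀ x x', R x x' → n ≤ x → (∀ y < x, ∃ y', R y y') ∧ (M.IsAnd T' x' ↔ M.IsAnd T x) ∧
      (M.IsNeg T' x' ↔ M.IsNeg T x) ∧ ∀ u, M.Edge T' u x' ↔ ∃ y, M.Edge T y x ∧ R y u) :
    M.IsBisim n T T' R where
  cases := h
  isAnd x x' hR hx := (h' x x' hR hx).2.1.symm
  isNeg x x' hR hx := (h' x x' hR hx).2.2.1.symm
  forth x x' hR hx y hy := by
    obtain ⟨y', hy'⟩ := (h' x x' hR hx).1 y (edge_lt hy)
    exact ⟨y', ((h' x x' hR hx).2.2.2 y').2 ⟨y, hy, hy'⟩, hy'⟩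
  back x x' hR hx y' hy' := ((h' x x' hR hx).2.2.2 y').1 hy'

variable (M) in
/-- `T` and `T'` have the same gates below `w`. -/
structure SameBelow (w : N) (T T' : Set N) : Prop where
  isAnd : ∀ x < w, M.IsAnd T x ↔ M.IsAnd T' x
  isNeg : ∀ x < w, M.IsNeg T x ↔ M.IsNeg T' x
  edge : ∀ y, ∀ x < w, M.Edge T y x ↔ M.Edge T' y x

theorem SameGates.sameBelow {T T' : Set N} (h : M.SameGates T T') (w : N) : M.SameBelow w T T' :=
  ⟨fun x _ => h.isAnd x, fun x _ => h.isNeg x, fun y x _ => h.edge y x⟩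

theorem SameBelow.isBisim {w : N} {T T' : Set N} (h : M.SameBelow w T T') (n : N) :
    M.IsBisim n T T' (fun x x' => x' = x ∧ x < w) := by
  refine IsBisim.of_edge ?_ ?_
  · rintro _ x ⟨rfl, -⟩
    exact (lt_or_ge x n).imp (fun h => ⟨h, rfl⟩) fun h => ⟨h, h⟩
  · rintro _ x ⟨rfl, hx⟩ -
    refine ⟨fun y hy => ⟨y, rfl, hy.trans hx⟩, (h.isAnd x hx).symm, (h.isNeg x hx).symm,
      fun u => ?_⟩
    rw [← h.edge u x hx]
    exact ⟨fun hu => ⟨u, hu, rfl, (edge_lt hu).trans hx⟩, by rintro ⟨y, hy, rfl, -⟩; exact hy⟩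

/-! ### Provable implications between gates -/

theorem Calc.der {n : N} {r : M.Circ → M.Circ → Prop} (K : M.Calc n r) {c : N} {P : S} {ℱ : Set (Seq N)} (h : K.Pr c P ℱ) (w : N) (d : ℕ) (Γ : Seq N)
    [hΓ : ∀ b, Fm M true (fun e _ => Γ b (e 0) (e 1))] (hw : ∀ b k x, Γ b k x → k < c ∧ x < w)
    (hd : Der d ℱ Γ) : K.Pr c P (ℱ ∪ {Γ}) := by
  have hΓ (b : Bool) := Fm.subst₂ (P := fun k x => Γ b k x) (hΓ b)
  refine K.mono (K.ind h 1 w d (fun _ => Γ) (fun _ => True) (fun _ _ _ => hw)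
    fun _ _ _ => hd.mono (fun Δ h => ⟨Δ, Or.inl h, le_rfl⟩) le_rfl) ?_
  rintro Δ (hΔ | rfl)
  · exact ⟨Δ, Or.inl hΔ, le_rfl⟩
  · exact ⟨_, Or.inr ⟨0, one_pos, trivial, rfl⟩, le_rfl⟩

theorem Calc.imp_trans {n : N} {r : M.Circ → M.Circ → Prop} (K : M.Calc n r) {c : N} {P : S} {k x k' x' k'' x'' : N} (hk : k < c) (hk' : k'' < c)
    (h : K.Pr c P {cl2 false k x true k' x'}) (h' : K.Pr c P {cl2 false k' x' true k'' x''}) :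
    K.Pr c P {cl2 false k x true k'' x''} := by
  refine K.mono (K.der (K.union h h') (x + x'' + 1) 1 (cl2 false k x true k'' x'') ?_ ?_) ?_
  · rintro _ _ _ (⟨-, rfl, rfl⟩ | ⟨-, rfl, rfl⟩)
    · exact ⟨hk, (lt_add_one M _ _).2 le_self_add⟩
    · exact ⟨hk', (lt_add_one M _ _).2 le_add_self⟩
  · refine ⟨_, Or.inl rfl, ?_⟩
    rintro _ _ _ (⟨rfl, rfl, rfl⟩ | ⟨rfl, rfl, rfl⟩)
    · exact Or.inl (Or.inl ⟨rfl, rfl, rfl⟩)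
    · refine Or.inr ⟨_, Or.inr rfl, ?_⟩
      rintro _ _ _ (⟨rfl, rfl, rfl⟩ | ⟨rfl, rfl, rfl⟩)
      · exact Or.inr ⟨rfl, rfl, rfl⟩
      · exact Or.inl (Or.inr ⟨rfl, rfl, rfl⟩)
  · rintro _ rfl
    exact ⟨_, Or.inr rfl, le_rfl⟩

theorem Calc.imp_of_bisim {n : N} {r : M.Circ → M.Circ → Prop} (K : M.Calc n r) {c : N} {P : S} {k k' : N} (hk : k < c) (hk' : k' < c) {R : N → N → Prop}
    [hR : Fm M true (fun e _ => R (e 0) (e 1))] (w : N) (hw : ∀ x x', R x x' → x < w ∧ x' < w)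
    (h : M.IsBisim n (M.row P k) (M.row P k') R) {x x' : N} (hx : R x x') :
    K.Pr c P {cl2 false k x true k' x'} :=
  K.mono (K.bisim hk hk' w hw h) (by rintro _ rfl; exact ⟨_, ⟨x, x', false, hx, rfl⟩, le_rfl⟩)

theorem Calc.imp_of_sameGates {n : N} {r : M.Circ → M.Circ → Prop} (K : M.Calc n r) {c : N} {P : S} {k k' : N} (hk : k < c) (hk' : k' < c)
    (h : M.SameGates (M.row P k) (M.row P k')) (x : N) :
    K.Pr c P {cl2 false k x true k' x} :=
  K.imp_of_bisim hk hk' (R := fun y y' => y' = y ∧ y < x + 1) (x + 1)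
    (by rintro y _ ⟨rfl, h⟩; exact ⟨h, h⟩) ((h.sameBelow (x + 1)).isBisim n)
    ⟨rfl, (lt_add_one M _ _).2 le_rfl⟩

theorem Calc.le_of_bisim {n : N} {r : M.Circ → M.Circ → Prop} (K : M.Calc n r) {C C' : M.Circ} {R : N → N → Prop}
    [hR : Fm M true (fun e _ => R (e 0) (e 1))] (w : N) (hw : ∀ x x', R x x' → x < w ∧ x' < w)
    (h : M.IsBisim n C.code C'.code R) {o o' : N} (ho : M.IsOut C.code o) (ho' : M.IsOut C'.code o')
    (hR : R o o') : r C C' := by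
  obtain ⟨P, h0, h1, -⟩ := exists_six_rows M C.1 C'.1 C.1 C.1 C.1 C.1 C.1 C.1
  refine K.concl (c := 2) one_lt_two (by rw [h0]; exact .refl _) (by rw [h1]; exact .refl _) ho ho'
    (K.imp_of_bisim two_pos one_lt_two (R := R) w hw ?_ hR)
  rw [h0, h1]
  exact h

theorem Calc.refl' {n : N} {r : M.Circ → M.Circ → Prop} (K : M.Calc n r) {C C' : M.Circ} (h : M.SameGates C.code C'.code) {o : N} (ho : M.IsOut C.code o)
    (ho' : M.IsOut C'.code o) : r C C' :=
  K.le_of_bisim (R := fun y y' => y' = y ∧ y < o + 1) (o + 1)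
    (by rintro y _ ⟨rfl, h⟩; exact ⟨h, h⟩) ((h.sameBelow (o + 1)).isBisim n) ho ho'
    ⟨rfl, (lt_add_one M _ _).2 le_rfl⟩

/-- Implications are chained through the rows 0, 2, 3, 4, 5, 1; the links 0–2, 3–4 and 5–1 compare
equal circuits. -/
theorem Calc.trans {n : N} {r : M.Circ → M.Circ → Prop} (K : M.Calc n r) {C C' C'' : M.Circ} (h : r C C') (h' : r C' C'') : r C C'' := by
  obtain ⟨o, ho, -⟩ := C.2
  obtain ⟨o', ho', -⟩ := C'.2
  obtain ⟨o'', ho'', -⟩ := C''.2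
  obtain ⟨P, h0, h1, h2, h3, h4, h5, hP⟩ := K.hyps2 h h' ho ho' ho' ho'' C.1 C''.1
  have l0 : (0 : N) < 6 := by norm_num
  have l1 : (1 : N) < 6 := by norm_num
  have l2 : (2 : N) < 6 := by norm_num
  have l3 : (3 : N) < 6 := by norm_num
  have l4 : (4 : N) < 6 := by norm_num
  have l5 : (5 : N) < 6 := by norm_num
  have e1 := K.imp_of_sameGates (P := P) l0 l2 (by rw [h0, h2]; exact .refl _) o
  have e2 := K.imp_of_sameGates (P := P) l3 l4 (by rw [h3, h4]; exact .refl _) o'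
  have e3 := K.imp_of_sameGates (P := P) l5 l1 (by rw [h1, h5]; exact .refl _) o''
  have e4 : K.Pr 6 P {cl2 false 2 o true 3 o'} :=
    K.mono hP (by rintro _ rfl; exact ⟨_, Or.inl rfl, le_rfl⟩)
  have e5 : K.Pr 6 P {cl2 false 4 o' true 5 o''} :=
    K.mono hP (by rintro _ rfl; exact ⟨_, Or.inr rfl, le_rfl⟩)
  exact K.concl l1 (by rw [h0]; exact .refl _) (by rw [h1]; exact .refl _) ho ho''
    (K.imp_trans l0 l1 e1 (K.imp_trans l2 l1 e4 (K.imp_trans l3 l1 e2 (K.imp_trans l4 l1 e5 e3))))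

/-! ### Representations of gates by circuits -/

theorem exists_circ (M : Model N S) [hM : M.Std] (Q : S) (x : N) :
    ∃ C : M.Circ, M.SameGates C.code (M.bits Q) ∧ M.IsOut C.code x := by
  obtain ⟨Z, h1, h2, h3, h4⟩ := exists_network M (M.len Q + x + 1) (fun y => M.IsAnd (M.bits Q) y)
    (fun y => M.IsNeg (M.bits Q) y) (fun y => y = x) (fun y z => M.Edge (M.bits Q) y z)
    (fun y h => (isAnd_lt_len' h).trans_le (by rw [add_assoc]; exact le_self_add))
    (fun y h => (isNeg_lt_len' h).trans_le (by rw [add_assoc]; exact le_self_add))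
    (by rintro _ rfl; exact (lt_add_one M _ _).2 le_add_self)
    (fun y z h => ⟨edge_lt h, (edge_lt_len' h).trans_le (by rw [add_assoc]; exact le_self_add)⟩)
  exact ⟨⟨Z, x, (h3 x).2 rfl, fun y hy => (h3 y).1 hy⟩, ⟨h1, h2, h4⟩, (h3 x).2 rfl⟩

end Model

end TwoSorted

set_option linter.unusedSectionVars false
set_option synthInstance.maxSize 1000
set_option synthInstance.maxHeartbeats 200000

namespace TwoSorted

namespace Model

variable {N : Type u} {S : Type v} [CommSemiring N] [LinearOrder N] [IsStrictOrderedRing N]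
  [CanonicallyOrderedAdd N] [Nonempty S] {M : Model N S} [hM : M.Std]

/-! ### Joins -/

instance Fm.copyGate {b : Bool} {n : N} {t t' t'' : (ℕ → N) → (ℕ → S) → N} [Tm M t] [Tm M t']
    [Tm M t''] : Fm M b (fun e s => M.CopyGate n (t e s) (t' e s) (t'' e s)) := by
  unfold CopyGate; infer_instance

theorem copyGate_iff {n i x x' : N} :
    M.CopyGate n i x x' ↔ (x < n ∧ x' = x) ∨ (n ≤ x ∧ x' = n + M.pair i x) := by
  rw [CopyGate, lt_iff, hM.le_iff, hM.add_eq]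

theorem IsBigOr.isBisim {n a : N} {X : S} {B : Set N} (h : M.IsBigOr n a X B) {i m : N} (hi : i < a)
    (hm : M.IsOut (M.row X i) m) :
    M.IsBisim n (M.row X i) B (fun x x' => x ≤ m ∧ M.CopyGate n i x x') := by
  refine IsBisim.of_edge ?_ ?_
  · rintro x x' ⟨-, hx⟩
    rcases copyGate_iff.1 hx with h | ⟨h, rfl⟩
    · exact Or.inl h
    · exact Or.inr ⟨h, le_self_add⟩
  · rintro x x' ⟨hxm, hx⟩ hn
    obtain ⟨h1, h2, h3⟩ := h.2 i m ((lt_iff _ _).2 hi) hm x x' ((hM.le_iff _ _).2 hn)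
      ((hM.le_iff _ _).2 hxm) hx
    refine ⟨fun y hy => ?_, h1, h2, fun u => ?_⟩
    · rcases lt_or_ge y n with h | h
      · exact ⟨y, hy.le.trans hxm, copyGate_iff.2 (Or.inl ⟨h, rfl⟩)⟩
      · exact ⟨_, hy.le.trans hxm, copyGate_iff.2 (Or.inr ⟨h, rfl⟩)⟩
    · rw [h3]
      exact exists_congr fun y => and_congr_right fun hy =>
        (and_iff_right ((edge_lt hy).le.trans hxm)).symm

theorem isOut_lt_len {X : S} {i x : N} (h : M.IsOut (M.row X i) x) : x < M.len X :=
  (right_le_pair M _ _).trans_lt (right_lt_len (M := M) h)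

/-- The copy of a gate x ≥ n of X(i) is n + ⟨i, x⟩. Monotonicity of the pairing keeps edges
increasing, and n + ⟨a, |X|⟩, above all relevant copies, is the output. -/
theorem exists_bigOr (M : Model N S) [hM : M.Std] (n a : N) (X : S) :
    ∃ B : M.Circ, M.IsBigOr n a X B.code := by
  have hlt {i y i' y' : N} (hi : i < i') (hy : y < y') : n + M.pair i y < n + M.pair i' y' := by
    gcongr; exact pair_lt_pair hi hy
  have hcopy {i v u y : N} (h : M.CopyGate n i v u) (hn : n ≤ y) (hv : v < y) :
      u < n + M.pair i y := by
    rcases copyGate_iff.1 h with ⟨h, rfl⟩ | ⟨h, rfl⟩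
    · exact h.trans_le le_self_add
    · gcongr; exact pair_lt_pair_right _ hv
  have hcopy' {i v u : N} (hi : i < a) (h : M.CopyGate n i v u) (hv : v < M.len X) :
      u < n + M.pair a (M.len X) := by
    rcases copyGate_iff.1 h with ⟨h, rfl⟩ | ⟨h, rfl⟩
    · exact h.trans_le le_self_add
    · gcongr; exact pair_lt_pair hi hv
  have hO {x : N} (hx : x < n + M.pair a (M.len X)) : x < n + M.pair a (M.len X) + 1 :=
    hx.trans_le le_self_add
  obtain ⟨Z, h1, h2, h3, h4⟩ := exists_network M (n + M.pair a (M.len X) + 1)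
    (fun x => ∃ i, i < a ∧ ∃ y, y < M.len X ∧ n ≤ y ∧ x = n + M.pair i y ∧ M.IsAnd (M.row X i) y)
    (fun x => ∃ i, i < a ∧ ∃ y, y < M.len X ∧ n ≤ y ∧ x = n + M.pair i y ∧ M.IsNeg (M.row X i) y)
    (fun x => x = n + M.pair a (M.len X))
    (fun u x => (∃ i, i < a ∧ ∃ y, y < M.len X ∧ n ≤ y ∧ x = n + M.pair i y ∧ ∃ v, v < y ∧
        M.Edge (M.row X i) v y ∧ M.CopyGate n i v u) ∨
      (x = n + M.pair a (M.len X) ∧ ∃ i, i < a ∧ ∃ v, v < M.len X ∧ M.IsOut (M.row X i) v ∧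
        M.CopyGate n i v u))
    (by rintro _ ⟨i, hi, y, hy, hn, rfl, -⟩; exact hO (hlt hi hy))
    (by rintro _ ⟨i, hi, y, hy, hn, rfl, -⟩; exact hO (hlt hi hy))
    (by rintro _ rfl; exact (lt_add_one M _ _).2 le_rfl)
    (by
      rintro u _ (⟨i, hi, y, hy, hn, rfl, v, hv, -, hu⟩ | ⟨rfl, i, hi, v, hv, -, hu⟩)
      · exact ⟨hcopy hu hn hv, hO (hlt hi hy)⟩
      · exact ⟨hcopy' hi hu hv, (lt_add_one M _ _).2 le_rfl⟩)
  have hne {i y : N} (hi : i < a) : n + M.pair i y ≠ n + M.pair a (M.len X) := by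
    intro h
    exact hi.ne (pair_inj.1 (add_left_cancel h)).1
  have hinj {i y i' y' : N} : n + M.pair i y = n + M.pair i' y' ↔ i = i' ∧ y = y' := by
    rw [add_right_inj, pair_inj]
  obtain ⟨B, rfl⟩ : ∃ B : M.Circ, B.1 = Z :=
    ⟨⟨Z, _, (h3 _).2 rfl, fun y hy => (h3 y).1 hy⟩, rfl⟩
  change ∀ x, M.IsAnd B.code x ↔ _ at h1
  change ∀ x, M.IsNeg B.code x ↔ _ at h2
  change ∀ y x, M.Edge B.code y x ↔ _ at h4
  refine ⟨B, ⟨n + M.pair a (M.len X), (h3 _).2 rfl, ?_, ?_, ?_, ?_⟩, ?_⟩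
  · rw [hM.le_iff]; exact le_self_add
  · rw [h1]
    rintro ⟨i, hi, y, hy, -, h, -⟩
    exact hne hi h.symm
  · rw [h2]
    rintro ⟨i, hi, y, hy, -, h, -⟩
    exact hne hi h.symm
  · intro u
    rw [h4]
    simp only [lt_iff]
    constructor
    · rintro (⟨i, hi, y, hy, hn, h, -⟩ | ⟨-, i, hi, v, -, h⟩)
      · exact absurd h.symm (hne hi)
      · exact ⟨i, v, hi, h⟩
    · rintro ⟨i, v, hi, h, h'⟩
      exact Or.inr ⟨trivial, i, hi, v, isOut_lt_len h, h, h'⟩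
  · intro i m hi hm x x' hn hxm hx
    rw [lt_iff] at hi
    rw [hM.le_iff] at hn
    rw [hM.le_iff] at hxm
    obtain ⟨h, -⟩ | ⟨-, rfl⟩ := copyGate_iff.1 hx
    · exact absurd h (not_lt.2 hn)
    rw [h1, h2]
    simp only [h4, hinj, hi.ne, false_and, or_false]
    refine ⟨⟨?_, fun h => ?_⟩, ⟨?_, fun h => ?_⟩, fun u => ⟨?_, ?_⟩⟩
    · rintro ⟨i', -, y, -, -, ⟨rfl, rfl⟩, h⟩; exact h
    · exact ⟨i, hi, x, isAnd_lt_len h, hn, ⟨rfl, rfl⟩, h⟩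
    · rintro ⟨i', -, y, -, -, ⟨rfl, rfl⟩, h⟩; exact h
    · exact ⟨i, hi, x, isNeg_lt_len h, hn, ⟨rfl, rfl⟩, h⟩
    · rintro ⟨i', -, y, -, -, ⟨rfl, rfl⟩, v, -, h⟩; exact ⟨v, h⟩
    · rintro ⟨v, h, h'⟩
      exact ⟨i, hi, x, edge_lt_len h, hn, ⟨rfl, rfl⟩, v, edge_lt h, h, h'⟩

/-- The place of the gate `y < w` of one of two circuits that are combined into one. -/
def Copy₂ (n w j y y' : N) : Prop := y < w ∧ ((y < n ∧ y' = y) ∨ (n ≤ y ∧ y' = n + 2 * y + j))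

instance Fm.copy₂ {b : Bool} {n w j : N} {t t' : (ℕ → N) → (ℕ → S) → N} [Tm M t] [Tm M t'] :
    Fm M b (fun e s => Copy₂ n w j (t e s) (t' e s)) := by
  unfold Copy₂; infer_instance

/-- Circuits for the meets of the circuit `(Z, o)` with the circuits `(Q, i)`, `i < a`, `i ∈ Γ`. -/
theorem exists_meets (M : Model N S) [hM : M.Std] (n a : N) (Z Q : S) (o : N) (Γ : N → Prop)
    [hΓ : Fm M true (fun e _ => Γ (e 0))] :
    ∃ (X : S) (w m : N), o < w ∧ a ≤ w ∧ n ≤ m ∧ (∀ j ≤ 1, ∀ y y', Copy₂ n w j y y' → y' < m) ∧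
      ∀ i < a, M.IsBisim n (M.bits Z) (M.row X i) (Copy₂ n w 0) ∧
        M.IsBisim n (M.bits Q) (M.row X i) (Copy₂ n w 1) ∧
        (M.IsAnd (M.row X i) m ↔ Γ i) ∧ ¬ M.IsNeg (M.row X i) m ∧
        (∀ x, M.IsOut (M.row X i) x ↔ x = m) ∧
        ∀ u, M.Edge (M.row X i) u m ↔ Γ i ∧ (Copy₂ n w 0 o u ∨ Copy₂ n w 1 i u) := by
  have hΓ := hΓ.subst₁
  -- Gates below w are copied; this covers o in `Z` and every i < a in `Q`.
  obtain ⟨w, hw⟩ : ∃ w, w = o + 1 + a := ⟨_, rfl⟩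
  have how : o < w := hw ▸ ((lt_add_one M _ _).2 le_rfl).trans_le le_self_add
  have haw : a ≤ w := hw ▸ le_add_self
  have hodd {x y : N} : n + 2 * x ≠ n + 2 * y + 1 := by
    intro h
    rw [add_assoc, add_right_inj] at h
    have := (mul_add_inj M (l := x) (l' := y) (W := 2) (j := 0) (j' := 1) two_pos one_lt_two).1
      (by rw [mul_comm, h]; ring)
    exact zero_ne_one this.2
  have heven {x y : N} : n + 2 * x = n + 2 * y ↔ x = y := by
    rw [add_right_inj, mul_right_inj' two_ne_zero]
  have hodd' {x y : N} : n + 2 * x + 1 = n + 2 * y + 1 ↔ x = y := by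
    rw [add_left_inj, heven]
  have hlt {j y z : N} (hj : j ≤ 1) (hy : y < z) : n + 2 * y + j < n + 2 * z := by
    have h := mul_add_lt M (W := 2) hy (lt_of_le_of_lt hj one_lt_two)
    rw [add_assoc, mul_comm 2, mul_comm 2]
    gcongr
  have hm {j y y' z : N} (hj : j ≤ 1) (h : Copy₂ n w j y y') (hn : n ≤ z) (hz : y < z) :
      y' < n + 2 * z := by
    obtain ⟨-, ⟨h, rfl⟩ | ⟨-, rfl⟩⟩ := h
    · exact h.trans_le le_self_add
    · exact hlt hj hz
  have hm' {j y y' : N} (hj : j ≤ 1) (h : Copy₂ n w j y y') : y' < n + 2 * w := by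
    obtain ⟨hw, ⟨h, rfl⟩ | ⟨-, rfl⟩⟩ := h
    · exact h.trans_le le_self_add
    · exact hlt hj hw
  have h01 : (0 : N) ≤ 1 := zero_le
  have hmm {x : N} (hx : x < n + 2 * w) : x < n + 2 * w + 1 := hx.trans_le le_self_add
  have hlt0 {y z : N} (hy : y < z) : n + 2 * y < n + 2 * z := by
    simpa using hlt h01 hy
  have hself : n + 2 * w < n + 2 * w + 1 := (lt_add_one M _ _).2 le_rfl
  -- Gates y ≥ n of `Z` go to n + 2y, those of `Q` to n + 2y + 1. The output n + 2w is the
  -- conjunction of the copies of o and i if `Γ i`, and otherwise an empty disjunction, which is 0.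
  obtain ⟨X, hX⟩ := exists_system M a (n + 2 * w + 1)
    (fun i x => i < a ∧ ((∃ y, y < w ∧ n ≤ y ∧ x = n + 2 * y ∧ M.IsAnd (M.bits Z) y) ∨
      (∃ y, y < w ∧ n ≤ y ∧ x = n + 2 * y + 1 ∧ M.IsAnd (M.bits Q) y) ∨ (x = n + 2 * w ∧ Γ i)))
    (fun i x => i < a ∧ ((∃ y, y < w ∧ n ≤ y ∧ x = n + 2 * y ∧ M.IsNeg (M.bits Z) y) ∨
      (∃ y, y < w ∧ n ≤ y ∧ x = n + 2 * y + 1 ∧ M.IsNeg (M.bits Q) y)))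
    (fun i x => i < a ∧ x = n + 2 * w)
    (fun i u x => i < a ∧ (
      (∃ y, y < w ∧ n ≤ y ∧ x = n + 2 * y ∧ ∃ v, v < y ∧ M.Edge (M.bits Z) v y ∧ Copy₂ n w 0 v u) ∨
      (∃ y, y < w ∧ n ≤ y ∧ x = n + 2 * y + 1 ∧ ∃ v, v < y ∧ M.Edge (M.bits Q) v y ∧
        Copy₂ n w 1 v u) ∨
      (x = n + 2 * w ∧ Γ i ∧ (Copy₂ n w 0 o u ∨ Copy₂ n w 1 i u))))
    (by
      rintro i _ ⟨hi, ⟨y, hy, -, rfl, -⟩ | ⟨y, hy, -, rfl, -⟩ | ⟨rfl, -⟩⟩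
      · exact ⟨hi, hmm (hlt0 hy)⟩
      · exact ⟨hi, hmm (hlt le_rfl hy)⟩
      · exact ⟨hi, hself⟩)
    (by
      rintro i _ ⟨hi, ⟨y, hy, -, rfl, -⟩ | ⟨y, hy, -, rfl, -⟩⟩
      · exact ⟨hi, hmm (hlt0 hy)⟩
      · exact ⟨hi, hmm (hlt le_rfl hy)⟩)
    (by rintro i _ ⟨hi, rfl⟩; exact ⟨hi, hself⟩)
    (by
      rintro i u _ ⟨hi, ⟨y, hy, hn, rfl, v, hv, -, hu⟩ | ⟨y, hy, hn, rfl, v, hv, -, hu⟩ |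
        ⟨rfl, -, hu | hu⟩⟩
      · exact ⟨hi, hm h01 hu hn hv, hmm (hlt0 hy)⟩
      · exact ⟨hi, (hm le_rfl hu hn hv).trans_le le_self_add, hmm (hlt le_rfl hy)⟩
      · exact ⟨hi, hm' h01 hu, hself⟩
      · exact ⟨hi, hm' le_rfl hu, hself⟩)
  refine ⟨X, w, n + 2 * w, how, haw, le_self_add, fun j hj y y' h => hm' hj h, fun i hi => ?_⟩
  obtain ⟨h1, h2, h3, h4⟩ := hX i
  have hne0 {y : N} (hy : y < w) : n + 2 * y ≠ n + 2 * w := (hlt0 hy).ne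
  have hne1 {y : N} (hy : y < w) : n + 2 * y + 1 ≠ n + 2 * w := (hlt le_rfl hy).ne
  have hcases (j : N) (x x' : N) (h : Copy₂ n w j x x') : (x < n ∧ x' = x) ∨ (n ≤ x ∧ n ≤ x') := by
    rcases h with ⟨-, h | ⟨h, rfl⟩⟩
    · exact Or.inl h
    · exact Or.inr ⟨h, by rw [add_assoc]; exact le_self_add⟩
  have htot (j : N) {x : N} (hx : x < w) (y : N) (hy : y < x) : ∃ y', Copy₂ n w j y y' := by
    rcases lt_or_ge y n with h | h
    · exact ⟨y, hy.trans hx, Or.inl ⟨h, rfl⟩⟩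
    · exact ⟨_, hy.trans hx, Or.inr ⟨h, rfl⟩⟩
  refine ⟨IsBisim.of_edge (hcases 0) ?_, IsBisim.of_edge (hcases 1) ?_, ?_, ?_, ?_, ?_⟩
  · rintro x x' ⟨hx, h | ⟨-, h⟩⟩ hn
    · exact absurd h.1 (not_lt.2 hn)
    rw [add_zero] at h
    subst h
    refine ⟨htot 0 hx, ?_, ?_, fun u => ?_⟩
    · simp only [h1, hi, heven, hodd, hx.ne, true_and, false_and, and_false, exists_false, or_false]
      exact ⟨by rintro ⟨y, -, -, rfl, h⟩; exact h, fun h => ⟨x, hx, hn, rfl, h⟩⟩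
    · simp only [h2, hi, heven, hodd, true_and, false_and, and_false, exists_false, or_false]
      exact ⟨by rintro ⟨y, -, -, rfl, h⟩; exact h, fun h => ⟨x, hx, hn, rfl, h⟩⟩
    · simp only [h4, hi, heven, hodd, hx.ne, true_and, false_and, and_false, exists_false, or_false]
      exact ⟨by rintro ⟨y, -, -, rfl, v, -, h⟩; exact ⟨v, h⟩,
        fun ⟨v, h, h'⟩ => ⟨x, hx, hn, rfl, v, edge_lt h, h, h'⟩⟩
  · rintro x x' ⟨hx, h | ⟨-, rfl⟩⟩ hn
    · exact absurd h.1 (not_lt.2 hn)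
    refine ⟨htot 1 hx, ?_, ?_, fun u => ?_⟩
    · simp only [h1, hi, hodd', hodd.symm, true_and, false_and, and_false, exists_false, false_or,
        or_false]
      exact ⟨by rintro ⟨y, -, -, rfl, h⟩; exact h, fun h => ⟨x, hx, hn, rfl, h⟩⟩
    · simp only [h2, hi, hodd', hodd.symm, true_and, false_and, and_false, exists_false, false_or]
      exact ⟨by rintro ⟨y, -, -, rfl, h⟩; exact h, fun h => ⟨x, hx, hn, rfl, h⟩⟩
    · simp only [h4, hi, hodd', hodd.symm, true_and, false_and, and_false, exists_false, false_or,
        or_false]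
      exact ⟨by rintro ⟨y, -, -, rfl, v, -, h⟩; exact ⟨v, h⟩,
        fun ⟨v, h, h'⟩ => ⟨x, hx, hn, rfl, v, edge_lt h, h, h'⟩⟩
  · rw [h1]
    constructor
    · rintro ⟨-, ⟨y, hy, -, h, -⟩ | ⟨y, hy, -, h, -⟩ | ⟨-, h⟩⟩
      · exact absurd h.symm (hne0 hy)
      · exact absurd h.symm (hne1 hy)
      · exact h
    · exact fun h => ⟨hi, Or.inr (Or.inr ⟨rfl, h⟩)⟩
  · rw [h2]
    rintro ⟨-, ⟨y, hy, -, h, -⟩ | ⟨y, hy, -, h, -⟩⟩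
    · exact absurd h.symm (hne0 hy)
    · exact absurd h.symm (hne1 hy)
  · intro x; rw [h3]; exact and_iff_right hi
  · intro u
    rw [h4]
    constructor
    · rintro ⟨-, ⟨y, hy, -, h, -⟩ | ⟨y, hy, -, h, -⟩ | ⟨-, h⟩⟩
      · exact absurd h.symm (hne0 hy)
      · exact absurd h.symm (hne1 hy)
      · exact h
    · exact fun h => ⟨hi, Or.inr (Or.inr ⟨rfl, h⟩)⟩

end Model

end TwoSorted

set_option linter.unusedSectionVars false
set_option synthInstance.maxSize 1000
set_option synthInstance.maxHeartbeats 200000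

namespace TwoSorted

namespace Model

variable {N : Type u} {S : Type v} [CommSemiring N] [LinearOrder N] [IsStrictOrderedRing N]
  [CanonicallyOrderedAdd N] [Nonempty S] {M : Model N S} [hM : M.Std]

/-! ### The density argument -/

theorem Calc.imp_of_edge_and {n : N} {r : M.Circ → M.Circ → Prop} (K : M.Calc n r) {c : N} {P : S}
    {k x y : N} (hk : k < c) (hx : n ≤ x) (hA : M.IsAnd (M.row P k) x)
    (hN : ¬ M.IsNeg (M.row P k) x) (hy : M.Edge (M.row P k) y x) :
    K.Pr c P {cl2 false k x true k y} := by
  refine K.mono (K.axSet c P (x + 1)) ?_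
  rintro _ rfl
  refine ⟨_, Or.inr (Or.inl ⟨k, hk, x, (lt_add_one M _ _).2 le_rfl, y, hx, hy, rfl⟩), ?_⟩
  intro β κ ξ h
  rw [leftSeq_iff (s := true) (a := true) (by simp [hA, hN]) (by simp [hA])] at h
  obtain ⟨rfl, ⟨rfl, rfl⟩ | ⟨rfl, rfl⟩⟩ := h
  · exact Or.inl ⟨rfl, rfl, rfl⟩
  · exact Or.inr ⟨rfl, rfl, rfl⟩

variable (M) in
/-- A situation in which the truth lemma holds. -/
structure Forcing (n : N) (r : M.Circ → M.Circ → Prop) (I G : Set M.Circ) where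
  K : M.Calc n r
  ideal : M.IsIdeal r I
  complete : M.IsComplete n I
  generic : M.IsGeneric r I G

/-- The value of the gate `x` of `Q` with respect to `G`. -/
def Val (G : Set M.Circ) (Q : S) (x : N) : Prop :=
  ∃ C ∈ G, M.SameGates C.code (M.bits Q) ∧ M.IsOut C.code x

section Forcing

variable {n : N} {r : M.Circ → M.Circ → Prop} {I G : Set M.Circ}

theorem Forcing.mem_iff_val (F : M.Forcing n r I G) {C : M.Circ} {Q : S} {x : N}
    (h : M.SameGates C.code (M.bits Q)) (hx : M.IsOut C.code x) : C ∈ G ↔ Val G Q x := by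
  constructor
  · exact fun hC => ⟨C, hC, h, hx⟩
  · rintro ⟨C', hC', h', hx'⟩
    exact F.generic.filter.upper C' C (F.K.refl' (h'.trans h.symm) hx' hx) hC'

theorem Forcing.val_of_bisim (F : M.Forcing n r I G) {Q Q' : S} {R : N → N → Prop}
    [hR : Fm M true (fun e _ => R (e 0) (e 1))] (w : N) (hw : ∀ x x', R x x' → x < w ∧ x' < w)
    (h : M.IsBisim n (M.bits Q) (M.bits Q') R) {x x' : N} (hx : R x x') (hv : Val G Q x) :
    Val G Q' x' := by
  obtain ⟨C, hC, h1, h2⟩ := hv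
  obtain ⟨C', h1', h2'⟩ := exists_circ M Q' x'
  exact ⟨C', F.generic.filter.upper C C' (F.K.le_of_bisim (R := R) w hw
    (h.congr h1.symm h1'.symm) h2 h2' hx) hC, h1', h2'⟩

theorem Forcing.val_iff_of_bisim (F : M.Forcing n r I G) {Q Q' : S} {R : N → N → Prop}
    [hR : Fm M true (fun e _ => R (e 0) (e 1))] (w : N) (hw : ∀ x x', R x x' → x < w ∧ x' < w)
    (h : M.IsBisim n (M.bits Q) (M.bits Q') R) {x x' : N} (hx : R x x') :
    Val G Q x ↔ Val G Q' x' := by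
  have hR' : Fm M true (fun e _ => R (e 1) (e 0)) := hR.subst₂ _ _
  exact ⟨F.val_of_bisim (R := R) w hw h hx,
    F.val_of_bisim (R := fun x x' => R x' x) w (fun x x' h => (hw x' x h).symm) h.symm hx⟩

theorem fm_exists_circ {P : S → S → Prop}
    (h : Fm M false (fun _ s => ∃ C C' : M.Circ, C.1 = s 0 ∧ C'.1 = s 1 ∧ P C.1 C'.1)) (Q : S)
    (Γ : N → Prop) (hΓ : Fm M true (fun e _ => Γ (e 0))) :
    Fm M false (fun _ s => ∃ x, Γ x ∧ ∃ Z' : S, ∃ Z : S, Z = s 0 ∧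
      M.SameGates (M.bits Z') (M.bits Q) ∧ M.IsOut (M.bits Z') x ∧
      ∃ C C' : M.Circ, C.1 = Z ∧ C'.1 = Z' ∧ P C.1 C'.1) := by
  have hΓ : Fm M false (fun e _ => Γ (e 0)) := hΓ.of_true
  have (X X' : (ℕ → S) → S) [Ss X] [Ss X'] :
      Fm M false (fun _ s => M.SameGates (M.bits (X s)) (M.bits (X' s))) := by
    refine Fm.congr (P := fun _ s => (∀ x, M.IsAnd (M.bits (X s)) x ↔ M.IsAnd (M.bits (X' s)) x) ∧
      (∀ x, M.IsNeg (M.bits (X s)) x ↔ M.IsNeg (M.bits (X' s)) x) ∧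
      (∀ y x, M.Edge (M.bits (X s)) y x ↔ M.Edge (M.bits (X' s)) y x)) inferInstance
      fun _ s => ?_
    exact ⟨fun h => ⟨h.1, h.2.1, h.2.2⟩, fun h => ⟨h.1, h.2, h.3⟩⟩
  infer_instance

theorem isDefinable_of_fm {r : M.Circ → M.Circ → Prop} {D : Set M.Circ} {P : S → Prop}
    (h : Fm M false (fun _ s => P (s 0))) (hP : ∀ C : M.Circ, C ∈ D ↔ P C.1)
    (hD : ∀ C C', r C C' → r C' C → C ∈ D → C' ∈ D) : M.IsDefinable r D := by
  obtain ⟨φ, -, p, q, h⟩ := h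
  refine ⟨hD, φ, mix (fun _ => M.zero) p, mix (fun _ => Classical.arbitrary S) q, 0, fun C => ?_⟩
  have key (Z : S) : P Z ↔ M.Realize φ (mix (fun _ => M.zero) p)
      (Function.update (mix (fun _ => Classical.arbitrary S) q) 0 Z) := by
    refine (h (fun _ => M.zero) (fun i => if i = 0 then Z else Classical.arbitrary S)).symm.trans ?_
    apply iff_of_eq
    congr 1
    funext i
    obtain ⟨k, rfl | rfl⟩ := Nat.even_or_odd' i
    · rcases k with _ | k <;> simp [mix]
    · rw [Function.update_of_ne (by omega), mix_odd, mix_odd]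
  exact (hP C).trans (key C.1)

/-- The circuits below some (Q, x) with `Γ x` form a definable set D, and it suffices that D is
dense over I. Below a counterexample C ∉ I every member of D is in I, in particular all meets C ∧
(Q, i) with `Γ i`. By completeness the join B of all the meets is in I. But the disjunction of the
(Q, i) is provable by `hv`, so C ≤ B, contradicting C ∉ I. This is the point where genericity and
completeness of the ideal are used. -/
theorem Forcing.exists_val (F : M.Forcing n r I G) (Q : S) (a : N) (Γ : N → Prop)
    [hΓ : Fm M true (fun e _ => Γ (e 0))] (ha : ∀ x, Γ x → x < a)
    (hv : ∀ Z Z' : S, ∃ c P, 2 < c ∧ M.row P 0 = M.bits Z ∧ M.row P 1 = M.bits Z' ∧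
      M.row P 2 = M.bits Q ∧ F.K.Pr c P {fun b k x => b = true ∧ k = 2 ∧ Γ x}) :
    ∃ x, Γ x ∧ Val G Q x := by
  obtain ⟨D, hD⟩ : ∃ D : Set M.Circ, D = {C | ∃ x, Γ x ∧ ∃ C' : M.Circ,
    M.SameGates C'.code (M.bits Q) ∧ M.IsOut C'.code x ∧ r C C'} := ⟨_, rfl⟩
  suffices h : ∃ C ∈ D, C ∈ G by
    obtain ⟨C, hCD, hCG⟩ := h
    rw [hD] at hCD
    obtain ⟨x, hx, C', h1, h2, h3⟩ := hCD
    exact ⟨x, hx, C', F.generic.filter.upper C C' h3 hCG, h1, h2⟩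
  have hdef : M.IsDefinable r D := by
    obtain ⟨P, hP⟩ : ∃ P : S → S → Prop,
        P = fun Z Z' => ∃ C C' : M.Circ, C.1 = Z ∧ C'.1 = Z' ∧ r C C' := ⟨_, rfl⟩
    have hPr (C C' : M.Circ) : P C.1 C'.1 ↔ r C C' := by
      rw [hP]
      constructor
      · rintro ⟨C₁, C₁', h, h', hr⟩
        obtain rfl := Subtype.ext h
        obtain rfl := Subtype.ext h'
        exact hr
      · exact fun h => ⟨C, C', rfl, rfl, h⟩
    have hfm := fm_exists_circ (M := M) (P := P) (F.K.def_.congr fun _ s => by simp only [hPr])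
      Q Γ hΓ
    refine isDefinable_of_fm (P := fun Z₀ => ∃ x, Γ x ∧ ∃ Z' : S, ∃ Z : S, Z = Z₀ ∧
      M.SameGates (M.bits Z') (M.bits Q) ∧ M.IsOut (M.bits Z') x ∧
      ∃ C C' : M.Circ, C.1 = Z ∧ C'.1 = Z' ∧ P C.1 C'.1) hfm (fun C => ?_) ?_
    · rw [hD]
      constructor
      · rintro ⟨x, hx, C', h1, h2, h3⟩
        exact ⟨x, hx, C'.1, C.1, rfl, h1, h2, C, C', rfl, rfl, (hPr C C').2 h3⟩
      · rintro ⟨x, hx, _, _, rfl, h1, h2, C₁, C', h, rfl, h3⟩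
        obtain rfl := Subtype.ext h
        exact ⟨x, hx, C', h1, h2, (hPr _ C').1 h3⟩
    · rw [hD]
      rintro C C₁ - h ⟨x, hx, C', h1, h2, h3⟩
      exact ⟨x, hx, C', h1, h2, F.K.trans h h3⟩
  suffices hdense : M.IsDense r I D by
    obtain ⟨C, h1, -, h2⟩ := F.generic.meets D hdef hdense
    exact ⟨C, h1, h2⟩
  intro C hCI
  by_contra hcon
  push Not at hcon
  obtain ⟨o, ho, -⟩ := C.2
  obtain ⟨X, w, m, how, haw, hnm, hmb, hX⟩ := exists_meets M n a C.1 Q o Γ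
  obtain ⟨B, hB⟩ := exists_bigOr M n a X
  -- If `Γ i`, the meet is below C and belongs to D, hence is in I by the choice of C. Otherwise it
  -- is 0.
  have hmem (i : N) (hi : i < a) (Ci : M.Circ) (hCi : Ci.code = M.row X i) : Ci ∈ I := by
    obtain ⟨h1, h2, h3, h4, h5, h6⟩ := hX i hi
    have hout : M.IsOut Ci.code m := by rw [hCi, h5]
    by_cases hΓi : Γ i
    · have hle (j : N) (hj : j ≤ 1) (Z : S) (y : N) (hy : y < w) (C' : M.Circ)
          (hC' : M.SameGates C'.code (M.bits Z)) (hC'o : M.IsOut C'.code y)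
          (hb : M.IsBisim n (M.bits Z) (M.row X i) (Copy₂ n w j))
          (he : ∀ u, Copy₂ n w j y u → M.Edge (M.row X i) u m) : r Ci C' := by
        obtain ⟨P, hP0, hP1, -⟩ := exists_six_rows M Ci.1 C'.1 Z Z Z Z Z Z
        replace hP0 : M.row P 0 = M.row X i := hP0.trans hCi
        replace hP1 : M.row P 1 = C'.code := hP1
        obtain ⟨u, hu⟩ : ∃ u, Copy₂ n w j y u := by
          rcases lt_or_ge y n with h | h
          · exact ⟨y, hy, Or.inl ⟨h, rfl⟩⟩
          · exact ⟨_, hy, Or.inr ⟨h, rfl⟩⟩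
        have e1 := F.K.imp_of_edge_and (c := 2) (P := P) (k := 0) (x := m) (y := u) two_pos hnm
          (by rw [hP0, h3]; exact hΓi) (by rw [hP0]; exact h4) (by rw [hP0]; exact he u hu)
        have e2 := F.K.imp_of_bisim (c := 2) (P := P) (k := 0) (k' := 1) two_pos one_lt_two
          (R := fun x x' => Copy₂ n w j x' x) (w + m)
          (fun x x' h => ⟨(hmb j hj x' x h).trans_le le_add_self, h.1.trans_le le_self_add⟩)
          (by rw [hP0, hP1]; exact (hb.congr hC'.symm (.refl _)).symm) hu
        exact F.K.concl (c := 2) one_lt_two (by rw [hP0, hCi]; exact .refl _)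
          (by rw [hP1]; exact .refl _) hout hC'o (F.K.imp_trans two_pos one_lt_two e1 e2)
      obtain ⟨C', hC', hC'o⟩ := exists_circ M Q i
      by_contra hI
      refine hcon Ci ?_ hI ?_
      · rw [hD]
        exact ⟨i, hΓi, C', hC', hC'o, hle 1 le_rfl Q i (hi.trans_le haw) C' hC' hC'o h2
          fun u hu => (h6 u).2 ⟨hΓi, Or.inr hu⟩⟩
      · exact hle 0 zero_le C.1 o how C (.refl _) ho h1 fun u hu => (h6 u).2 ⟨hΓi, Or.inl hu⟩
    · refine F.ideal.zero_mem Ci fun C' => ?_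
      obtain ⟨o', ho', -⟩ := C'.2
      obtain ⟨P, hP0, hP1, -⟩ := exists_six_rows M Ci.1 C'.1 Q Q Q Q Q Q
      replace hP0 : M.row P 0 = M.row X i := hP0.trans hCi
      replace hP1 : M.row P 1 = C'.code := hP1
      refine F.K.concl (c := 2) one_lt_two (by rw [hP0, hCi]; exact .refl _)
        (by rw [hP1]; exact .refl _) hout ho' (F.K.mono (F.K.axSet 2 P (m + 1)) ?_)
      rintro _ rfl
      refine ⟨_, Or.inr (Or.inr ⟨0, two_pos, m, (lt_add_one M _ _).2 le_rfl, hnm, rfl⟩), ?_⟩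
      intro β κ ξ h
      rw [rightSeq_iff (s := false) (a := false) (by simp [hP0, h3, h4, hΓi])
        (by simp [hP0, h3, hΓi])] at h
      obtain ⟨rfl, ⟨-, h⟩ | ⟨rfl, rfl⟩⟩ := h
      · rw [hP0, h6] at h
        exact absurd h.1 hΓi
      · exact Or.inl ⟨rfl, rfl, rfl⟩
  have hBI : B ∈ I := by
    refine F.complete a X (fun i hi => ?_) (fun i hi => hmem i ((lt_iff _ _).1 hi)) B hB
    obtain ⟨-, -, -, -, h5, -⟩ := hX i ((lt_iff _ _).1 hi)
    exact ⟨m, (h5 m).2 rfl, fun y hy => (h5 y).1 hy⟩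
  -- It remains to prove C ≤ B in the calculus.
  refine hCI (F.ideal.lower C B ?_ hBI)
  obtain ⟨O, hO, hnO, hOA, hON, hOE⟩ := hB.1
  rw [hM.le_iff] at hnO
  simp only [lt_iff] at hOE
  obtain ⟨c, P, hc, hP0, hP1, hP2, hP⟩ := hv C.1 B.1
  replace hP0 : M.row P 0 = C.code := hP0
  replace hP1 : M.row P 1 = B.code := hP1
  have hc1 : 1 < c := one_lt_two.trans hc
  have hc0 : 0 < c := zero_lt_one.trans hc1
  -- A gate of C or of `Q` implies each of its copies inside the meets inside B. The bisimulations
  -- for the different i are merged into one, so that nonstandardly many copies are treated at once.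
  have hbis (j : N) (hj : j ≤ 1) (k : N) (hk : k < c)
      (h : ∀ i < a, M.IsBisim n (M.row P k) (M.row X i) (Copy₂ n w j)) :
      F.K.Pr c P {Γ | ∃ i, i < a ∧ ∃ y z u, Copy₂ n w j y z ∧ M.CopyGate n i z u ∧
        Γ = cl2 false k y true 1 u} := by
    have hb := F.K.bisim (c := c) (P := P) (k := k) (k' := 1) hk hc1
      (R := fun y u => ∃ i, i < a ∧ ∃ z, z < m + 1 ∧ Copy₂ n w j y z ∧ M.CopyGate n i z u)
      (w + (n + M.pair a (m + 1)))
      (by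
        rintro y u ⟨i, hi, z, hz, h, h'⟩
        refine ⟨h.1.trans_le le_self_add, lt_of_lt_of_le ?_ le_add_self⟩
        rcases copyGate_iff.1 h' with ⟨h, rfl⟩ | ⟨-, rfl⟩
        · exact h.trans_le le_self_add
        · gcongr; exact pair_lt_pair hi hz)
      (by
        refine IsBisim.iUnion fun i hi => ?_
        have := (h i hi).comp (hB.isBisim hi (((hX i hi).2.2.2.2.1 m).2 rfl))
        rw [hP1]
        convert this using 1
        funext y u
        apply propext
        refine exists_congr fun z => ?_
        rw [lt_add_one M]
        tauto)
    refine F.K.mono hb ?_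
    rintro _ ⟨i, hi, y, z, u, h1, h2, rfl⟩
    exact ⟨_, ⟨y, u, false, ⟨i, hi, z, (hmb j hj y z h1).trans_le le_self_add, h1, h2⟩, rfl⟩, le_rfl⟩
  have e0 := hbis 0 zero_le 0 hc0 fun i hi => by rw [hP0]; exact (hX i hi).1
  have e1 := hbis 1 le_rfl 2 hc fun i hi => by rw [hP2]; exact (hX i hi).2.1
  refine F.K.concl (c := c) (o := o) (o' := O) hc1 (by rw [hP0]; exact .refl _)
    (by rw [hP1]; exact .refl _) ho hO (F.K.mono (F.K.der (F.K.union (F.K.union e0 e1)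
      (F.K.union hP (F.K.axSet c P (O + 1)))) (o + O + 1) 2 (cl2 false 0 o true 1 O) ?_ ?_)
        fun Δ hΔ => ⟨Δ, Or.inr hΔ, le_rfl⟩)
  · rintro _ _ _ (⟨-, rfl, rfl⟩ | ⟨-, rfl, rfl⟩)
    · exact ⟨hc0, (lt_add_one M _ _).2 le_self_add⟩
    · exact ⟨hc1, (lt_add_one M _ _).2 le_add_self⟩
  -- Cases on the gate x ∈ Γ that is true. Given that o is true as well, both predecessors of the
  -- copy of the x-th meet are true, so this copy is true, and it is a disjunct of the output of B.
  · refine ⟨_, Or.inr (Or.inl rfl), ?_⟩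
    rintro _ _ x ⟨rfl, rfl, hx⟩
    right
    obtain ⟨h1, h2, h3, h4, h5, h6⟩ := hX x (ha x hx)
    have hg : M.CopyGate n x m (n + M.pair x m) := copyGate_iff.2 (Or.inr ⟨hnm, rfl⟩)
    have hgO : M.Edge B.code (n + M.pair x m) O := (hOE _).2 ⟨x, m, ha x hx, (h5 m).2 rfl, hg⟩
    have hgA := hB.2 x m ((lt_iff _ _).2 (ha x hx)) ((h5 m).2 rfl) m _ ((hM.le_iff _ _).2 hnm)
      ((hM.le_iff _ _).2 le_rfl) hg
    have hgO' : n + M.pair x m < O + 1 := (edge_lt hgO).trans ((lt_add_one M _ _).2 le_rfl)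
    refine ⟨_, Or.inr (Or.inr (Or.inr (Or.inr ⟨1, hc1, n + M.pair x m, hgO', le_self_add, rfl⟩))),
      fun β κ ξ h => ?_⟩
    rw [rightSeq_iff (s := true) (a := true) (by simp [hP1, hgA.1, hgA.2.1, h3, h4, hx])
      (by simp [hP1, hgA.1, h3, hx]), hP1, hgA.2.2] at h
    obtain ⟨rfl, ⟨rfl, y, hy, hξ⟩ | ⟨rfl, rfl⟩⟩ := h
    · right
      obtain ⟨-, hy | hy⟩ := (h6 y).1 hy
      · refine ⟨_, Or.inl (Or.inl ⟨x, ha x hx, o, y, ξ, hy, hξ, rfl⟩), ?_⟩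
        rintro _ _ _ (⟨rfl, rfl, rfl⟩ | ⟨rfl, rfl, rfl⟩)
        · exact Or.inl (Or.inl (Or.inl ⟨rfl, rfl, rfl⟩))
        · exact Or.inr ⟨rfl, rfl, rfl⟩
      · refine ⟨_, Or.inl (Or.inr ⟨x, ha x hx, x, y, ξ, hy, hξ, rfl⟩), ?_⟩
        rintro _ _ _ (⟨rfl, rfl, rfl⟩ | ⟨rfl, rfl, rfl⟩)
        · exact Or.inl (Or.inr ⟨rfl, rfl, rfl⟩)
        · exact Or.inr ⟨rfl, rfl, rfl⟩
    · right
      refine ⟨_, Or.inr (Or.inr (Or.inr (Or.inl ⟨1, hc1, O, (lt_add_one M _ _).2 le_rfl,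
        n + M.pair x m, hnO, by rw [hP1]; exact hgO, rfl⟩))), fun β κ ξ h => ?_⟩
      rw [leftSeq_iff (s := false) (a := false) (by simp [hP1, hOA, hON]) (by simp [hP1, hOA])] at h
      obtain ⟨rfl, ⟨rfl, rfl⟩ | ⟨rfl, rfl⟩⟩ := h
      · exact Or.inl (Or.inl (Or.inr ⟨rfl, rfl, rfl⟩))
      · exact Or.inr ⟨rfl, rfl, rfl⟩

end Forcing

end Model

end TwoSorted

set_option linter.unusedSectionVars false
set_option synthInstance.maxSize 1000
set_option synthInstance.maxHeartbeats 200000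

namespace TwoSorted

namespace Model

variable {N : Type u} {S : Type v} [CommSemiring N] [LinearOrder N] [IsStrictOrderedRing N]
  [CanonicallyOrderedAdd N] [Nonempty S] {M : Model N S} [hM : M.Std]

/-! ### The truth lemma -/

/-- A circuit is extended by new gates. -/
theorem exists_extension (M : Model N S) [hM : M.Std] (Q : S) (c b : N) (A Ng : N → Prop)
    (Ed : N → N → Prop) [hA : Fm M true (fun e _ => A (e 0))] [hN : Fm M true (fun e _ => Ng (e 0))]
    [hE : Fm M true (fun e _ => Ed (e 0) (e 1))] :
    ∃ Q' : S, M.SameBelow c (M.bits Q) (M.bits Q') ∧ ∀ x, c ≤ x → x < b →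
      (M.IsAnd (M.bits Q') x ↔ A x) ∧ (M.IsNeg (M.bits Q') x ↔ Ng x) ∧
      ∀ y, M.Edge (M.bits Q') y x ↔ y < x ∧ Ed y x := by
  have hA := hA.subst₁
  have hN := hN.subst₁
  have hE := hE.subst₂
  obtain ⟨Q', h1, h2, -, h4⟩ := exists_network M (c + b)
    (fun x => (x < c ∧ M.IsAnd (M.bits Q) x) ∨ (c ≤ x ∧ x < b ∧ A x))
    (fun x => (x < c ∧ M.IsNeg (M.bits Q) x) ∨ (c ≤ x ∧ x < b ∧ Ng x)) (fun _ => False)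
    (fun y x => y < x ∧ ((x < c ∧ M.Edge (M.bits Q) y x) ∨ (c ≤ x ∧ x < b ∧ Ed y x)))
    (by
      rintro x (⟨h, -⟩ | ⟨-, h, -⟩)
      exacts [h.trans_le le_self_add, h.trans_le le_add_self])
    (by
      rintro x (⟨h, -⟩ | ⟨-, h, -⟩)
      exacts [h.trans_le le_self_add, h.trans_le le_add_self])
    (fun _ h => h.elim)
    (by
      rintro y x ⟨hy, ⟨h, -⟩ | ⟨-, h, -⟩⟩
      exacts [⟨hy, h.trans_le le_self_add⟩, ⟨hy, h.trans_le le_add_self⟩])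
  refine ⟨Q', ⟨fun x hx => ?_, fun x hx => ?_, fun y x hx => ?_⟩,
    fun x hc hb => ⟨?_, ?_, fun y => ?_⟩⟩
  · rw [h1]; simp [hx, not_le.2 hx]
  · rw [h2]; simp [hx, not_le.2 hx]
  · rw [h4]
    simp only [hx, not_le.2 hx, true_and, false_and, or_false]
    exact ⟨fun h => ⟨edge_lt h, h⟩, fun h => h.2⟩
  · rw [h1]; simp [hc, hb, not_lt.2 hc]
  · rw [h2]; simp [hc, hb, not_lt.2 hc]
  · rw [h4]; simp [hc, hb, not_lt.2 hc]

section Forcing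

variable {n : N} {r : M.Circ → M.Circ → Prop} {I G : Set M.Circ}

theorem Forcing.val_iff_of_sameBelow (F : M.Forcing n r I G) {Q Q' : S} {c : N}
    (h : M.SameBelow c (M.bits Q) (M.bits Q')) {x : N} (hx : x < c) : Val G Q x ↔ Val G Q' x :=
  F.val_iff_of_bisim (R := fun x x' => x' = x ∧ x < c) c (by rintro x _ ⟨rfl, h⟩; exact ⟨h, h⟩)
    (h.isBisim n) ⟨rfl, hx⟩

/-- A circuit computing `0`. -/
theorem Calc.exists_zero (K : M.Calc n r) : ∃ C : M.Circ, ∀ C', r C C' := by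
  obtain ⟨Z, h1, h2, h3, h4⟩ := exists_network M (n + 1) (fun _ => False) (fun _ => False)
    (fun x => x = n) (fun _ _ => False) (fun _ h => h.elim) (fun _ h => h.elim)
    (by rintro _ rfl; exact (lt_add_one M _ _).2 le_rfl) (fun _ _ h => h.elim)
  refine ⟨⟨Z, n, (h3 n).2 rfl, fun y hy => (h3 y).1 hy⟩, fun C' => ?_⟩
  obtain ⟨o', ho', -⟩ := C'.2
  obtain ⟨P, hP0, hP1, -⟩ := exists_six_rows M Z C'.1 Z Z Z Z Z Z
  replace hP1 : M.row P 1 = C'.code := hP1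
  refine K.concl (c := 2) (P := P) (o := n) one_lt_two (by rw [hP0]; exact .refl _)
    (by rw [hP1]; exact .refl _) ((h3 n).2 rfl) ho' (K.mono (K.axSet 2 P (n + 1)) ?_)
  rintro _ rfl
  refine ⟨_, Or.inr (Or.inr ⟨0, two_pos, n, (lt_add_one M _ _).2 le_rfl, le_rfl, rfl⟩), ?_⟩
  intro β κ ξ h
  rw [rightSeq_iff (s := false) (a := false) (by simp [hP0, h1, h2]) (by simp [hP0, h1])] at h
  obtain ⟨rfl, ⟨-, h⟩ | ⟨rfl, rfl⟩⟩ := h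
  · rw [hP0, h4] at h; exact h.elim
  · exact Or.inl ⟨rfl, rfl, rfl⟩

/-- A circuit below both the gate y and its negation z is below 0. So if both were in G, closure of
the filter under meets would put 0 into G. -/
theorem Forcing.not_val_of_val_neg (F : M.Forcing n r I G) {Q : S} {y z : N} (hz : n ≤ z)
    (hA : ¬ M.IsAnd (M.bits Q) z) (hN : M.IsNeg (M.bits Q) z) (hE : M.Edge (M.bits Q) y z)
    (h : Val G Q z) : ¬ Val G Q y := by
  rintro ⟨C₁, hC₁, h₁, ho₁⟩
  obtain ⟨C₂, hC₂, h₂, ho₂⟩ := h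
  obtain ⟨C, hC⟩ := F.K.exists_zero
  refine F.generic.filter.zero_notMem C hC (F.generic.filter.inf_mem C₁ C₂ C hC₁ hC₂ (hC _) (hC _)
    fun C' h h' => ?_)
  obtain ⟨o, ho, -⟩ := C.2
  obtain ⟨o', ho', -⟩ := C'.2
  obtain ⟨P, p0, p1, p2, p3, p4, p5, hP⟩ := F.K.hyps2 h h' ho' ho₁ ho' ho₂ C'.1 C.1
  replace p0 : M.row P 0 = C'.code := p0
  replace p1 : M.row P 1 = C.code := p1
  have l0 : (0 : N) < 6 := by norm_num
  have l1 : (1 : N) < 6 := by norm_num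
  have l2 : (2 : N) < 6 := by norm_num
  have l3 : (3 : N) < 6 := by norm_num
  have l4 : (4 : N) < 6 := by norm_num
  have l5 : (5 : N) < 6 := by norm_num
  have h35 : M.SameGates (M.row P 3) (M.row P 5) := by rw [p3, p5]; exact h₁.trans h₂.symm
  have e1 := F.K.imp_trans l0 l3 (F.K.imp_of_sameGates l0 l2 (by rw [p0, p2]; exact .refl _) o')
    (F.K.mono hP (ℱ' := {cl2 false 2 o' true 3 y})
      (by rintro _ rfl; exact ⟨_, Or.inl rfl, le_rfl⟩))
  have e2 := F.K.imp_trans l0 l5 (F.K.imp_of_sameGates l0 l4 (by rw [p0, p4]; exact .refl _) o')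
    (F.K.mono hP (ℱ' := {cl2 false 4 o' true 5 z})
      (by rintro _ rfl; exact ⟨_, Or.inr rfl, le_rfl⟩))
  have e3 := F.K.imp_trans l0 l5 e1 (F.K.imp_of_sameGates l3 l5 h35 y)
  refine F.K.concl l1 (by rw [p0]; exact .refl _) (by rw [p1]; exact .refl _) ho' ho
    (F.K.mono (F.K.der (F.K.union (F.K.union e2 e3) (F.K.axSet 6 P (z + 1))) (o' + o + 1) 2
      (cl2 false 0 o' true 1 o) ?_ ?_) fun Δ hΔ => ⟨Δ, Or.inr hΔ, le_rfl⟩)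
  · rintro _ _ _ (⟨-, rfl, rfl⟩ | ⟨-, rfl, rfl⟩)
    · exact ⟨l0, (lt_add_one M _ _).2 le_self_add⟩
    · exact ⟨l1, (lt_add_one M _ _).2 le_add_self⟩
  · have g5 : M.SameGates (M.row P 5) (M.bits Q) := by rw [p5]; exact h₂
    refine ⟨_, Or.inr (Or.inr (Or.inl ⟨5, l5, z, (lt_add_one M _ _).2 le_rfl, y, hz,
      (g5.edge _ _).2 hE, rfl⟩)), fun β κ ξ hβ => Or.inr ?_⟩
    rw [leftSeq_iff (s := true) (a := false) (by simp [g5.isAnd, g5.isNeg, hA, hN])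
      (by simp [g5.isAnd, hA])] at hβ
    obtain ⟨rfl, ⟨rfl, rfl⟩ | ⟨rfl, rfl⟩⟩ := hβ
    · refine Der.of_le (d := 0) (by omega) ⟨_, Or.inl (Or.inl rfl), ?_⟩
      rintro _ _ _ (⟨rfl, rfl, rfl⟩ | ⟨rfl, rfl, rfl⟩)
      · exact Or.inl (Or.inl ⟨rfl, rfl, rfl⟩)
      · exact Or.inr ⟨rfl, rfl, rfl⟩
    · refine Der.of_le (d := 0) (by omega) ⟨_, Or.inl (Or.inr rfl), ?_⟩
      rintro _ _ _ (⟨rfl, rfl, rfl⟩ | ⟨rfl, rfl, rfl⟩)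
      · exact Or.inl (Or.inl ⟨rfl, rfl, rfl⟩)
      · exact Or.inr ⟨rfl, rfl, rfl⟩

/-- The sequent `Γ` about the gates of `Q` is provable, also in the presence of other circuits. -/
def Calc.Valid (K : M.Calc n r) (Q : S) (Γ : Bool → N → Prop) : Prop :=
  -- The free rows 0, 1, 2 receive the two circuits compared in `Forcing.exists_val` and an
  -- extension of `Q`.
  ∀ Z Z' Z'' : S, ∃ c P, 3 < c ∧ M.row P 0 = M.bits Z ∧ M.row P 1 = M.bits Z' ∧
    M.row P 2 = M.bits Z'' ∧ M.row P 3 = M.bits Q ∧ K.Pr c P {fun b k x => k = 3 ∧ Γ b x}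

/-- `Forcing.exists_val` handles disjunctions of gates. A negative literal of y is turned into a
gate by adding to `Q` the negation c + y of y, and `Forcing.not_val_of_val_neg` translates back. -/
theorem Forcing.exists_true (F : M.Forcing n r I G) (Q : S) (a : N) (Γ : Bool → N → Prop)
    [hΓ : ∀ b, Fm M true (fun e _ => Γ b (e 0))] (ha : ∀ b x, Γ b x → x < a)
    (hv : F.K.Valid Q Γ) : ∃ b x, Γ b x ∧ (b = true ↔ Val G Q x) := by
  have hΓ (b : Bool) := (hΓ b).subst₁
  obtain ⟨c, hc⟩ : ∃ c, c = n + a := ⟨_, rfl⟩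
  have hnc : n ≤ c := hc ▸ le_self_add
  have hac : a ≤ c := hc ▸ le_add_self
  replace ha (b x) (h : Γ b x) : x < c := (ha b x h).trans_le hac
  obtain ⟨Q', hQ, hQ'⟩ := exists_extension M Q c (c + c) (fun _ => False) (fun _ => True)
    (fun y x => x = c + y)
  have hneg {x : N} (hx : x < c) : ¬ M.IsAnd (M.bits Q') (c + x) ∧ M.IsNeg (M.bits Q') (c + x) ∧
      ∀ y, M.Edge (M.bits Q') y (c + x) ↔ y = x := by
    obtain ⟨h1, h2, h3⟩ := hQ' (c + x) le_self_add (by gcongr)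
    refine ⟨fun h => h1.1 h, h2.2 trivial, fun y => ?_⟩
    rw [h3, add_right_inj]
    exact ⟨fun h => h.2.symm, by rintro rfl; exact ⟨hx.trans_le le_self_add, rfl⟩⟩
  obtain ⟨x, hx, hvx⟩ := F.exists_val Q' (c + c)
    (fun x => Γ true x ∨ ∃ y, y < c ∧ x = c + y ∧ Γ false y) (by
      rintro x (h | ⟨y, hy, rfl, -⟩)
      · exact (ha _ _ h).trans_le le_self_add
      · gcongr) (by
      intro Z Z'
      obtain ⟨c', P, h3, p0, p1, p2, p3, hP⟩ := hv Z Z' Q'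
      have h2 : 2 < c' := by refine lt_trans ?_ h3; norm_num
      refine ⟨c', P, h2, p0, p1, p2, ?_⟩
      have e1 := F.K.bisim (P := P) h3 h2 (R := fun x x' => x' = x ∧ x < c) c
        (by rintro x _ ⟨rfl, h⟩; exact ⟨h, h⟩) (by rw [p2, p3]; exact hQ.isBisim n)
      refine F.K.mono (F.K.der (F.K.union (F.K.union hP e1) (F.K.axSet c' P (c + c))) (c + c) 2
        (fun b k x => b = true ∧ k = 2 ∧ (Γ true x ∨ ∃ y, y < c ∧ x = c + y ∧ Γ false y)) ?_ ?_)
        fun Δ hΔ => ⟨Δ, Or.inr hΔ, le_rfl⟩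
      · rintro b k x ⟨-, rfl, h | ⟨y, hy, rfl, -⟩⟩
        · exact ⟨h2, (ha _ _ h).trans_le le_self_add⟩
        · exact ⟨h2, by gcongr⟩
      · refine ⟨_, Or.inl (Or.inl rfl), ?_⟩
        rintro b _ x ⟨rfl, hb⟩
        right
        have hxc := ha b x hb
        cases b
        · obtain ⟨q1, q2, q3⟩ := hneg hxc
          refine ⟨_, Or.inr (Or.inr (Or.inr ⟨2, h2, c + x, by gcongr, hnc.trans le_self_add, rfl⟩)),
            fun β κ ξ h => ?_⟩
          rw [rightSeq_iff (s := true) (a := false) (by simp [p2, q1, q2])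
            (by simp [p2, q1]), p2, q3] at h
          obtain ⟨rfl, ⟨rfl, rfl⟩ | ⟨rfl, rfl⟩⟩ := h
          · refine Or.inr ⟨_, Or.inl (Or.inr ⟨ξ, ξ, true, ⟨rfl, hxc⟩, rfl⟩), ?_⟩
            rintro _ _ _ (⟨rfl, rfl, rfl⟩ | ⟨rfl, rfl, rfl⟩)
            · exact Or.inl (Or.inr ⟨rfl, rfl, rfl⟩)
            · exact Or.inr ⟨rfl, rfl, rfl⟩
          · exact Or.inl (Or.inl ⟨rfl, rfl, Or.inr ⟨x, hxc, rfl, hb⟩⟩)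
        · refine Der.of_le (d := 0) (by omega)
            ⟨_, Or.inl (Or.inr ⟨x, x, false, ⟨rfl, hxc⟩, rfl⟩), ?_⟩
          rintro _ _ _ (⟨rfl, rfl, rfl⟩ | ⟨rfl, rfl, rfl⟩)
          · exact Or.inr ⟨rfl, rfl, rfl⟩
          · exact Or.inl ⟨rfl, rfl, Or.inl hb⟩)
  rcases hx with hx | ⟨y, hy, rfl, hy'⟩
  · exact ⟨true, x, hx, iff_of_true rfl ((F.val_iff_of_sameBelow hQ (ha _ _ hx)).2 hvx)⟩
  · obtain ⟨q1, q2, q3⟩ := hneg hy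
    refine ⟨false, y, hy', iff_of_false (by simp) ?_⟩
    rw [F.val_iff_of_sameBelow hQ hy]
    exact F.not_val_of_val_neg (hnc.trans le_self_add) q1 q2 ((q3 y).2 rfl) hvx

theorem Calc.valid_of_axSet (K : M.Calc n r) (Q : S) (w : N) {Γ : Bool → N → Prop}
    (h : ∀ P, M.row P 3 = M.bits Q →
      ∃ Δ ∈ M.AxSet n (M.row P) 4 w, Δ ≤ fun b k x => k = 3 ∧ Γ b x) : K.Valid Q Γ := by
  intro Z Z' Z''
  obtain ⟨P, p0, p1, p2, p3, -⟩ := exists_six_rows M Z Z' Z'' Q Z Z Z Z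
  exact ⟨4, P, by norm_num, p0, p1, p2, p3, K.mono (K.axSet 4 P w) (by rintro _ rfl; exact h P p3)⟩

/-- The values of the gates with respect to `G` are computed by the circuit. -/
theorem Forcing.val_iff_gateVal (F : M.Forcing n r I G) (Q : S) {x : N} (hx : n ≤ x) :
    Val G Q x ↔ M.GateVal (M.bits Q) {y | Val G Q y} x := by
  have l3 : (3 : N) < 4 := by norm_num
  have hxx : x < x + 1 := (lt_add_one M _ _).2 le_rfl
  -- The gate equation is the truth of the left axioms, one for each predecessor, and of the right
  -- axiom.
  have hl (y : N) (hy : M.Edge (M.bits Q) y x) := F.exists_true Q (x + 1)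
    (fun b ξ => M.leftSeq (M.bits Q) 3 x y b 3 ξ) (by
      rintro b ξ ⟨-, ⟨-, rfl⟩ | ⟨-, rfl⟩⟩
      exacts [hxx, (edge_lt hy).trans hxx])
    (F.K.valid_of_axSet Q (x + 1) fun P hP => ⟨_, Or.inr (Or.inl ⟨3, l3, x, hxx, y, hx,
      by rw [hP]; exact hy, rfl⟩), fun b k ξ h => ⟨h.1, by rw [hP] at h; exact h.1 ▸ h⟩⟩)
  obtain ⟨b, ξ, hr, hr'⟩ := F.exists_true Q (x + 1)
    (fun b ξ => M.rightSeq (M.bits Q) 3 x b 3 ξ) (by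
      rintro b ξ ⟨-, ⟨-, h⟩ | ⟨-, rfl⟩⟩
      exacts [(edge_lt h).trans hxx, hxx])
    (F.K.valid_of_axSet Q (x + 1) fun P hP => ⟨_, Or.inr (Or.inr ⟨3, l3, x, hxx, hx, rfl⟩),
      fun b k ξ h => ⟨h.1, by rw [hP] at h; exact h.1 ▸ h⟩⟩)
  have hl' (y : N) (hy : M.Edge (M.bits Q) y x) :
      (Val G Q x ↔ ¬ (M.IsAnd (M.bits Q) x ↔ ¬ M.IsNeg (M.bits Q) x)) ∨
        (Val G Q y ↔ M.IsAnd (M.bits Q) x) := by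
    obtain ⟨b, ξ, ⟨-, ⟨h, rfl⟩ | ⟨h, rfl⟩⟩, h'⟩ := hl y hy
    · exact Or.inl (h'.symm.trans h)
    · exact Or.inr (h'.symm.trans h)
  have hr'' : (∃ y, M.Edge (M.bits Q) y x ∧ (Val G Q y ↔ ¬ M.IsAnd (M.bits Q) x)) ∨
      (Val G Q x ↔ (M.IsAnd (M.bits Q) x ↔ ¬ M.IsNeg (M.bits Q) x)) := by
    obtain ⟨-, ⟨h, h''⟩ | ⟨h, rfl⟩⟩ := hr
    · exact Or.inl ⟨ξ, h'', hr'.symm.trans h⟩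
    · exact Or.inr (hr'.symm.trans h)
  clear hl hr hr'
  rw [GateVal]
  simp only [Set.mem_ofPred_eq]
  by_cases hA : M.IsAnd (M.bits Q) x <;> by_cases hN : M.IsNeg (M.bits Q) x <;>
    simp only [hA, hN, Xor] at hl' hr'' ⊢ <;> grind

end Forcing

end Model

end TwoSorted

set_option linter.unusedSectionVars false
set_option synthInstance.maxSize 1000
set_option synthInstance.maxHeartbeats 200000

namespace TwoSorted

namespace Model

variable {N : Type u} {S : Type v} [CommSemiring N] [LinearOrder N] [IsStrictOrderedRing N]
  [CanonicallyOrderedAdd N] [Nonempty S] {M : Model N S} [hM : M.Std]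

/-! ### Least numbers -/

theorem two_mul_ne (M : Model N S) [hM : M.Std] (x y : N) : 2 * x ≠ 2 * y + 1 := by
  intro h
  have := (mul_add_inj M (l := x) (l' := y) (W := 2) (j := 0) (j' := 1) two_pos one_lt_two).1
    (by rw [mul_comm, h]; ring)
  exact zero_ne_one this.2

section Forcing

variable {n : N} {r : M.Circ → M.Circ → Prop} {I G : Set M.Circ}

/-- Least numbers exist for the values of definable sequences of gates. -/
theorem Forcing.exists_least_val (F : M.Forcing n r I G) (Q : S) (B a : N) {i₀ : N} (hi₀ : i₀ < a)
    (h : Val G Q (B + i₀)) : ∃ i < a, Val G Q (B + i) ∧ ∀ j < i, ¬ Val G Q (B + j) := by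
  obtain ⟨c, hc⟩ : ∃ c, c = n + (B + a) := ⟨_, rfl⟩
  have hnc : n ≤ c := hc ▸ le_self_add
  have hBc {i : N} (hi : i < a) : B + i < c :=
    lt_of_lt_of_le (by gcongr) (hc ▸ le_add_self : B + a ≤ c)
  have hodd {x y : N} : c + 2 * x ≠ c + 2 * y + 1 := by
    rw [add_assoc, Ne, add_right_inj]; exact two_mul_ne M x y
  have heven {x y : N} : c + 2 * x = c + 2 * y ↔ x = y := by
    rw [add_right_inj, mul_right_inj' two_ne_zero]
  have hodd' {x y : N} : c + 2 * x + 1 = c + 2 * y + 1 ↔ x = y := by rw [add_left_inj, heven]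
  have hb1 {i : N} (hi : i < a) : c + 2 * i + 1 < c + 2 * a := by
    have h := mul_add_lt M (W := 2) hi one_lt_two
    rw [add_assoc, mul_comm 2, mul_comm 2]
    gcongr
  have hb0 {i : N} (hi : i < a) : c + 2 * i < c + 2 * a := by gcongr
  have hge0 {i : N} : c ≤ c + 2 * i := le_self_add
  have hge1 {i : N} : c ≤ c + 2 * i + 1 := by rw [add_assoc]; exact le_self_add
  -- The new gate c + 2i says that all B + j with j < i are false, and c + 2i + 1 is its conjunction
  -- with B + i, so it says that i is the least true index.
  obtain ⟨Q', hQ, hQ'⟩ := exists_extension M Q c (c + 2 * a) (fun x => ∃ i, i < a ∧ x = c + 2 * i + 1)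
    (fun x => ∃ i, i < a ∧ x = c + 2 * i)
    (fun y x => (∃ i, i < a ∧ x = c + 2 * i ∧ ∃ j, j < i ∧ y = B + j) ∨
      (∃ i, i < a ∧ x = c + 2 * i + 1 ∧ (y = B + i ∨ y = c + 2 * i)))
  have hnu {i : N} (hi : i < a) : ¬ M.IsAnd (M.bits Q') (c + 2 * i) ∧
      M.IsNeg (M.bits Q') (c + 2 * i) ∧
      ∀ y, M.Edge (M.bits Q') y (c + 2 * i) ↔ ∃ j, j < i ∧ y = B + j := by
    obtain ⟨h1, h2, h3⟩ := hQ' _ hge0 (hb0 hi)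
    refine ⟨fun h => ?_, h2.2 ⟨i, hi, rfl⟩, fun y => ?_⟩
    · obtain ⟨j, -, h⟩ := h1.1 h
      exact hodd h
    · rw [h3]
      simp only [hodd, heven, false_and, and_false, exists_false, or_false]
      constructor
      · rintro ⟨-, _, -, rfl, h⟩; exact h
      · rintro ⟨j, hj, rfl⟩
        exact ⟨(hBc (hj.trans hi)).trans_le hge0, i, hi, rfl, j, hj, rfl⟩
  have hz {i : N} (hi : i < a) : M.IsAnd (M.bits Q') (c + 2 * i + 1) ∧
      ¬ M.IsNeg (M.bits Q') (c + 2 * i + 1) ∧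
      ∀ y, M.Edge (M.bits Q') y (c + 2 * i + 1) ↔ y = B + i ∨ y = c + 2 * i := by
    obtain ⟨h1, h2, h3⟩ := hQ' _ hge1 (hb1 hi)
    refine ⟨h1.2 ⟨i, hi, rfl⟩, fun h => ?_, fun y => ?_⟩
    · obtain ⟨j, -, h⟩ := h2.1 h
      exact hodd h.symm
    · rw [h3]
      simp only [hodd.symm, hodd', false_and, and_false, exists_false, false_or]
      constructor
      · rintro ⟨-, _, -, rfl, h⟩; exact h
      · rintro (rfl | rfl)
        · exact ⟨(hBc hi).trans_le hge1, i, hi, rfl, Or.inl rfl⟩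
        · exact ⟨(lt_add_one M _ _).2 le_rfl, i, hi, rfl, Or.inr rfl⟩
  -- The sequent says: if B + i₀ is true, then some j < a is the least true index. Since B + i₀ has
  -- value 1, its truth in G selects such a j.
  obtain ⟨b, x, hx, hbx⟩ := F.exists_true Q' (c + 2 * a)
    (fun b x => (b = false ∧ x = B + i₀) ∨ (b = true ∧ ∃ j, j < a ∧ x = c + 2 * j + 1)) (by
      rintro b x (⟨-, rfl⟩ | ⟨-, j, hj, rfl⟩)
      exacts [(hBc hi₀).trans_le le_self_add, hb1 hj]) (by
      intro Z Z' Z''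
      obtain ⟨P, p0, p1, p2, p3, -⟩ := exists_six_rows M Z Z' Z'' Q' Z Z Z Z
      have l3 : (3 : N) < 4 := by norm_num
      -- Proved by induction on i inside the calculus: if B + i is true, then either i is least or
      -- some B + j with j < i is true, where the sequent for j applies.
      refine ⟨4, P, l3, p0, p1, p2, p3, F.K.mono (F.K.ind (F.K.axSet 4 P (c + 2 * a)) a (c + 2 * a) 2
        (fun i b k x => k = 3 ∧ ((b = false ∧ x = B + i) ∨
          (b = true ∧ ∃ j, j < a ∧ x = c + 2 * j + 1))) (fun _ => True) ?_ ?_) ?_⟩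
      · rintro i hi - b k x ⟨rfl, ⟨-, rfl⟩ | ⟨-, j, hj, rfl⟩⟩
        exacts [⟨l3, (hBc hi).trans_le le_self_add⟩, ⟨l3, hb1 hj⟩]
      · intro i hi _
        obtain ⟨q1, q2, q3⟩ := hz hi
        obtain ⟨q1', q2', q3'⟩ := hnu hi
        refine ⟨_, Or.inl (Or.inr (Or.inr ⟨3, l3, _, hb1 hi, hnc.trans hge1, rfl⟩)), fun β κ ξ h => ?_⟩
        rw [rightSeq_iff (s := true) (a := true) (by simp [p3, q1, q2]) (by simp [p3, q1]), p3,
          q3] at h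
        obtain ⟨rfl, ⟨rfl, rfl | rfl⟩ | ⟨rfl, rfl⟩⟩ := h
        · exact Or.inl ⟨rfl, Or.inl ⟨rfl, rfl⟩⟩
        · refine Or.inr ⟨_, Or.inl (Or.inr (Or.inr ⟨3, l3, _, hb0 hi, hnc.trans hge0, rfl⟩)),
            fun β κ ξ h => ?_⟩
          rw [rightSeq_iff (s := true) (a := false) (by simp [p3, q1', q2']) (by simp [p3, q1']), p3,
            q3'] at h
          obtain ⟨rfl, ⟨rfl, j, hj, rfl⟩ | ⟨rfl, rfl⟩⟩ := h
          · refine Or.inr ⟨_, Or.inr ⟨j, hj, trivial, rfl⟩, ?_⟩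
            rintro _ _ _ ⟨rfl, ⟨rfl, rfl⟩ | h⟩
            · exact Or.inr ⟨rfl, rfl, rfl⟩
            · exact Or.inl (Or.inl ⟨rfl, Or.inr h⟩)
          · exact Or.inl (Or.inr ⟨rfl, rfl, rfl⟩)
        · exact Or.inl ⟨rfl, Or.inr ⟨rfl, i, hi, rfl⟩⟩
      · rintro _ rfl
        exact ⟨_, Or.inr ⟨i₀, hi₀, trivial, rfl⟩, le_rfl⟩)
  have hval {i : N} (hi : i < a) : Val G Q (B + i) ↔ Val G Q' (B + i) :=
    F.val_iff_of_sameBelow hQ (hBc hi)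
  rcases hx with ⟨rfl, rfl⟩ | ⟨rfl, j, hj, rfl⟩
  · exact absurd (hbx.2 ((hval hi₀).1 h)) (by simp)
  · have h1 := hbx.1 rfl
    obtain ⟨q1, q2, q3⟩ := hz hj
    obtain ⟨q1', q2', q3'⟩ := hnu hj
    rw [F.val_iff_gateVal Q' (hnc.trans hge1), GateVal] at h1
    simp only [q1, q2, q3, Xor, true_and, not_true, false_and, or_false, not_false_eq_true, and_true,
      false_or, forall_eq_or_imp, forall_eq, Set.mem_ofPred_eq] at h1
    obtain ⟨h1, h2⟩ := h1
    rw [F.val_iff_gateVal Q' (hnc.trans hge0), GateVal] at h2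
    simp only [q1', q2', q3', Xor, true_and, false_and, not_false_eq_true, not_true, and_false,
      or_false, false_or, Set.mem_ofPred_eq] at h2
    exact ⟨j, hj, (hval hj).2 h1, fun i hi hv => h2 ⟨_, ⟨i, hi, rfl⟩, (hval (hi.trans hj)).1 hv⟩⟩

end Forcing

end Model

end TwoSorted

set_option linter.unusedSectionVars false
set_option synthInstance.maxSize 1000
set_option synthInstance.maxHeartbeats 200000

namespace TwoSorted

namespace Model

variable {N : Type u} {S : Type v} [CommSemiring N] [LinearOrder N] [IsStrictOrderedRing N]
  [CanonicallyOrderedAdd N] [Nonempty S] {M : Model N S} [hM : M.Std]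

/-! ### The strings of the generic model -/

/-- `T` is a string of the generic model. -/
def IsGen (M : Model N S) (G : Set M.Circ) (T : Set N) : Prop :=
  ∃ (a : N) (X : S), M.IsBString a X ∧ T = M.iG G a X

section Forcing

variable {n : N} {r : M.Circ → M.Circ → Prop} {I G : Set M.Circ}

/-- The i-th circuit of the Boolean-valued string consists of the gates of `Q` with output f(i). -/
theorem Forcing.isGen_val (F : M.Forcing n r I G) (Q : S) (a w : N) (f : N → N)
    [hf : Fm M true (fun e _ => e 0 = f (e 1))] (hw : ∀ i < a, f i < w) :
    M.IsGen G {i | i < a ∧ Val G Q (f i)} := by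
  have hf := Fm.subst₂ (P := fun y x => y = f x) hf
  obtain ⟨X, hX⟩ := exists_system M a (M.len Q + w) (fun i x => i < a ∧ M.IsAnd (M.bits Q) x)
    (fun i x => i < a ∧ M.IsNeg (M.bits Q) x) (fun i x => i < a ∧ x = f i)
    (fun i y x => i < a ∧ M.Edge (M.bits Q) y x)
    (fun i x h => ⟨h.1, (isAnd_lt_len' h.2).trans_le le_self_add⟩)
    (fun i x h => ⟨h.1, (isNeg_lt_len' h.2).trans_le le_self_add⟩)
    (by rintro i _ ⟨h, rfl⟩; exact ⟨h, (hw i h).trans_le le_add_self⟩)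
    (fun i y x h => ⟨h.1, edge_lt h.2, (edge_lt_len' h.2).trans_le le_self_add⟩)
  have hout {i : N} (hi : i < a) (x : N) : M.IsOut (M.row X i) x ↔ x = f i := by
    rw [(hX i).2.2.1]; exact and_iff_right hi
  have hcirc {i : N} (hi : i < a) : M.IsCircuit (M.row X i) :=
    ⟨f i, (hout hi _).2 rfl, fun y hy => (hout hi y).1 hy⟩
  refine ⟨a, X, fun i hi => hcirc ((lt_iff _ _).1 hi), ?_⟩
  ext i
  change i < a ∧ _ ↔ M.lt i a ∧ _
  rw [lt_iff]
  refine and_congr_right fun hi => ?_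
  have hsame : M.SameGates (M.row X i) (M.bits Q) := by
    obtain ⟨h1, h2, -, h4⟩ := hX i
    exact ⟨fun x => (h1 x).trans (and_iff_right hi), fun x => (h2 x).trans (and_iff_right hi),
      fun y x => (h4 y x).trans (and_iff_right hi)⟩
  have key (C : M.Circ) (hC : C.code = M.row X i) : C ∈ G ↔ Val G Q (f i) :=
    F.mem_iff_val (hC ▸ hsame) (by rw [hC]; exact (hout hi _).2 rfl)
  constructor
  · intro h
    obtain ⟨Z, hZ⟩ := exists_bits_eq_row M X i
    have hC : M.IsCircuit (M.bits Z) := hZ ▸ hcirc hi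
    exact ⟨⟨Z, hC⟩, (key ⟨Z, hC⟩ hZ).2 h, hZ⟩
  · rintro ⟨C, hCG, hC⟩
    exact (key C hC).1 hCG

/-- The circuit for the join of the X(i) already contains copies of all of them. A gate c + i is
added whose only predecessor is the copy of the output of X(i); for i ≥ a it has no predecessor and
is false, as it should be. -/
theorem Forcing.exists_val_of_isGen (F : M.Forcing n r I G) {T : Set N} (hT : M.IsGen G T) (m : N) :
    ∃ Q B, ∀ i < m, i ∈ T ↔ Val G Q (B + i) := by
  obtain ⟨a, X, hX, rfl⟩ := hT
  obtain ⟨C, hC⟩ := exists_bigOr M n a X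
  obtain ⟨c, hc⟩ : ∃ c, c = n + M.pair a (M.len X) := ⟨_, rfl⟩
  obtain ⟨Q, hQ, hQ'⟩ := exists_extension M C.1 c (c + m) (fun _ => False) (fun _ => False)
    (fun y x => ∃ i, i < m ∧ x = c + i ∧ i < a ∧ ∃ w, w < M.len X ∧ M.IsOut (M.row X i) w ∧
      M.CopyGate n i w y)
  refine ⟨Q, c, fun i hi => ?_⟩
  obtain ⟨h1, h2, h3⟩ := hQ' (c + i) le_self_add (by gcongr)
  rw [F.val_iff_gateVal Q (by rw [hc, add_assoc]; exact le_self_add), GateVal]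
  simp only [h1, h2, h3, Xor, false_and, not_false_eq_true, true_and, false_or, and_true,
    add_right_inj, Set.mem_ofPred_eq]
  change M.lt i a ∧ _ ↔ _
  rw [lt_iff]
  have hcopy {w : N} (hi : i < a) (hw : M.IsOut (M.row X i) w) :
      ∃ u, M.CopyGate n i w u ∧ u < c := by
    rcases lt_or_ge w n with h | h
    · exact ⟨w, copyGate_iff.2 (Or.inl ⟨h, rfl⟩), hc ▸ h.trans_le le_self_add⟩
    · refine ⟨_, copyGate_iff.2 (Or.inr ⟨h, rfl⟩), ?_⟩
      rw [hc]; gcongr; exact pair_lt_pair hi (isOut_lt_len hw)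
  have key {w u : N} (hi : i < a) (hw : M.IsOut (M.row X i) w) (hu : M.CopyGate n i w u)
      (huc : u < c) : Val G Q u ↔ ∃ C' ∈ G, C'.code = M.row X i := by
    obtain ⟨Z, hZ⟩ := exists_bits_eq_row M X i
    have hb := hC.isBisim hi hw
    rw [← hZ] at hb
    rw [← F.val_iff_of_sameBelow hQ huc, ← F.val_iff_of_bisim (Q := Z)
      (R := fun x x' => x ≤ w ∧ M.CopyGate n i x x') (M.len X + c) (by
        rintro x x' ⟨hx, h⟩
        have hx' := hx.trans_lt (isOut_lt_len hw)
        refine ⟨hx'.trans_le le_self_add, lt_of_lt_of_le ?_ le_add_self⟩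
        rcases copyGate_iff.1 h with ⟨h, rfl⟩ | ⟨-, rfl⟩
        · exact hc ▸ h.trans_le le_self_add
        · rw [hc]; gcongr; exact pair_lt_pair hi hx') hb ⟨le_rfl, hu⟩]
    constructor
    · intro h
      have hZC : M.IsCircuit (M.bits Z) := hZ ▸ hX i ((lt_iff _ _).2 hi)
      have hsame : M.SameGates (Circ.code ⟨Z, hZC⟩) (M.bits Z) := SameGates.refl _
      have hout : M.IsOut (Circ.code ⟨Z, hZC⟩) w := by change M.IsOut (M.bits Z) w; rwa [hZ]
      exact ⟨⟨Z, hZC⟩, (F.mem_iff_val hsame hout).2 h, hZ⟩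
    · rintro ⟨C', hC'G, hC'⟩
      exact (F.mem_iff_val (by rw [hC', hZ]; exact .refl _) (by rwa [hC'])).1 hC'G
  constructor
  · rintro ⟨hia, h⟩
    obtain ⟨w, hw, -⟩ := hX i ((lt_iff _ _).2 hia)
    obtain ⟨u, hu, huc⟩ := hcopy hia hw
    exact ⟨u, ⟨huc.trans_le le_self_add, i, hi, rfl, hia, w, isOut_lt_len hw, hw, hu⟩,
      (key hia hw hu huc).2 h⟩
  · rintro ⟨u, ⟨-, _, -, rfl, hia, w, -, hw, hu⟩, hv⟩
    obtain ⟨u', hu', huc⟩ := hcopy hia hw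
    have huu : u = u' := by
      rcases copyGate_iff.1 hu with ⟨h, rfl⟩ | ⟨h, rfl⟩ <;>
        rcases copyGate_iff.1 hu' with ⟨h', rfl⟩ | ⟨h', rfl⟩
      · rfl
      · exact absurd h (not_lt.2 h')
      · exact absurd h' (not_lt.2 h)
      · rfl
    subst huu
    exact ⟨hia, (key hia hw hu huc).1 hv⟩

/-- One layer of negated disjunctions, wired by a ground relation. The other closure properties
needed for comprehension reduce to this one. -/
theorem Forcing.isGen_nor (F : M.Forcing n r I G) {T : Set N} (hT : M.IsGen G T) (a b : N)
    (D : N → N → Prop) [hD : Fm M true (fun e _ => D (e 0) (e 1))] :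
    M.IsGen G {i | i < a ∧ ¬ ∃ j < b, D i j ∧ j ∈ T} := by
  have hD := hD.subst₂
  obtain ⟨Q, B, hQ⟩ := F.exists_val_of_isGen hT b
  obtain ⟨c, hc⟩ : ∃ c, c = n + (B + b) := ⟨_, rfl⟩
  obtain ⟨Q', hQ', hQ''⟩ := exists_extension M Q c (c + a) (fun _ => False) (fun _ => True)
    (fun y x => ∃ i, i < a ∧ x = c + i ∧ ∃ j, j < b ∧ D i j ∧ y = B + j)
  have h := F.isGen_val Q' a (c + a) (fun i => c + i) (fun i hi => by gcongr)
  convert h using 1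
  ext i
  refine and_congr_right fun hi => ?_
  obtain ⟨h1, h2, h3⟩ := hQ'' (c + i) le_self_add (by gcongr)
  rw [F.val_iff_gateVal Q' (by rw [hc, add_assoc]; exact le_self_add), GateVal]
  simp only [h1, h2, h3, Xor, false_and, not_false_eq_true, true_and, false_or, not_true, and_false,
    or_false, add_right_inj, Set.mem_ofPred_eq]
  have hlt {j : N} (hj : j < b) : B + j < c := lt_of_lt_of_le (by gcongr) (hc ▸ le_add_self)
  refine not_congr ⟨?_, ?_⟩
  · rintro ⟨j, hj, h4, h5⟩
    exact ⟨B + j, ⟨(hlt hj).trans_le le_self_add, i, hi, rfl, j, hj, h4, rfl⟩,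
      (F.val_iff_of_sameBelow hQ' (hlt hj)).1 ((hQ j hj).1 h5)⟩
  · rintro ⟨_, ⟨-, _, -, rfl, j, hj, h4, rfl⟩, h5⟩
    exact ⟨j, hj, h4, (hQ j hj).2 ((F.val_iff_of_sameBelow hQ' (hlt hj)).2 h5)⟩

theorem IsGen.exists_bound {T : Set N} (hT : M.IsGen G T) : ∃ a, ∀ i ∈ T, i < a := by
  obtain ⟨a, X, -, rfl⟩ := hT
  exact ⟨a, fun i hi => (lt_iff _ _).1 hi.1⟩

theorem Forcing.isGen_compl (F : M.Forcing n r I G) {T : Set N} (hT : M.IsGen G T) (a : N) :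
    M.IsGen G {i | i < a ∧ i ∉ T} := by
  convert F.isGen_nor hT a a (fun i j => j = i) using 1
  ext i
  refine and_congr_right fun hi => not_congr ⟨fun h => ⟨i, hi, rfl, h⟩, ?_⟩
  rintro ⟨_, -, rfl, h⟩; exact h

theorem Forcing.isGen_exists (F : M.Forcing n r I G) {T : Set N} (hT : M.IsGen G T) (a b : N)
    (D : N → N → Prop) [hD : Fm M true (fun e _ => D (e 0) (e 1))] :
    M.IsGen G {i | i < a ∧ ∃ j < b, D i j ∧ j ∈ T} := by
  convert F.isGen_compl (F.isGen_nor hT a b D) a using 1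
  ext i
  refine and_congr_right fun hi => ⟨fun h h' => h'.2 h, fun h => ?_⟩
  by_contra h'
  exact h ⟨hi, h'⟩

theorem Forcing.isGen_ground (F : M.Forcing n r I G) (a : N) (P : N → Prop)
    [hP : Fm M true (fun e _ => P (e 0))] : M.IsGen G {i | i < a ∧ P i} := by
  have hP := hP.subst₁
  have h0 : M.IsGen G {i | i < 0 ∧ Val G (Classical.arbitrary S) i} :=
    F.isGen_val _ 0 0 (fun i => i) (fun i hi => absurd hi (not_lt.2 zero_le))
  -- The complement of the empty set below 1 is {0}, and 0 is joined to i exactly if `P i`.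
  convert F.isGen_exists (F.isGen_compl h0 1) a 1 (fun i _ => P i) using 1
  ext i
  refine and_congr_right fun hi => ⟨fun h => ⟨0, one_pos, h, one_pos, ?_⟩, ?_⟩
  · exact fun h => not_lt_of_ge zero_le h.1
  · rintro ⟨_, -, h, -⟩; exact h

theorem IsGen.exists_join {T T' : Set N} (hT : M.IsGen G T) (hT' : M.IsGen G T') :
    ∃ U a, M.IsGen G U ∧ (∀ i ∈ T, i < a) ∧ (∀ i < a, i ∈ U ↔ i ∈ T) ∧ ∀ i, a + i ∈ U ↔ i ∈ T' := by
  obtain ⟨a, X, hX, rfl⟩ := hT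
  obtain ⟨a', X', hX', rfl⟩ := hT'
  obtain ⟨Y, hY⟩ := exists_rows M (a + a') (M.len X + M.len X')
    (fun i => {x | (i < a ∧ x ∈ M.row X i) ∨ ∃ k, k < a' ∧ i = a + k ∧ x ∈ M.row X' k})
    (h := by simp only [Set.mem_ofPred_eq]; infer_instance) (by
      rintro i x (⟨h, h'⟩ | ⟨k, hk, rfl, h⟩)
      · exact ⟨h.trans_le le_self_add, (right_lt_len h').trans_le le_self_add⟩
      · exact ⟨by gcongr, (right_lt_len h).trans_le le_add_self⟩)
  have h1 {i : N} (hi : i < a) : M.row Y i = M.row X i := by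
    rw [hY]
    ext x
    constructor
    · rintro (h | ⟨k, -, rfl, -⟩)
      · exact h.2
      · exact absurd hi (not_lt.2 le_self_add)
    · exact fun h => Or.inl ⟨hi, h⟩
  have h2 {i : N} (hi : i < a') : M.row Y (a + i) = M.row X' i := by
    rw [hY]
    ext x
    constructor
    · rintro (⟨h, -⟩ | ⟨k, -, h, h'⟩)
      · exact absurd h (not_lt.2 le_self_add)
      · rwa [add_left_cancel h]
    · exact fun h => Or.inr ⟨i, hi, rfl, h⟩
  refine ⟨_, a, ⟨a + a', Y, fun i hi => ?_, rfl⟩, fun i hi => (lt_iff _ _).1 hi.1, fun i hi => ?_,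
    fun i => ?_⟩
  · rw [lt_iff] at hi
    rcases lt_or_exists_add i a with h | ⟨k, rfl⟩
    · rw [h1 h]; exact hX i ((lt_iff _ _).2 h)
    · have hk := lt_of_add_lt_add_left hi
      rw [h2 hk]; exact hX' k ((lt_iff _ _).2 hk)
  · change M.lt _ _ ∧ _ ↔ M.lt _ _ ∧ _
    rw [lt_iff, lt_iff, h1 hi]
    simp only [hi, hi.trans_le (le_self_add : a ≤ a + a')]
  · change M.lt _ _ ∧ _ ↔ M.lt _ _ ∧ _
    rw [lt_iff, lt_iff, add_lt_add_iff_left]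
    exact and_congr_right fun hi => by rw [h2 hi]

theorem Forcing.isGen_join (F : M.Forcing n r I G) {T T' : Set N} (hT : M.IsGen G T)
    (hT' : M.IsGen G T') (m m' : N) :
    M.IsGen G {i | (i < m ∧ i ∈ T) ∨ ∃ k < m', i = m + k ∧ k ∈ T'} := by
  obtain ⟨U, a, hU, ha, h1, h2⟩ := hT.exists_join hT'
  convert F.isGen_exists hU (m + m') (a + m')
    (fun i j => (i < m ∧ j < a ∧ j = i) ∨ ∃ k, k < m' ∧ i = m + k ∧ j = a + k) using 1
  ext i
  constructor
  · rintro (⟨hi, h⟩ | ⟨k, hk, rfl, h⟩)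
    · exact ⟨hi.trans_le le_self_add, i, (ha i h).trans_le le_self_add, Or.inl ⟨hi, ha i h, rfl⟩,
        (h1 i (ha i h)).2 h⟩
    · exact ⟨by gcongr, a + k, by gcongr, Or.inr ⟨k, hk, rfl, rfl⟩, (h2 k).2 h⟩
  · rintro ⟨-, _, -, ⟨hi, hj, rfl⟩ | ⟨k, hk, rfl, rfl⟩, h⟩
    · exact Or.inl ⟨hi, (h1 _ hj).1 h⟩
    · exact Or.inr ⟨k, hk, rfl, (h2 k).1 h⟩

/-- De Morgan: i is in both sets if neither i nor a + i is in the concatenation of the complements.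
-/
theorem Forcing.isGen_inter (F : M.Forcing n r I G) {T T' : Set N} (hT : M.IsGen G T)
    (hT' : M.IsGen G T') : M.IsGen G (T ∩ T') := by
  obtain ⟨a, ha⟩ := hT.exists_bound
  have h := F.isGen_join (F.isGen_compl hT a) (F.isGen_compl hT' a) a a
  convert F.isGen_nor h a (a + a) (fun i j => j = i ∨ j = a + i) using 1
  ext i
  constructor
  · rintro ⟨h1, h2⟩
    refine ⟨ha i h1, ?_⟩
    rintro ⟨_, -, rfl | rfl, ⟨h3, h4⟩ | ⟨k, -, h3, h4⟩⟩
    · exact h4.2 h1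
    · exact absurd (ha _ h1) (not_lt.2 (h3 ▸ le_self_add))
    · exact absurd h3 (not_lt.2 le_self_add)
    · rw [← add_left_cancel h3] at h4; exact h4.2 h2
  · rintro ⟨hi, h⟩
    constructor
    · by_contra h'
      exact h ⟨i, hi.trans_le le_self_add, Or.inl rfl, Or.inl ⟨hi, hi, h'⟩⟩
    · by_contra h'
      exact h ⟨a + i, by gcongr, Or.inr rfl, Or.inr ⟨i, hi, rfl, hi, h'⟩⟩

theorem Forcing.exists_least_of_isGen (F : M.Forcing n r I G) {T : Set N} (hT : M.IsGen G T)
    (hne : T.Nonempty) : ∃ i ∈ T, ∀ j < i, j ∉ T := by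
  obtain ⟨a, ha⟩ := hT.exists_bound
  obtain ⟨Q, B, hQ⟩ := F.exists_val_of_isGen hT a
  obtain ⟨i₀, hi₀⟩ := hne
  obtain ⟨i, hi, h1, h2⟩ := F.exists_least_val Q B a (ha i₀ hi₀) ((hQ i₀ (ha i₀ hi₀)).1 hi₀)
  exact ⟨i, (hQ i hi).2 h1, fun j hj h => h2 j hj ((hQ j (hj.trans hi)).1 h)⟩

end Forcing

end Model

end TwoSorted

set_option linter.unusedSectionVars false
set_option synthInstance.maxSize 1000
set_option synthInstance.maxHeartbeats 200000

namespace TwoSorted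

namespace Model

variable {N : Type u} {S : Type v} [CommSemiring N] [LinearOrder N] [IsStrictOrderedRing N]
  [CanonicallyOrderedAdd N] [Nonempty S] {M : Model N S} [hM : M.Std]

/-! ### Basic axioms in the generic model -/

section Forcing

variable {n : N} {r : M.Circ → M.Circ → Prop} {I G : Set M.Circ}

/-- The strict upper bounds b ≤ a of T form a string of M[G], nonempty because it contains a, so it
has a least element. -/
theorem Forcing.exists_isLength (F : M.Forcing n r I G) {T : Set N} (hT : M.IsGen G T) :
    ∃ b, M.IsLength T b := by
  obtain ⟨a, ha⟩ := hT.exists_bound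
  have h := F.isGen_nor hT (a + 1) a (fun i j => i ≤ j)
  obtain ⟨b, ⟨-, hb⟩, hb'⟩ := F.exists_least_of_isGen h ⟨a, (lt_add_one M _ _).2 le_rfl, by
    rintro ⟨j, hj, h, -⟩; exact absurd hj (not_lt.2 h)⟩
  refine ⟨b, fun y hy => (lt_iff _ _).2 ?_, fun b' h' => (hM.le_iff _ _).2 ?_⟩
  · by_contra hyb
    exact hb ⟨y, ha y hy, not_lt.1 hyb, hy⟩
  · by_contra hbb
    push Not at hbb
    refine hb' b' hbb ⟨?_, ?_⟩
    · by_contra hba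
      push Not at hba
      refine hb' a (((lt_add_one M _ _).2 le_rfl).trans_le (hba.trans hbb.le))
        ⟨(lt_add_one M _ _).2 le_rfl, ?_⟩
      rintro ⟨j, hj, h, -⟩
      exact absurd hj (not_lt.2 h)
    · rintro ⟨j, -, h, hj⟩
      exact absurd ((lt_iff _ _).1 (h' j hj)) (not_lt.2 h)

open Classical in
theorem Forcing.isLength_len (F : M.Forcing n r I G) (T : M.GenericStrings G) :
    M.IsLength T.1 ((M.generic G).len T) := by
  have h : ∃ b, M.IsLength T.1 b := F.exists_isLength T.2
  change M.IsLength T.1 (if h : ∃ b, M.IsLength T.1 b then h.choose else M.zero)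
  rw [dif_pos h]
  exact h.choose_spec

theorem Forcing.basic (F : M.Forcing n r I G) : (M.generic G).Basic where
  b1 := hM.vzero.1.b1
  b2 := hM.vzero.1.b2
  b3 := hM.vzero.1.b3
  b4 := hM.vzero.1.b4
  b5 := hM.vzero.1.b5
  b6 := hM.vzero.1.b6
  b7 := hM.vzero.1.b7
  b8 := hM.vzero.1.b8
  b9 := hM.vzero.1.b9
  b10 := hM.vzero.1.b10
  b11 := hM.vzero.1.b11
  b12 := hM.vzero.1.b12
  l1 T y hy := (F.isLength_len T).1 y hy
  l2 T y hy := by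
    by_contra hyT
    change M.succ y = _ at hy
    change ¬ y ∈ T.1 at hyT
    rw [hM.succ_eq] at hy
    have h := (F.isLength_len T).2 y fun z hz => (lt_iff _ _).2 (lt_of_le_of_ne ?_ ?_)
    · rw [hM.le_iff, ← hy] at h
      exact absurd ((lt_add_one M _ _).2 le_rfl) (not_lt.2 h)
    · rw [← lt_add_one M, hy, ← lt_iff (M := M)]
      exact (F.isLength_len T).1 z hz
    · rintro rfl; exact hyT hz
  se T T' h h' := by
    refine Subtype.ext (Set.ext fun i => ⟨fun hi => ?_, fun hi => ?_⟩)
    · exact (h' i ((F.isLength_len T).1 i hi)).1 hi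
    · exact (h' i (h ▸ (F.isLength_len T').1 i hi)).2 hi

/-! ### Comprehension in the generic model -/

variable (M) in
/-- A bounded definable function. -/
structure DefFun (f : N → N) : Prop where
  fm : Fm M true (fun e _ => e 0 = f (e 1))
  bdd : ∃ w, ∀ i, f i < w

theorem DefFun.const (M : Model N S) [hM : M.Std] (x : N) : M.DefFun (fun _ => x) :=
  ⟨inferInstance, x + 1, fun _ => (lt_add_one M _ _).2 le_rfl⟩

theorem DefFun.map₂ {f g : N → N} (hf : M.DefFun f) (hg : M.DefFun g) (h : N → N → N)
    [hh : Tm M (fun e _ => h (e 0) (e 1))] (hw : ∀ x y x' y', x ≤ x' → y ≤ y' → h x y ≤ h x' y') :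
    M.DefFun (fun i => h (f i) (g i)) := by
  have hf' := Fm.subst₂ (P := fun y x => y = f x) hf.fm
  have hg' := Fm.subst₂ (P := fun y x => y = g x) hg.fm
  obtain ⟨w, hw₁⟩ := hf.bdd
  obtain ⟨w', hw₂⟩ := hg.bdd
  have hh' := Fm.subst₃ (M := M) (b := true) (P := fun z x y => z = h x y)
    (h := by
      have h1 : Fm M true (fun e s => e 0 = h (e 1) (e 2)) := by
        have := hh.lift
        infer_instance
      exact h1)
  refine ⟨?_, h w w' + 1, fun i => (lt_add_one M _ _).2 (hw _ _ _ _ (hw₁ i).le (hw₂ i).le)⟩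
  refine Fm.congr (P := fun e _ => ∃ u, u < w ∧ u = f (e 1) ∧ ∃ v, v < w' ∧ v = g (e 1) ∧
    e 0 = h u v) inferInstance fun e _ => ?_
  constructor
  · rintro ⟨_, -, rfl, _, -, rfl, h⟩; exact h
  · exact fun h => ⟨_, hw₁ _, rfl, _, hw₂ _, rfl, h⟩

/-- The arithmetic of M[G] is that of M, and the lengths of the fixed strings are constants; so
terms define ground functions of the index. -/
theorem DefFun.termVal {ν : N → ℕ → N} (hν : ∀ x, M.DefFun (fun i => ν i x))
    (σ : ℕ → M.GenericStrings G) (t : NumTerm) :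
    M.DefFun (fun i => (M.generic G).termVal (ν i) σ t) := by
  induction t with
  | var x => exact hν x
  | zero => exact DefFun.const M M.zero
  | succ t ih =>
    refine ih.map₂ ih (fun x _ => M.succ x) fun x y x' y' hx _ => ?_
    rw [hM.succ_eq, hM.succ_eq]; gcongr
  | add t t' ih ih' =>
    refine ih.map₂ ih' (fun x y => M.add x y) fun x y x' y' hx hy => ?_
    rw [hM.add_eq, hM.add_eq]; gcongr
  | mul t t' ih ih' =>
    refine ih.map₂ ih' (fun x y => M.mul x y) fun x y x' y' hx hy => ?_
    rw [hM.mul_eq, hM.mul_eq]; gcongr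
  | len X => exact DefFun.const M _

theorem exists_div (M : Model N S) [hM : M.Std] (W : N) (hW : 0 < W) :
    ∃ d m : N → N, ∀ l j, j < W → d (l * W + j) = l ∧ m (l * W + j) = j := by
  choose d m h using exists_mul_add M W hW
  refine ⟨d, m, fun l j hj => ?_⟩
  have := (mul_add_inj M (h _).1 hj).1 (h (l * W + j)).2.symm
  exact this

end Forcing

end Model

end TwoSorted

set_option linter.unusedSectionVars false
set_option synthInstance.maxSize 1000
set_option synthInstance.maxHeartbeats 200000

namespace TwoSorted

namespace Model

variable {N : Type u} {S : Type v} [CommSemiring N] [LinearOrder N] [IsStrictOrderedRing N]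
  [CanonicallyOrderedAdd N] [Nonempty S] {M : Model N S} [hM : M.Std]


section Forcing

variable {n : N} {r : M.Circ → M.Circ → Prop} {I G : Set M.Circ}

/-- An index i = lW + j stands for the pair (l, j). In this way the value of a quantified variable
is absorbed into the index. -/
theorem exists_div_mod (M : Model N S) [hM : M.Std] (W : N) (hW : 0 < W) :
    ∃ ι : N → N × N, (∀ l j, j < W → ι (l * W + j) = (l, j)) ∧ M.DefFun (fun i => (ι i).2) ∧
      ∀ f, M.DefFun f → M.DefFun (fun i => f (ι i).1) := by
  obtain ⟨d, m, h⟩ := exists_div M W hW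
  have hs (i : N) : ∃ l, l < i + 1 ∧ ∃ j, j < W ∧ i = l * W + j := by
    obtain ⟨l, j, hj, hi⟩ := exists_mul_add M W hW i
    refine ⟨l, (lt_add_one M _ _).2 ?_, j, hj, hi⟩
    calc l = l * 1 := (_root_.mul_one l).symm
      _ ≤ l * W := by gcongr; rw [← _root_.zero_add (1 : N), add_one_le M]; exact hW
      _ ≤ i := hi ▸ le_self_add
  refine ⟨fun i => (d i, m i), fun l j hj => Prod.ext (h l j hj).1 (h l j hj).2, ⟨?_, W, fun i => ?_⟩,
    fun f hf => ⟨?_, ?_⟩⟩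
  · refine Fm.congr (P := fun e _ => ∃ l, l < e 1 + 1 ∧ ∃ j, j < W ∧ e 1 = l * W + j ∧ e 0 = j)
      inferInstance fun e _ => ?_
    constructor
    · rintro ⟨l, -, j, hj, h1, h2⟩
      rw [h2, h1]; exact (h l j hj).2.symm
    · intro he
      obtain ⟨l, hl, j, hj, h1⟩ := hs (e 1)
      exact ⟨l, hl, j, hj, h1, by rw [he, h1]; exact (h l j hj).2⟩
  · obtain ⟨l, -, j, hj, rfl⟩ := hs i
    exact (h l j hj).2.trans_lt hj
  · have hf' := Fm.subst₂ (P := fun y x => y = f x) hf.fm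
    refine Fm.congr (P := fun e _ => ∃ l, l < e 1 + 1 ∧ ∃ j, j < W ∧ e 1 = l * W + j ∧ e 0 = f l)
      inferInstance fun e _ => ?_
    constructor
    · rintro ⟨l, -, j, hj, h1, h2⟩
      rw [h2, h1]
      change _ = f (d _)
      rw [(h l j hj).1]
    · intro he
      obtain ⟨l, hl, j, hj, h1⟩ := hs (e 1)
      refine ⟨l, hl, j, hj, h1, ?_⟩
      rw [he, h1]
      change f (d _) = _
      rw [(h l j hj).1]
  · obtain ⟨w, hw⟩ := hf.bdd
    exact ⟨w, fun i => hw _⟩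

theorem DefFun.exists_update {ν : N → ℕ → N} (hν : ∀ x, M.DefFun (fun i => ν i x)) (x : ℕ) {W : N}
    (hW : 0 < W) : ∃ (ν' : N → ℕ → N), (∀ y, M.DefFun (fun i => ν' i y)) ∧
      ∀ l j, j < W → ν' (l * W + j) = Function.update (ν l) x j := by
  obtain ⟨ι, h1, h2, h3⟩ := exists_div_mod M W hW
  refine ⟨fun i => Function.update (ν (ι i).1) x (ι i).2, fun y => ?_, fun l j hj => ?_⟩
  · rcases eq_or_ne y x with rfl | h
    · simpa only [Function.update_self] using h2
    · simpa only [Function.update_of_ne h] using h3 _ (hν y)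
  · dsimp only; rw [h1 l j hj]

/-- A whole family of assignments, indexed by i < a, is considered so that the induction passes
through quantifiers. If w exceeds the values of the bounding term, the matrix is treated with index
iw + k, where k is the value of the bound variable, and closure under bounded quantifiers projects
back to i. -/
theorem Forcing.isGen_realize (F : M.Forcing n r I G) (σ : ℕ → M.GenericStrings G) {φ : Fml}
    (hφ : φ.IsSigmaZeroB) (a : N) {ν : N → ℕ → N} (hν : ∀ x, M.DefFun (fun i => ν i x)) :
    M.IsGen G {i | i < a ∧ (M.generic G).Realize φ (ν i) σ} := by
  induction φ generalizing a ν with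
  | eq t t' =>
    have hT (t : NumTerm) := DefFun.termVal hν σ t
    have h := Fm.subst₂ (P := fun y x => y = (M.generic G).termVal (ν x) σ t) (hT t).fm
    have h' := Fm.subst₂ (P := fun y x => y = (M.generic G).termVal (ν x) σ t') (hT t').fm
    obtain ⟨w, hw⟩ := (hT t).bdd
    refine F.isGen_ground a _ (hP := ?_)
    refine Fm.congr (P := fun e _ => ∃ u, u < w ∧ u = (M.generic G).termVal (ν (e 0)) σ t ∧
      u = (M.generic G).termVal (ν (e 0)) σ t') inferInstance fun e _ => ?_
    constructor
    · rintro ⟨_, -, rfl, h⟩; exact h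
    · exact fun h => ⟨_, hw _, rfl, h⟩
  | le t t' =>
    have hT (t : NumTerm) := DefFun.termVal hν σ t
    have h := Fm.subst₂ (P := fun y x => y = (M.generic G).termVal (ν x) σ t) (hT t).fm
    have h' := Fm.subst₂ (P := fun y x => y = (M.generic G).termVal (ν x) σ t') (hT t').fm
    obtain ⟨w, hw⟩ := (hT t).bdd
    obtain ⟨w', hw'⟩ := (hT t').bdd
    refine F.isGen_ground a _ (hP := ?_)
    refine Fm.congr (P := fun e _ => ∃ u, u < w ∧ u = (M.generic G).termVal (ν (e 0)) σ t ∧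
      ∃ v, v < w' ∧ v = (M.generic G).termVal (ν (e 0)) σ t' ∧ M.le u v) inferInstance fun e _ => ?_
    constructor
    · rintro ⟨_, -, rfl, _, -, rfl, h⟩; exact h
    · exact fun h => ⟨_, hw _, rfl, _, hw' _, rfl, h⟩
  | mem t X =>
    have hT (t : NumTerm) := DefFun.termVal hν σ t
    have h := Fm.subst₂ (P := fun y x => y = (M.generic G).termVal (ν x) σ t) (hT t).fm
    obtain ⟨w, hw⟩ := (hT t).bdd
    convert F.isGen_exists (σ X).2 a w (fun i j => j = (M.generic G).termVal (ν i) σ t) using 1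
    ext i
    refine and_congr_right fun _ => ⟨fun h => ⟨_, hw i, rfl, h⟩, ?_⟩
    rintro ⟨_, -, rfl, h⟩; exact h
  -- The strings do not vary with the index, so this is a constant condition.
  | strEq X Y => exact F.isGen_ground a (fun _ => σ X = σ Y)
  | neg φ ih =>
    convert F.isGen_compl (ih hφ a hν) a using 1
    ext i
    exact and_congr_right fun hi => ⟨fun h h' => h h'.2, fun h h' => h ⟨hi, h'⟩⟩
  | and φ ψ ih ih' =>
    convert F.isGen_inter (ih hφ.1 a hν) (ih' hφ.2 a hν) using 1
    ext i
    exact ⟨fun h => ⟨⟨h.1, h.2.1⟩, h.1, h.2.2⟩, fun h => ⟨h.1.1, h.1.2, h.2.2⟩⟩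
  | or φ ψ ih ih' =>
    convert F.isGen_compl (F.isGen_inter (F.isGen_compl (ih hφ.1 a hν) a)
      (F.isGen_compl (ih' hφ.2 a hν) a)) a using 1
    ext i
    refine and_congr_right fun hi => ⟨fun h h' => ?_, fun h => ?_⟩
    · rcases h with h | h
      · exact h'.1.2 ⟨hi, h⟩
      · exact h'.2.2 ⟨hi, h⟩
    · by_contra h'
      exact h ⟨⟨hi, fun hh => h' (Or.inl hh.2)⟩, hi, fun hh => h' (Or.inr hh.2)⟩
  | ballNum x t φ ih =>
    have hT (t : NumTerm) := DefFun.termVal hν σ t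
    have h := Fm.subst₂ (P := fun y x => y = (M.generic G).termVal (ν x) σ t) (hT t).fm
    obtain ⟨w, hw⟩ := (hT t).bdd
    obtain ⟨ν', hν', hW⟩ := DefFun.exists_update hν x (zero_le.trans_lt (hw 0))
    -- A universal quantifier is the NOR of the failures.
    have h1 := F.isGen_compl (ih hφ (a * w) hν') (a * w)
    convert F.isGen_nor h1 a (a * w) (fun i j => ∃ k, k < w ∧ j = i * w + k ∧
      ∃ u, u < w ∧ u = (M.generic G).termVal (ν i) σ t ∧ k < u) using 1
    ext i
    refine and_congr_right fun hi => ⟨?_, fun h m hm => ?_⟩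
    · rintro h ⟨_, hj, ⟨k, hk, rfl, _, -, rfl, hkt⟩, h2⟩
      refine h2.2 ⟨hj, ?_⟩
      rw [hW _ _ hk]
      exact h k ((lt_iff (M := M) _ _).2 hkt)
    · have hm' : m < _ := (lt_iff (M := M) _ _).1 hm
      by_contra hc
      refine h ⟨i * w + m, mul_add_lt M hi (hm'.trans (hw i)),
        ⟨m, hm'.trans (hw i), rfl, _, hw i, rfl, hm'⟩,
        mul_add_lt M hi (hm'.trans (hw i)), fun h3 => hc ?_⟩
      rw [← hW _ _ (hm'.trans (hw i))]; exact h3.2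
  | bexNum x t φ ih =>
    have hT (t : NumTerm) := DefFun.termVal hν σ t
    have h := Fm.subst₂ (P := fun y x => y = (M.generic G).termVal (ν x) σ t) (hT t).fm
    obtain ⟨w, hw⟩ := (hT t).bdd
    obtain ⟨ν', hν', hW⟩ := DefFun.exists_update hν x (zero_le.trans_lt (hw 0))
    have h1 := ih hφ (a * w) hν'
    convert F.isGen_exists h1 a (a * w) (fun i j => ∃ k, k < w ∧ j = i * w + k ∧
      ∃ u, u < w ∧ u = (M.generic G).termVal (ν i) σ t ∧ k < u) using 1
    ext i
    refine and_congr_right fun hi => ⟨?_, ?_⟩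
    · rintro ⟨m, hm, h2⟩
      have hm' : m < _ := (lt_iff (M := M) _ _).1 hm
      refine ⟨i * w + m, mul_add_lt M hi (hm'.trans (hw i)),
        ⟨m, hm'.trans (hw i), rfl, _, hw i, rfl, hm'⟩,
        mul_add_lt M hi (hm'.trans (hw i)), ?_⟩
      rw [hW _ _ (hm'.trans (hw i))]; exact h2
    · rintro ⟨_, hj, ⟨k, hk, rfl, _, -, rfl, hkt⟩, h2⟩
      refine ⟨k, (lt_iff (M := M) _ _).2 hkt, ?_⟩
      rw [← hW _ _ hk]; exact h2.2
  | allNum _ _ => exact hφ.elim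
  | exNum _ _ => exact hφ.elim
  | allStr _ _ => exact hφ.elim
  | exStr _ _ => exact hφ.elim

theorem Forcing.comp (F : M.Forcing n r I G) : (M.generic G).Comp := by
  classical
  intro φ hφ ν σ z a
  -- The identity, cut off at a in order to be bounded.
  have hd : M.DefFun (fun i => if i < a then i else 0) := by
    refine ⟨?_, a + 1, fun i => ?_⟩
    · refine Fm.congr (P := fun e _ => (e 1 < a ∧ e 0 = e 1) ∨ (¬ e 1 < a ∧ e 0 = 0)) inferInstance
        fun e _ => ?_
      split_ifs with h <;> simp only [h, true_and, false_and, not_true, not_false_eq_true, or_false,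
        false_or]
    · rw [lt_add_one M]
      split_ifs with h
      · exact h.le
      · exact zero_le
  have h := F.isGen_realize σ hφ a (ν := fun i => Function.update ν z (if i < a then i else 0))
    fun x => by
      rcases eq_or_ne x z with rfl | h
      · simpa only [Function.update_self] using hd
      · simpa only [Function.update_of_ne h] using DefFun.const M _
  refine ⟨⟨_, h⟩, (F.isLength_len ⟨_, h⟩).2 a fun y hy => (lt_iff _ _).2 hy.1, fun m hm => ?_⟩
  have hm' : m < a := (lt_iff (M := M) _ _).1 hm
  change m < a ∧ _ ↔ _
  rw [if_pos hm', and_iff_right hm']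

end Forcing

end Model

end TwoSorted

set_option linter.unusedSectionVars false
set_option synthInstance.maxSize 1000
set_option synthInstance.maxHeartbeats 200000

namespace TwoSorted

namespace Model

variable {N : Type u} {S : Type v} [CommSemiring N] [LinearOrder N] [IsStrictOrderedRing N]
  [CanonicallyOrderedAdd N] [Nonempty S] {M : Model N S} [hM : M.Std]


/-! ### Monotone circuit values in the generic model -/

section Forcing

variable {n : N} {r : M.Circ → M.Circ → Prop} {I G : Set M.Circ}

theorem Forcing.val_and (F : M.Forcing n r I G) {Q : S} {x : N} (hx : n ≤ x)
    (hA : M.IsAnd (M.bits Q) x) (hN : ¬ M.IsNeg (M.bits Q) x) :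
    Val G Q x ↔ ∀ y, M.Edge (M.bits Q) y x → Val G Q y := by
  rw [F.val_iff_gateVal Q hx, GateVal]
  simp only [hA, hN, Xor, false_and, not_false_eq_true, true_and, false_or, not_true, and_true,
    or_false, Set.mem_ofPred_eq]

theorem Forcing.val_or (F : M.Forcing n r I G) {Q : S} {x : N} (hx : n ≤ x)
    (hA : ¬ M.IsAnd (M.bits Q) x) (hN : ¬ M.IsNeg (M.bits Q) x) :
    Val G Q x ↔ ∃ y, M.Edge (M.bits Q) y x ∧ Val G Q y := by
  rw [F.val_iff_gateVal Q hx, GateVal]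
  simp only [hA, hN, Xor, false_and, not_false_eq_true, true_and, false_or, and_true,
    Set.mem_ofPred_eq]

theorem Forcing.exists_literals (F : M.Forcing n r I G) {T : Set N} (hT : M.IsGen G T) (m : N) :
    ∃ Q B B', ∀ i < m, (Val G Q (B + i) ↔ i ∈ T) ∧ (Val G Q (B' + i) ↔ i ∉ T) := by
  obtain ⟨Q, B, h⟩ := F.exists_val_of_isGen (F.isGen_join hT (F.isGen_compl hT m) m m) (m + m)
  refine ⟨Q, B, B + m, fun i hi => ⟨?_, ?_⟩⟩
  · rw [← h i (hi.trans_le le_self_add)]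
    constructor
    · rintro (h | ⟨k, -, rfl, -⟩)
      · exact h.2
      · exact absurd hi (not_lt.2 le_self_add)
    · exact fun h => Or.inl ⟨hi, h⟩
  · rw [add_assoc, ← h (m + i) (by gcongr)]
    constructor
    · rintro (⟨h, -⟩ | ⟨k, -, h, h'⟩)
      · exact absurd h (not_lt.2 le_self_add)
      · rw [add_left_cancel h]; exact h'.2
    · exact fun h => Or.inr ⟨i, hi, rfl, hi, h⟩

/-- The place of the gate of kind `κ < 4` with index `y < W` in the `x`-th block. -/
def layer (c W κ x y : N) : N := c + ((x * 4 + κ) * W + y)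

instance Tm.layer {c W κ : N} {t t' : (ℕ → N) → (ℕ → S) → N} [Tm M t] [Tm M t'] :
    Tm M (fun e s => layer c W κ (t e s) (t' e s)) := by
  unfold Model.layer; infer_instance

theorem layer_inj (M : Model N S) [hM : M.Std] {c W κ x y κ' x' y' : N} (hκ : κ < 4) (hκ' : κ' < 4)
    (hy : y < W) (hy' : y' < W) (h : layer c W κ x y = layer c W κ' x' y') :
    κ = κ' ∧ x = x' ∧ y = y' := by
  obtain ⟨h1, h2⟩ := (mul_add_inj M hy hy').1 (add_left_cancel h)
  obtain ⟨h3, h4⟩ := (mul_add_inj M hκ hκ').1 h1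
  exact ⟨h4, h3, h2⟩

/-- Gates are ordered by block x and then by kind, so all edges of the network go upwards: kinds 0
and 1 read kind 3 of earlier blocks, kind 2 reads kind 0, and kind 3 reads kinds 1 and 2 of its own
block. -/
theorem layer_lt (M : Model N S) [hM : M.Std] {c W κ x y κ' x' y' : N} (hκ : κ < 4) (hy : y < W)
    (h : x < x' ∨ x = x' ∧ κ < κ') : layer c W κ x y < layer c W κ' x' y' := by
  have : (x * 4 + κ) * W + y < (x' * 4 + κ') * W := by
    refine mul_add_lt M ?_ hy
    rcases h with h | ⟨rfl, h⟩
    · exact (mul_add_lt M h hκ).trans_le le_self_add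
    · gcongr
  rw [layer, layer]
  exact (add_lt_add_iff_left c).2 (this.trans_le le_self_add)

variable (M) in
/-- The edges of the network computing the values of the circuit `C`, `E` with `W` gates. The
literals of `C` and `E` are the gates `B + x`, `B' + x`, `B + (W + ⟨y, x⟩)` and `B' + (W + ⟨y, x⟩)`. -/
def MCVEdge (c W B B' u z : N) : Prop :=
  ∃ x, x < W ∧
    ((∃ y, y < x ∧ z = layer c W 0 x y ∧ (u = B' + (W + M.pair y x) ∨ u = layer c W 3 y 0)) ∨
    (∃ y, y < x ∧ z = layer c W 1 x y ∧
      (u = B + (W + M.pair y x) ∨ u = B' + x ∨ u = layer c W 3 y 0)) ∨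
    (z = layer c W 2 x 0 ∧ (u = B + x ∨ ∃ y, y < x ∧ u = layer c W 0 x y)) ∨
    (z = layer c W 3 x 0 ∧ 2 ≤ x ∧ (u = layer c W 2 x 0 ∨ ∃ y, y < x ∧ u = layer c W 1 x y)))

instance Fm.mcvEdge {c W B B' : N} {t t' : (ℕ → N) → (ℕ → S) → N} [h : Tm M t] [h' : Tm M t'] :
    Fm M true (fun e s => M.MCVEdge c W B B' (t e s) (t' e s)) := by
  have h := h.lift
  have h' := h'.lift
  have h₂ := h.lift
  have h₂' := h'.lift
  unfold MCVEdge; infer_instance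

theorem mcvEdge_zero (M : Model N S) [hM : M.Std] {c W B B' u x y : N} (hx : x < W) (hy : y < x) :
    M.MCVEdge c W B B' u (layer c W 0 x y) ↔ u = B' + (W + M.pair y x) ∨ u = layer c W 3 y 0 := by
  have h0 : 0 < W := zero_le.trans_lt hx
  constructor
  · rintro ⟨x', hx', ⟨y', hy', h, h'⟩ | ⟨y', hy', h, h'⟩ | ⟨h, h'⟩ | ⟨h, h'⟩⟩
    · obtain ⟨-, rfl, rfl⟩ := layer_inj M (by norm_num) (by norm_num) (hy.trans hx) (hy'.trans hx') h
      exact h'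
    · exact absurd (layer_inj M (by norm_num) (by norm_num) (hy.trans hx) (hy'.trans hx') h).1
        (by norm_num)
    · exact absurd (layer_inj M (by norm_num) (by norm_num) (hy.trans hx) h0 h).1 (by norm_num)
    · exact absurd (layer_inj M (by norm_num) (by norm_num) (hy.trans hx) h0 h).1 (by norm_num)
  · exact fun h => ⟨x, hx, Or.inl ⟨y, hy, rfl, h⟩⟩

theorem mcvEdge_one (M : Model N S) [hM : M.Std] {c W B B' u x y : N} (hx : x < W) (hy : y < x) :
    M.MCVEdge c W B B' u (layer c W 1 x y) ↔
      u = B + (W + M.pair y x) ∨ u = B' + x ∨ u = layer c W 3 y 0 := by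
  have h0 : 0 < W := zero_le.trans_lt hx
  constructor
  · rintro ⟨x', hx', ⟨y', hy', h, h'⟩ | ⟨y', hy', h, h'⟩ | ⟨h, h'⟩ | ⟨h, h'⟩⟩
    · exact absurd (layer_inj M (by norm_num) (by norm_num) (hy.trans hx) (hy'.trans hx') h).1
        (by norm_num)
    · obtain ⟨-, rfl, rfl⟩ := layer_inj M (by norm_num) (by norm_num) (hy.trans hx) (hy'.trans hx') h
      exact h'
    · exact absurd (layer_inj M (by norm_num) (by norm_num) (hy.trans hx) h0 h).1 (by norm_num)
    · exact absurd (layer_inj M (by norm_num) (by norm_num) (hy.trans hx) h0 h).1 (by norm_num)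
  · exact fun h => ⟨x, hx, Or.inr (Or.inl ⟨y, hy, rfl, h⟩)⟩

theorem mcvEdge_two (M : Model N S) [hM : M.Std] {c W B B' u x : N} (hx : x < W) :
    M.MCVEdge c W B B' u (layer c W 2 x 0) ↔ u = B + x ∨ ∃ y, y < x ∧ u = layer c W 0 x y := by
  have h0 : 0 < W := zero_le.trans_lt hx
  constructor
  · rintro ⟨x', hx', ⟨y', hy', h, h'⟩ | ⟨y', hy', h, h'⟩ | ⟨h, h'⟩ | ⟨h, h'⟩⟩
    · exact absurd (layer_inj M (by norm_num) (by norm_num) h0 (hy'.trans hx') h).1 (by norm_num)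
    · exact absurd (layer_inj M (by norm_num) (by norm_num) h0 (hy'.trans hx') h).1 (by norm_num)
    · obtain ⟨-, rfl, -⟩ := layer_inj M (by norm_num) (by norm_num) h0 h0 h
      exact h'
    · exact absurd (layer_inj M (by norm_num) (by norm_num) h0 h0 h).1 (by norm_num)
  · exact fun h => ⟨x, hx, Or.inr (Or.inr (Or.inl ⟨rfl, h⟩))⟩

theorem mcvEdge_three (M : Model N S) [hM : M.Std] {c W B B' u x : N} (hx : x < W) :
    M.MCVEdge c W B B' u (layer c W 3 x 0) ↔
      2 ≤ x ∧ (u = layer c W 2 x 0 ∨ ∃ y, y < x ∧ u = layer c W 1 x y) := by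
  have h0 : 0 < W := zero_le.trans_lt hx
  constructor
  · rintro ⟨x', hx', ⟨y', hy', h, h'⟩ | ⟨y', hy', h, h'⟩ | ⟨h, h'⟩ | ⟨h, h'⟩⟩
    · exact absurd (layer_inj M (by norm_num) (by norm_num) h0 (hy'.trans hx') h).1 (by norm_num)
    · exact absurd (layer_inj M (by norm_num) (by norm_num) h0 (hy'.trans hx') h).1 (by norm_num)
    · exact absurd (layer_inj M (by norm_num) (by norm_num) h0 h0 h).1 (by norm_num)
    · obtain ⟨-, rfl, -⟩ := layer_inj M (by norm_num) (by norm_num) h0 h0 h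
      exact h'
  · exact fun h => ⟨x, hx, Or.inr (Or.inr (Or.inr ⟨rfl, h⟩))⟩

/-- Type and edges of a gate of the circuit are themselves Boolean values, not known in M. Hence the
network computes both alternatives: Y(x) is (C(x) ∧ ⋀_{y<x} (¬E(y,x) ∨ Y(y))) ∨ ⋁_{y<x} (E(y,x) ∧
¬C(x) ∧ Y(y)). Kinds 0 and 1 are the inner disjunctions and conjunctions, kind 2 is the first
disjunct, and kind 3 is Y(x). -/
theorem Forcing.exists_mcv (F : M.Forcing n r I G) {C E : Set N} (hC : M.IsGen G C)
    (hE : M.IsGen G E) (W : N) :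
    ∃ Y, M.IsGen G Y ∧ ∀ x < W, x ∈ Y ↔ x = 1 ∨ (2 ≤ x ∧
      ((x ∈ C ∧ ∀ y < x, M.pair y x ∈ E → y ∈ Y) ∨
        (x ∉ C ∧ ∃ y < x, M.pair y x ∈ E ∧ y ∈ Y))) := by
  obtain ⟨Q, B, B', hQ⟩ := F.exists_literals (F.isGen_join hC hE W (M.pair W W)) (W + M.pair W W)
  obtain ⟨c, hc⟩ : ∃ c, c = n + (B + B' + (W + M.pair W W)) := ⟨_, rfl⟩
  have hp {x y : N} (hx : x < W) (hy : y < x) : M.pair y x < M.pair W W :=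
    pair_lt_pair (hy.trans hx) hx
  have hB {i : N} (hi : i < W + M.pair W W) : B + i < c := by
    rw [hc]
    refine lt_of_lt_of_le ?_ le_add_self
    calc B + i < B + (W + M.pair W W) := by gcongr
      _ ≤ _ := by gcongr; exact le_self_add
  have hB' {i : N} (hi : i < W + M.pair W W) : B' + i < c := by
    rw [hc]
    refine lt_of_lt_of_le ?_ le_add_self
    calc B' + i < B' + (W + M.pair W W) := by gcongr
      _ ≤ _ := by gcongr; exact le_add_self
  -- Gates of kind 3 have predecessors only for x ≥ 2. So Y(1) is an empty conjunction and true,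
  -- Y(0) an empty disjunction and false.
  obtain ⟨Q', hQ', hgate⟩ := exists_extension M Q c (layer c W 0 W 0)
    (fun z => ∃ x, x < W ∧ ((∃ y, y < x ∧ z = layer c W 1 x y) ∨ z = layer c W 2 x 0 ∨
      (x = 1 ∧ z = layer c W 3 x 0))) (fun _ => False) (fun u z => M.MCVEdge c W B B' u z)
  have hval {i : N} (hi : i < c) : Val G Q' i ↔ Val G Q i := (F.val_iff_of_sameBelow hQ' hi).symm
  have hW {x : N} (hx : x < W) : x < W + M.pair W W := hx.trans_le le_self_add
  have hWp {x y : N} (hx : x < W) (hy : y < x) : W + M.pair y x < W + M.pair W W :=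
    (add_lt_add_iff_left W).2 (hp hx hy)
  have hmemC {x : N} (hx : x < W) : (x < W ∧ x ∈ C ∨ ∃ k < M.pair W W, x = W + k ∧ k ∈ E) ↔ x ∈ C := by
    constructor
    · rintro (h | ⟨k, -, rfl, -⟩)
      · exact h.2
      · exact absurd hx (not_lt.2 le_self_add)
    · exact fun h => Or.inl ⟨hx, h⟩
  have hmemE {x y : N} (hx : x < W) (hy : y < x) : (W + M.pair y x < W ∧ W + M.pair y x ∈ C ∨
      ∃ k < M.pair W W, W + M.pair y x = W + k ∧ k ∈ E) ↔ M.pair y x ∈ E := by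
    constructor
    · rintro (⟨h, -⟩ | ⟨k, -, h, h'⟩)
      · exact absurd h (not_lt.2 le_self_add)
      · rwa [add_left_cancel h]
    · exact fun h => Or.inr ⟨_, hp hx hy, rfl, h⟩
  have vC {x : N} (hx : x < W) : Val G Q' (B + x) ↔ x ∈ C :=
    (hval (hB (hW hx))).trans ((hQ x (hW hx)).1.trans (hmemC hx))
  have vC' {x : N} (hx : x < W) : Val G Q' (B' + x) ↔ x ∉ C :=
    (hval (hB' (hW hx))).trans ((hQ x (hW hx)).2.trans (not_congr (hmemC hx)))
  have vE {x y : N} (hx : x < W) (hy : y < x) :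
      Val G Q' (B + (W + M.pair y x)) ↔ M.pair y x ∈ E :=
    (hval (hB (hWp hx hy))).trans ((hQ _ (hWp hx hy)).1.trans (hmemE hx hy))
  have vE' {x y : N} (hx : x < W) (hy : y < x) :
      Val G Q' (B' + (W + M.pair y x)) ↔ M.pair y x ∉ E :=
    (hval (hB' (hWp hx hy))).trans ((hQ _ (hWp hx hy)).2.trans (not_congr (hmemE hx hy)))
  have hc' (κ x y : N) : c ≤ layer c W κ x y := le_self_add
  have hn (κ x y : N) : n ≤ layer c W κ x y := (hc ▸ le_self_add : n ≤ c).trans (hc' κ x y)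
  have hg {κ x y : N} (hκ : κ < 4) (hx : x < W) (hy : y < W) :=
    hgate (layer c W κ x y) (hc' κ x y) (layer_lt M hκ hy (Or.inl hx))
  have hclt {i κ x y : N} (hi : i < c) : i < layer c W κ x y := hi.trans_le (hc' κ x y)
  have v0 {x y : N} (hx : x < W) (hy : y < x) : Val G Q' (layer c W 0 x y) ↔
      (M.pair y x ∈ E → Val G Q' (layer c W 3 y 0)) := by
    have h0 : 0 < W := zero_le.trans_lt hx
    obtain ⟨h1, h2, h3⟩ := hg (κ := 0) (by norm_num) hx (hy.trans hx)
    rw [F.val_or (hn _ _ _) _ (fun h => h2.1 h)]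
    · simp only [h3, mcvEdge_zero M hx hy]
      constructor
      · rintro ⟨_, ⟨-, rfl | rfl⟩, h⟩ he
        · exact absurd he ((vE' hx hy).1 h)
        · exact h
      · intro h
        by_cases he : M.pair y x ∈ E
        · exact ⟨_, ⟨layer_lt M (by norm_num) h0 (Or.inl hy), Or.inr rfl⟩, h he⟩
        · exact ⟨_, ⟨hclt (hB' (hWp hx hy)), Or.inl rfl⟩, (vE' hx hy).2 he⟩
    · rw [h1]
      rintro ⟨x', hx', ⟨y', hy', h⟩ | h | ⟨-, h⟩⟩
      · exact absurd (layer_inj M (by norm_num) (by norm_num) (hy.trans hx) (hy'.trans hx') h).1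
          (by norm_num)
      · exact absurd (layer_inj M (by norm_num) (by norm_num) (hy.trans hx) h0 h).1 (by norm_num)
      · exact absurd (layer_inj M (by norm_num) (by norm_num) (hy.trans hx) h0 h).1 (by norm_num)
  have v1 {x y : N} (hx : x < W) (hy : y < x) : Val G Q' (layer c W 1 x y) ↔
      (M.pair y x ∈ E ∧ x ∉ C ∧ Val G Q' (layer c W 3 y 0)) := by
    have h0 : 0 < W := zero_le.trans_lt hx
    obtain ⟨h1, h2, h3⟩ := hg (κ := 1) (by norm_num) hx (hy.trans hx)
    rw [F.val_and (hn _ _ _) (h1.2 ⟨x, hx, Or.inl ⟨y, hy, rfl⟩⟩) (fun h => h2.1 h)]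
    simp only [h3, mcvEdge_one M hx hy]
    constructor
    · exact fun h => ⟨(vE hx hy).1 (h _ ⟨hclt (hB (hWp hx hy)), Or.inl rfl⟩),
        (vC' hx).1 (h _ ⟨hclt (hB' (hW hx)), Or.inr (Or.inl rfl)⟩),
        h _ ⟨layer_lt M (by norm_num) h0 (Or.inl hy), Or.inr (Or.inr rfl)⟩⟩
    · rintro ⟨h4, h5, h6⟩ _ ⟨-, rfl | rfl | rfl⟩
      exacts [(vE hx hy).2 h4, (vC' hx).2 h5, h6]
  have v2 {x : N} (hx : x < W) : Val G Q' (layer c W 2 x 0) ↔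
      (x ∈ C ∧ ∀ y < x, Val G Q' (layer c W 0 x y)) := by
    have h0 : 0 < W := zero_le.trans_lt hx
    obtain ⟨h1, h2, h3⟩ := hg (κ := 2) (by norm_num) hx h0
    rw [F.val_and (hn _ _ _) (h1.2 ⟨x, hx, Or.inr (Or.inl rfl)⟩) (fun h => h2.1 h)]
    simp only [h3, mcvEdge_two M hx]
    constructor
    · exact fun h => ⟨(vC hx).1 (h _ ⟨hclt (hB (hW hx)), Or.inl rfl⟩), fun y hy =>
        h _ ⟨layer_lt M (by norm_num) (hy.trans hx) (Or.inr ⟨rfl, by norm_num⟩),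
          Or.inr ⟨y, hy, rfl⟩⟩⟩
    · rintro ⟨h4, h5⟩ _ ⟨-, rfl | ⟨y, hy, rfl⟩⟩
      exacts [(vC hx).2 h4, h5 y hy]
  have v3 {x : N} (hx : x < W) : Val G Q' (layer c W 3 x 0) ↔ x = 1 ∨ (2 ≤ x ∧
      (Val G Q' (layer c W 2 x 0) ∨ ∃ y < x, Val G Q' (layer c W 1 x y))) := by
    have h0 : 0 < W := zero_le.trans_lt hx
    obtain ⟨h1, h2, h3⟩ := hg (κ := 3) (by norm_num) hx h0
    rcases eq_or_ne x 1 with rfl | hx1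
    · rw [F.val_and (hn _ _ _) (h1.2 ⟨1, hx, Or.inr (Or.inr ⟨rfl, rfl⟩)⟩) (fun h => h2.1 h)]
      simp only [h3, mcvEdge_three M hx, true_or, iff_true]
      rintro u ⟨-, h, -⟩
      exact absurd h (not_le.2 one_lt_two)
    · rw [F.val_or (hn _ _ _) _ (fun h => h2.1 h)]
      · simp only [h3, mcvEdge_three M hx]
        constructor
        · rintro ⟨_, ⟨-, h, rfl | ⟨y, hy, rfl⟩⟩, h'⟩
          · exact Or.inr ⟨h, Or.inl h'⟩
          · exact Or.inr ⟨h, Or.inr ⟨y, hy, h'⟩⟩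
        · rintro (h | ⟨h, h' | ⟨y, hy, h'⟩⟩)
          · exact absurd h hx1
          · exact ⟨_, ⟨layer_lt M (by norm_num) h0 (Or.inr ⟨rfl, by norm_num⟩), h, Or.inl rfl⟩, h'⟩
          · exact ⟨_, ⟨layer_lt M (by norm_num) (hy.trans hx) (Or.inr ⟨rfl, by norm_num⟩), h,
              Or.inr ⟨y, hy, rfl⟩⟩, h'⟩
      · rw [h1]
        rintro ⟨x', hx', ⟨y', hy', h⟩ | h | ⟨h', h⟩⟩
        · exact absurd (layer_inj M (by norm_num) (by norm_num) h0 (hy'.trans hx') h).1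
            (by norm_num)
        · exact absurd (layer_inj M (by norm_num) (by norm_num) h0 h0 h).1 (by norm_num)
        · exact hx1 ((layer_inj M (by norm_num) (by norm_num) h0 h0 h).2.1.trans h')
  refine ⟨_, F.isGen_val Q' W (layer c W 0 W 0) (fun x => layer c W 3 x 0)
    (fun x hx => layer_lt M (by norm_num) (zero_le.trans_lt hx) (Or.inl hx)), fun x hx => ?_⟩
  have hY {y : N} (hy : y < x) : y ∈ {i | i < W ∧ Val G Q' (layer c W 3 i 0)} ↔
      Val G Q' (layer c W 3 y 0) := and_iff_right (hy.trans hx)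
  refine (and_iff_right hx).trans ((v3 hx).trans (or_congr_right (and_congr_right fun _ =>
    or_congr ((v2 hx).trans (and_congr_right fun _ => forall₂_congr fun y hy => ?_)) ?_)))
  · rw [v0 hx hy, hY hy]
  · constructor
    · rintro ⟨y, hy, h⟩
      obtain ⟨h1, h2, h3⟩ := (v1 hx hy).1 h
      exact ⟨h2, y, hy, h1, (hY hy).2 h3⟩
    · rintro ⟨h2, y, hy, h1, h3⟩
      exact ⟨y, hy, (v1 hx hy).2 ⟨h1, h2, (hY hy).1 h3⟩⟩

theorem Forcing.mcv (F : M.Forcing n r I G) : (M.generic G).MCV := by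
  intro a C E
  -- Adding 2 covers the positions 0 and 1 also when a is small.
  obtain ⟨Y, hY, h⟩ := F.exists_mcv C.2 E.2 (a + 2)
  have h2 : a + 2 = a + 1 + 1 := by rw [add_assoc, one_add_one_eq_two]
  refine ⟨⟨Y, hY⟩, ?_, ?_, fun x hx hx2 => ?_⟩
  · change M.zero ∉ Y
    rw [hM.zero_eq, h 0 (by rw [h2]; exact (lt_add_one M _ _).2 zero_le)]
    rintro (h | ⟨h, -⟩)
    · exact zero_ne_one h
    · exact absurd h (not_le.2 zero_lt_two)
  · change M.one ∈ Y
    rw [one_eq, h 1 (by rw [h2]; exact (lt_add_one M _ _).2 le_add_self)]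
    exact Or.inl rfl
  · replace hx : x < a := (lt_iff (M := M) _ _).1 hx
    replace hx2 : 2 ≤ x := by
      rw [← two_eq (M := M), ← hM.le_iff]; exact hx2
    change x ∈ Y ↔ (x ∈ C.1 ∧ ∀ y, M.lt y x → M.pair y x ∈ E.1 → y ∈ Y) ∨
      (x ∉ C.1 ∧ ∃ y, M.lt y x ∧ M.pair y x ∈ E.1 ∧ y ∈ Y)
    rw [h x (hx.trans_le le_self_add)]
    simp only [lt_iff]
    constructor
    · rintro (rfl | h)
      · exact absurd hx2 (not_le.2 one_lt_two)
      · exact h.2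
    · exact fun h => Or.inr ⟨hx2, h⟩

theorem Forcing.vp (F : M.Forcing n r I G) : (M.generic G).VP :=
  ⟨⟨F.basic, F.comp⟩, F.mcv⟩

end Forcing

end Model

end TwoSorted

/-- A structure without strings. -/
theorem TwoSorted.Model.generic_vp_of_isEmpty {N : Type u} {S : Type v} [IsEmpty S]
    {M : TwoSorted.Model N S} (hM : M.Basic) (G : Set M.Circ) : (M.generic G).VP :=
  have _ : IsEmpty (M.GenericStrings G) := ⟨fun ⟨_, _, X, _⟩ => isEmptyElim X⟩
  ⟨⟨⟨hM.b1, hM.b2, hM.b3, hM.b4, hM.b5, hM.b6, hM.b7, hM.b8, hM.b9, hM.b10, hM.b11, hM.b12,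
    fun X => isEmptyElim X, fun X => isEmptyElim X, fun X => isEmptyElim X⟩,
    fun _ _ _ σ => isEmptyElim (σ 0)⟩, fun _ C => isEmptyElim C⟩

/-- Let `(M₀, M)` be a model of `VP`, let `n ∈ M₀`, let `𝔹` be the Boolean algebra of circuits of
`(M₀, M)` in the inputs `p_0, …, p_{n-1}` modulo either of the two orders, and let `G` be a generic
filter of `𝔹` over an `M₀`-complete ideal `I`. Then `(M₀, M[G])` is a model of `VP`. -/
theorem mainTheorem8 {N : Type u} {S : Type v} (M : TwoSorted.Model N S) (hM : M.VP) (n : N)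
    (r : M.Circ → M.Circ → Prop) (hr : r = M.leA n ∨ r = M.leEF n)
    (I : Set M.Circ) (hI : M.IsIdeal r I) (hIc : M.IsComplete n I)
    (G : Set M.Circ) (hG : M.IsGeneric r I G) :
    (M.generic G).VP := by
  -- If M has no strings, comprehension and hence induction are vacuous for it, but then M[G] has no
  -- strings either and only the number axioms matter.
  cases isEmpty_or_nonempty S with
  | inl _ => exact TwoSorted.Model.generic_vp_of_isEmpty hM.1.1 G
  | inr _ =>
    obtain ⟨_, _, _, _, _⟩ := hM.1.exists_std
    have hK : Nonempty (M.Calc n r) := by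
      rcases hr with rfl | rfl
      · exact TwoSorted.Model.nonempty_calc_leA hM.2 n
      · exact TwoSorted.Model.nonempty_calc_leEF M n
    exact TwoSorted.Model.Forcing.vp ⟨hK.some, hI, hIc, hG⟩
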